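/- Let $(M^3,g)$ be a connected smooth Riemannian $3$-manifold with non-empty, connected boundary $\Sigma=\partial M$, and suppose that $(M,g)$ is asymptotically flat: there are a compact set $K\subset M$, a number $R>0$ and a diffeomorphism $M\setminus K\cong\{y\in\mathbb R^3: |y|>R\}$ in whose coordinates, for some $\tau>0$, $\partial^\alpha(g_{ij}-\delta_{ij})=O(|y|^{-\tau-|\alpha|})$ for all $|\alpha|\le 2$. Let $u\in C^2(M)$ (up to the boundary) solve $$\Delta_g u=0 \text{ on } M,\qquad u=1 \text{ on } \Sigma,\qquad u\to 0 \text{ at infinity},$$ let $w=-\log u$, and let $\Sigma_t=\{x\in M: w(x)=t\}$. Let $da$ denote the two-dimensional Hausdorff measure of $(M,g)$, normalized to agree with surface area. Then, for every $t\ge 0$, $|\nabla w|$ is $da$-integrable on $\Sigma_t$ and on $\Sigma$, and $$\int_{\Sigma_t}|\nabla w|\,da=C_0\,e^{t},\qquad\text{where } C_0=\int_{\Sigma}|\nabla w|\,da .$$ -/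

import Mathlib

open Set Filter MeasureTheory Bundle Manifold
open scoped Topology ContDiff Manifold

noncomputable section

/-- The model vector space `ℝ³` with its Euclidean norm. -/
abbrev E3 : Type := EuclideanSpace ℝ (Fin 3)

/-- The `i`-th standard basis vector of `ℝ³`. -/
def stdVec (i : Fin 3) : E3 := EuclideanSpace.single i (1 : ℝ)

section Riemannian

variable {M : Type*} [MetricSpace M] [ChartedSpace (EuclideanHalfSpace 3) M]
  [IsManifold (𝓡∂ 3) ∞ M] [RiemannianBundle (fun x : M ↦ TangentSpace (𝓡∂ 3) x)]

/-- The components `g_{ij}(y) = g(∂_i ψ(y), ∂_j ψ(y))` of the Riemannian metric in the coordinates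
given by a local parametrization `ψ : ℝ³ ⊇ s → M`. -/
def metricCoeff (ψ : E3 → M) (s : Set E3) (y : E3) : Matrix (Fin 3) (Fin 3) ℝ :=
  Matrix.of fun i j ↦
    inner ℝ (mfderivWithin 𝓘(ℝ, E3) (𝓡∂ 3) ψ s y (stdVec i))
      (mfderivWithin 𝓘(ℝ, E3) (𝓡∂ 3) ψ s y (stdVec j))

/-- The Laplace-Beltrami operator in the coordinates given by a parametrization `ψ` of a piece of
`M` by a piece of `s`:
`Δ u = (det g)^{-1/2} ∑_i ∂_i ((det g)^{1/2} ∑_j g^{ij} ∂_j u)`. -/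
def coordLaplacian (ψ : E3 → M) (s : Set E3) (u : M → ℝ) (y : E3) : ℝ :=
  (√(metricCoeff ψ s y).det)⁻¹ *
    ∑ i, fderivWithin ℝ
      (fun z ↦ √(metricCoeff ψ s z).det *
        ∑ j, (metricCoeff ψ s z)⁻¹ i j * fderivWithin ℝ (u ∘ ψ) s z (stdVec j))
      s y (stdVec i)

/-- A function on the Riemannian manifold with boundary `M` is (classically) harmonic if it is `C²`
up to the boundary and its Laplacian vanishes at every point, computed in every smooth chart.
At boundary points the derivatives are the one-sided ones, taken within the half-space. -/
def IsHarmonic (u : M → ℝ) : Prop :=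
  ContMDiff (𝓡∂ 3) 𝓘(ℝ, ℝ) 2 u ∧
    ∀ e ∈ IsManifold.maximalAtlas (𝓡∂ 3) ∞ M, ∀ x ∈ e.source,
      coordLaplacian (e.extend (𝓡∂ 3)).symm (range (𝓡∂ 3)) u (e.extend (𝓡∂ 3) x) = 0

/-- The Riemannian gradient `∇f(x) ∈ T_x M`, i.e. the vector with `g(∇f(x), v) = df_x(v)`. -/
def riemGradient (f : M → ℝ) (x : M) : TangentSpace (𝓡∂ 3) x :=
  haveI : FiniteDimensional ℝ (TangentSpace (𝓡∂ 3) x) :=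
    inferInstanceAs (FiniteDimensional ℝ E3)
  haveI : CompleteSpace (TangentSpace (𝓡∂ 3) x) := FiniteDimensional.complete ℝ _
  (InnerProductSpace.toDual ℝ (TangentSpace (𝓡∂ 3) x)).symm
    (mfderiv (𝓡∂ 3) 𝓘(ℝ, ℝ) f x)

/-- The defining property of the gradient. -/
theorem inner_riemGradient (f : M → ℝ) (x : M) (v : TangentSpace (𝓡∂ 3) x) :
    inner ℝ (riemGradient f x) v = mfderiv (𝓡∂ 3) 𝓘(ℝ, ℝ) f x v := by
  haveI : FiniteDimensional ℝ (TangentSpace (𝓡∂ 3) x) :=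
    inferInstanceAs (FiniteDimensional ℝ E3)
  haveI : CompleteSpace (TangentSpace (𝓡∂ 3) x) := FiniteDimensional.complete ℝ _
  unfold riemGradient
  exact InnerProductSpace.toDual_symm_apply

variable (M) in
/-- `M` is asymptotically flat (with one end, of some order `τ > 0`): outside a compact set, `M` is
diffeomorphic to the complement of a closed ball in `ℝ³`, and in these coordinates
`∂^α (g_{ij} - δ_{ij}) = O(|y|^{-τ-|α|})` for `|α| ≤ 2`. -/
def IsAsymptoticallyFlat : Prop :=
  ∃ (K : Set M) (R τ C : ℝ) (Φ : OpenPartialHomeomorph M E3),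
    IsCompact K ∧ 0 < R ∧ 0 < τ ∧
    Φ.source = Kᶜ ∧ Φ.target = {y | R < ‖y‖} ∧
    ContMDiffOn (𝓡∂ 3) 𝓘(ℝ, E3) ∞ Φ Φ.source ∧
    ContMDiffOn 𝓘(ℝ, E3) (𝓡∂ 3) ∞ Φ.symm Φ.target ∧
    ∀ k ≤ 2, ∀ i j : Fin 3, ∀ y ∈ Φ.target,
      ‖iteratedFDeriv ℝ k
        (fun z ↦ metricCoeff Φ.symm Φ.target z i j - (1 : Matrix (Fin 3) (Fin 3) ℝ) i j) y‖
        ≤ C * ‖y‖ ^ (-τ - (k : ℝ))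

end Riemannian

end

/-! Since |∇w| = |∇u|/|u| where u ≠ 0, the statement amounts to this: the flux of ∇u through {u = c}
is finite and equal to the flux through {u = 1} for every c in (0, 1]. The classical argument
applies the divergence theorem between two level sets. Here u is only C², which is below the
regularity that Sard's theorem needs in dimension three, and the claim concerns every level,
critical ones included. So the divergence theorem is replaced by the weak equation ∫⟨∇ζ, ∇u⟩ = 0 for
ζ compactly supported off the boundary (`integral_gradPair_eq_zero`).

The test function is ζ = Φ(u)χ. Here Φ is the primitive of a difference φ₁ − φ₀ of probability
densities supported inside (a, 1), and χ cuts off to the regular set {|∇u|² ≥ 1/(n+1)}. Near a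
regular point u can be made a coordinate, so a coarea formula holds for the weight χ
(`hasCoarea_of_regular`). The weak equation then says that two averages over levels of the
χ-weighted flux differ by at most ∫_{u ≥ a} |⟨∇χ, ∇u⟩| (`abs_sub_integral_levelFlux_le`). The
weighted flux is continuous in the level, so φ₁ may concentrate at a single level c, with c = 1
included (`abs_levelFlux_sub_le`).

The decisive estimate is |⟨∇|∇u|², ∇u⟩| ≤ C|∇u|² on compact sets, which holds because the Hessian is
bounded (`exists_abs_gradPair_gradPair_le`). It bounds the error integrand uniformly in n. That
integrand also tends to 0 pointwise, so dominated convergence kills the error, and monotone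
convergence then removes the cutoff (`exists_flux_eq`). Critical points contribute nothing to the
flux.

Surface measure is Hausdorff measure, so an area formula is proved for maps whose distances are
asymptotic to a norm, and chart parametrizations of the Riemannian distance are shown to be such
maps (`chartParam_hasMetricDeriv`). At regular boundary points u − 1 is reflected oddly across the
boundary, so that {u = 1} becomes the last leaf of the coordinate family. A weak maximum principle
shows that ∇u = 0 wherever u > 1 or u < 0. Asymptotic flatness supplies σ-compactness, hence
partitions of unity. -/

/-! ### The area formula for maps with a sharp metric derivative -/

/-- Near `z`, within `S`, the distance between the images under `Ψ` is asymptotic to the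
gauge `q` of the difference, uniformly in pairs of points. -/
def HasMetricDeriv {V X : Type*} [NormedAddCommGroup V] [MetricSpace X] (Ψ : V → X) (S : Set V)
    (z : V) (q : V → ℝ) : Prop :=
  ∀ ε > 0, ∃ r > 0, ∀ a ∈ Metric.ball z r ∩ S, ∀ b ∈ Metric.ball z r ∩ S,
    (1 - ε) * q (a - b) ≤ dist (Ψ a) (Ψ b) ∧ dist (Ψ a) (Ψ b) ≤ (1 + ε) * q (a - b)

/-- Equal values of `g` force equal values of `f`, so on `B` the map `f` factors through `g` by a
`K`-Lipschitz map of `g '' B`. Injectivity is not needed. -/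
theorem hausdorffMeasure_image_le_of_dist_le {V X Y : Type*} [MetricSpace X] [MeasurableSpace X]
    [BorelSpace X] [MetricSpace Y] [MeasurableSpace Y] [BorelSpace Y] {f : V → X} {g : V → Y}
    {B : Set V} {K : NNReal} (h : ∀ a ∈ B, ∀ b ∈ B, dist (f a) (f b) ≤ K * dist (g a) (g b))
    {d : ℝ} (hd : 0 ≤ d) :
    Measure.hausdorffMeasure d (f '' B) ≤ (K : ENNReal) ^ d * Measure.hausdorffMeasure d (g '' B) := by
  rcases B.eq_empty_or_nonempty with rfl | ⟨b₀, -⟩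
  · simp
  have : Nonempty V := ⟨b₀⟩
  have hmem : ∀ a ∈ B, Function.invFunOn g B (g a) ∈ B := fun a ha ↦
    Function.invFunOn_mem ⟨a, ha, rfl⟩
  have heq : ∀ a ∈ B, g (Function.invFunOn g B (g a)) = g a := fun a ha ↦
    Function.invFunOn_eq ⟨a, ha, rfl⟩
  have himg : f '' B = (f ∘ Function.invFunOn g B) '' (g '' B) := by
    rw [← image_comp]
    refine image_congr fun a ha ↦ ?_
    have := h a ha _ (hmem a ha)
    rw [heq a ha, dist_self, mul_zero] at this
    exact dist_le_zero.1 this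
  rw [himg]
  refine LipschitzOnWith.hausdorffMeasure_image_le (K := K) ?_ hd
  refine LipschitzOnWith.of_dist_le_mul ?_
  rintro _ ⟨a, ha, rfl⟩ _ ⟨b, hb, rfl⟩
  have := h _ (hmem a ha) _ (hmem b hb)
  rwa [heq a ha, heq b hb] at this

theorem euclideanHausdorffMeasure_image_le_of_dist_le {V X Y : Type*} [MetricSpace X]
    [MeasurableSpace X] [BorelSpace X] [MetricSpace Y] [MeasurableSpace Y] [BorelSpace Y]
    {f : V → X} {g : V → Y} {B : Set V} {K : NNReal}
    (h : ∀ a ∈ B, ∀ b ∈ B, dist (f a) (f b) ≤ K * dist (g a) (g b)) (m : ℕ) :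
    μHE[m] (f '' B) ≤ (K : ENNReal) ^ m * μHE[m] (g '' B) := by
  have := hausdorffMeasure_image_le_of_dist_le h (Nat.cast_nonneg m)
  rw [ENNReal.rpow_natCast] at this
  simp only [Measure.euclideanHausdorffMeasure_def, Measure.smul_apply, ENNReal.smul_def,
    smul_eq_mul]
  calc _ ≤ _ := mul_le_mul_right this _
    _ = _ := by ring

section Area

variable {m : ℕ} {X : Type*} [MetricSpace X] [MeasurableSpace X] [BorelSpace X]

/-- Comparison of `Ψ` with the linear model `A`, whose image has Lebesgue measure |det A| · vol B.
-/
theorem euclideanHausdorffMeasure_image_bounds {Ψ : EuclideanSpace ℝ (Fin m) → X}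
    {B : Set (EuclideanSpace ℝ (Fin m))}
    (A : EuclideanSpace ℝ (Fin m) →ₗ[ℝ] EuclideanSpace ℝ (Fin m)) {K : NNReal}
    (h1 : ∀ a ∈ B, ∀ b ∈ B, dist (Ψ a) (Ψ b) ≤ K * ‖A (a - b)‖)
    (h2 : ∀ a ∈ B, ∀ b ∈ B, ‖A (a - b)‖ ≤ K * dist (Ψ a) (Ψ b)) :
    μHE[m] (Ψ '' B) ≤ (K : ENNReal) ^ m * (ENNReal.ofReal |LinearMap.det A| * volume B) ∧
    ENNReal.ofReal |LinearMap.det A| * volume B ≤ (K : ENNReal) ^ m * μHE[m] (Ψ '' B) := by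
  have hv : μHE[m] (A '' B) = ENNReal.ofReal |LinearMap.det A| * volume B := by
    rw [EuclideanSpace.euclideanHausdorffMeasure_eq_volume, Measure.addHaar_image_linearMap]
  rw [← hv]
  refine ⟨euclideanHausdorffMeasure_image_le_of_dist_le (fun a ha b hb ↦ ?_) m,
    euclideanHausdorffMeasure_image_le_of_dist_le (fun a ha b hb ↦ ?_) m⟩
  · rw [dist_eq_norm (A a), ← map_sub]; exact h1 a ha b hb
  · rw [dist_eq_norm (A a), ← map_sub]; exact h2 a ha b hb

/-- A measure inequality that holds locally on a measurable set holds on it. -/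
theorem measure_le_of_locally_le {V : Type*} [TopologicalSpace V] [SecondCountableTopology V]
    [MeasurableSpace V] [BorelSpace V] {μ ν : Measure V} {S : Set V}
    (h : ∀ z ∈ S, ∃ U, IsOpen U ∧ z ∈ U ∧ ∀ B ⊆ U ∩ S, MeasurableSet B → μ B ≤ ν B)
    {B : Set V} (hB : MeasurableSet B) (hBS : B ⊆ S) : μ B ≤ ν B := by
  choose! U hUo hzU hU using h
  -- By the Lindelöf property countably many of the neighbourhoods suffice; making them disjoint
  -- reduces the claim to σ-additivity.
  obtain ⟨t, htS, htc, hcov⟩ := TopologicalSpace.countable_cover_nhdsWithin (f := U) (s := S)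
    (fun z hz ↦ mem_nhdsWithin_of_mem_nhds ((hUo z hz).mem_nhds (hzU z hz)))
  rcases t.eq_empty_or_nonempty with rfl | hne
  · have : B = ∅ := subset_empty_iff.1 (by simpa using hBS.trans hcov)
    simp [this]
  obtain ⟨e, rfl⟩ := htc.exists_eq_range hne
  let D : ℕ → Set V := fun n ↦ B ∩ disjointed (fun k ↦ U (e k)) n
  have hDm : ∀ n, MeasurableSet (D n) := fun n ↦
    hB.inter (MeasurableSet.disjointed (fun k ↦ (hUo _ (htS ⟨k, rfl⟩)).measurableSet) n)
  have hDd : Pairwise (Function.onFun Disjoint D) := fun i j hij ↦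
    ((disjoint_disjointed _ hij).mono inter_subset_right inter_subset_right)
  have hDU : B = ⋃ n, D n := by
    simp only [D]
    rw [← inter_iUnion, iUnion_disjointed]
    refine (inter_eq_left.2 (hBS.trans (hcov.trans ?_))).symm
    simp
  rw [hDU, measure_iUnion hDd hDm, measure_iUnion hDd hDm]
  refine ENNReal.tsum_le_tsum fun n ↦ hU (e n) (htS ⟨n, rfl⟩) _ ?_ (hDm n)
  exact fun x hx ↦ ⟨disjointed_subset (fun k ↦ U (e k)) n hx.2, hBS hx.1⟩

variable {S : Set (EuclideanSpace ℝ (Fin m))} {Ψ : EuclideanSpace ℝ (Fin m) → X}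
  {J : EuclideanSpace ℝ (Fin m) → ℝ}

/-- The hypotheses of the area formula: `Ψ` is injective on the measurable set `S` and has at each
point of `S` a sharp metric derivative with continuous positive Jacobian `J`. -/
structure HasMetricJacobian (Ψ : EuclideanSpace ℝ (Fin m) → X) (S : Set (EuclideanSpace ℝ (Fin m)))
    (J : EuclideanSpace ℝ (Fin m) → ℝ) : Prop where
  meas : MeasurableSet S
  inj : InjOn Ψ S
  cont : ContinuousOn J S
  pos : ∀ z ∈ S, 0 < J z
  deriv : ∀ z ∈ S, ∃ A : EuclideanSpace ℝ (Fin m) →ₗ[ℝ] EuclideanSpace ℝ (Fin m),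
    |LinearMap.det A| = J z ∧ HasMetricDeriv Ψ S z (fun v ↦ ‖A v‖)

theorem HasMetricJacobian.continuousOn (h : HasMetricJacobian Ψ S J) : ContinuousOn Ψ S := by
  intro z hz
  obtain ⟨A, -, hA⟩ := h.deriv z hz
  obtain ⟨r, hr, hrA⟩ := hA 1 one_pos
  rw [ContinuousWithinAt, tendsto_iff_dist_tendsto_zero]
  have hlim : Tendsto (fun a ↦ (1 + 1) * ‖A (a - z)‖) (𝓝[S] z) (𝓝 0) := by
    have hc : Continuous fun a ↦ (1 + 1) * ‖A (a - z)‖ := by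
      have := LinearMap.continuous_of_finiteDimensional A
      fun_prop
    have := (hc.tendsto z).mono_left (nhdsWithin_le_nhds (s := S))
    simpa using this
  refine squeeze_zero' (Eventually.of_forall fun _ ↦ dist_nonneg) ?_ hlim
  filter_upwards [inter_mem_nhdsWithin S (Metric.ball_mem_nhds z hr)] with a ha
  exact (hrA a ⟨ha.2, ha.1⟩ z ⟨Metric.mem_ball_self hr, hz⟩).2

theorem HasMetricJacobian.measurableEmbedding (h : HasMetricJacobian Ψ S J) :
    MeasurableEmbedding (S.domRestrict Ψ) :=
  h.continuousOn.measurableEmbedding h.meas h.inj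

/-- On a small ball `Ψ` is `K`-comparable with its derivative at `z`, which costs `K ^ m` in
measure. Replacing the constant `J z` by `J a` costs one more factor `K`. -/
theorem HasMetricJacobian.local_bounds (h : HasMetricJacobian Ψ S J) {z : EuclideanSpace ℝ (Fin m)}
    (hz : z ∈ S) {K : NNReal} (hK : 1 < K) :
    ∃ U, IsOpen U ∧ z ∈ U ∧ ∀ B ⊆ U ∩ S, MeasurableSet B →
      μHE[m] (Ψ '' B) ≤ (K : ENNReal) ^ (m + 1) * ∫⁻ a in B, ENNReal.ofReal (J a) ∧
      ∫⁻ a in B, ENNReal.ofReal (J a) ≤ (K : ENNReal) ^ (m + 1) * μHE[m] (Ψ '' B) := by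
  have hK' : (1 : ℝ) < K := by exact_mod_cast hK
  have hK0 : (0 : ℝ) < K := by linarith
  obtain ⟨A, hdet, hA⟩ := h.deriv z hz
  -- With ε = 1 − 1/K the lower factor 1 − ε is exactly 1/K, and the upper factor 1 + ε is at most K
  -- because K + 1/K ≥ 2.
  have hε : 0 < 1 - (K : ℝ)⁻¹ := by
    have := inv_lt_one_of_one_lt₀ hK'; linarith
  have hKε : 1 + (1 - (K : ℝ)⁻¹) ≤ K := by
    have : 0 ≤ ((K : ℝ) - 1) ^ 2 / K := by positivity
    have h2 : ((K : ℝ) - 1) ^ 2 / K = K - 2 + (K : ℝ)⁻¹ := by field_simp; ring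
    linarith
  obtain ⟨r, hr, hrA⟩ := hA _ hε
  have hJ1 : ∀ᶠ a in 𝓝[S] z, J a < K * J z :=
    (h.cont z hz).eventually_lt continuousWithinAt_const (by
      have := h.pos z hz; nlinarith)
  have hJ2 : ∀ᶠ a in 𝓝[S] z, J z < K * J a :=
    continuousWithinAt_const.eventually_lt (f := fun _ ↦ J z) (g := fun a ↦ K * J a)
      (continuousWithinAt_const.mul (h.cont z hz)) (by
      have := h.pos z hz; change J z < K * J z; nlinarith)
  obtain ⟨W, hWo, hzW, hW⟩ := mem_nhdsWithin.1 (hJ1.and hJ2)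
  refine ⟨Metric.ball z r ∩ W, Metric.isOpen_ball.inter hWo, ⟨Metric.mem_ball_self hr, hzW⟩,
    fun B hB hBm ↦ ?_⟩
  have hb := euclideanHausdorffMeasure_image_bounds (Ψ := Ψ) (B := B) A (K := K)
    (fun a ha b hb ↦ ((hrA a ⟨(hB ha).1.1, (hB ha).2⟩ b ⟨(hB hb).1.1, (hB hb).2⟩).2).trans
      (by gcongr))
    (fun a ha b hb ↦ by
      have := (hrA a ⟨(hB ha).1.1, (hB ha).2⟩ b ⟨(hB hb).1.1, (hB hb).2⟩).1
      rw [sub_sub_cancel, inv_mul_le_iff₀ hK0] at this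
      exact this)
  rw [hdet] at hb
  have hup : ENNReal.ofReal (J z) * volume B ≤ K * ∫⁻ a in B, ENNReal.ofReal (J a) := by
    rw [← lintegral_const_mul' _ _ ENNReal.coe_ne_top, ← setLIntegral_const]
    refine setLIntegral_mono' hBm fun a ha ↦ ?_
    have := (hW ⟨(hB ha).1.2, (hB ha).2⟩).2
    rw [← ENNReal.ofReal_coe_nnreal, ← ENNReal.ofReal_mul hK0.le]
    exact ENNReal.ofReal_le_ofReal this.le
  have hlo : ∫⁻ a in B, ENNReal.ofReal (J a) ≤ K * (ENNReal.ofReal (J z) * volume B) := by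
    rw [← setLIntegral_const, ← lintegral_const_mul' _ _ ENNReal.coe_ne_top]
    refine setLIntegral_mono' hBm fun a ha ↦ ?_
    have := (hW ⟨(hB ha).1.2, (hB ha).2⟩).1
    rw [← ENNReal.ofReal_coe_nnreal, ← ENNReal.ofReal_mul hK0.le]
    exact ENNReal.ofReal_le_ofReal this.le
  constructor
  · calc _ ≤ _ := hb.1
      _ ≤ (K : ENNReal) ^ m * (K * ∫⁻ a in B, ENNReal.ofReal (J a)) := by gcongr
      _ = _ := by ring
  · calc _ ≤ _ := hlo
      _ ≤ K * ((K : ENNReal) ^ m * μHE[m] (Ψ '' B)) := mul_le_mul_right hb.2 _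
      _ = _ := by ring

/-- The measure on the parameter domain that computes the Hausdorff measure of the image. -/
noncomputable def pullbackHausdorff (Ψ : EuclideanSpace ℝ (Fin m) → X)
    (S : Set (EuclideanSpace ℝ (Fin m))) : Measure (EuclideanSpace ℝ (Fin m)) :=
  (Measure.comap (S.domRestrict Ψ) μHE[m]).map Subtype.val

theorem HasMetricJacobian.pullbackHausdorff_apply (h : HasMetricJacobian Ψ S J)
    {B : Set (EuclideanSpace ℝ (Fin m))} (hB : MeasurableSet B) (hBS : B ⊆ S) :
    pullbackHausdorff Ψ S B = μHE[m] (Ψ '' B) := by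
  rw [pullbackHausdorff, Measure.map_apply measurable_subtype_coe hB,
    h.measurableEmbedding.comap_apply]
  congr 1
  ext x
  simp only [mem_image, mem_preimage, Subtype.exists, domRestrict_apply]
  exact ⟨fun ⟨a, _, hb, hx⟩ ↦ ⟨a, hb, hx⟩, fun ⟨a, hb, hx⟩ ↦ ⟨a, hBS hb, hb, hx⟩⟩

theorem ENNReal_le_of_forall_one_lt_pow {a b : ENNReal} {n : ℕ}
    (h : ∀ K : NNReal, 1 < K → a ≤ (K : ENNReal) ^ n * b) : a ≤ b := by
  have hlim : Tendsto (fun K : NNReal ↦ (K : ENNReal) ^ n * b) (𝓝[>] 1) (𝓝 ((1 : ENNReal) ^ n * b)) := by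
    refine ENNReal.Tendsto.mul_const ?_ (Or.inl (by simp))
    refine ((ENNReal.continuous_pow n).tendsto _).comp ?_
    exact (ENNReal.continuous_coe.tendsto 1).mono_left nhdsWithin_le_nhds
  rw [one_pow, one_mul] at hlim
  exact ge_of_tendsto hlim (eventually_nhdsWithin_of_forall fun K hK ↦ h K hK)

/-- **Area formula** for maps with a sharp metric derivative. -/
theorem HasMetricJacobian.measure_image (h : HasMetricJacobian Ψ S J)
    {B : Set (EuclideanSpace ℝ (Fin m))} (hB : MeasurableSet B) (hBS : B ⊆ S) :
    μHE[m] (Ψ '' B) = ∫⁻ a in B, ENNReal.ofReal (J a) := by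
  have hwd : ∀ B', MeasurableSet B' → (volume.withDensity fun a ↦ ENNReal.ofReal (J a)) B' =
      ∫⁻ a in B', ENNReal.ofReal (J a) := fun B' hB' ↦ withDensity_apply _ hB'
  -- Each inequality holds locally up to the factor `K ^ (m + 1)`, hence globally with that factor;
  -- then K → 1.
  apply le_antisymm
  · refine ENNReal_le_of_forall_one_lt_pow (n := m + 1) fun K hK ↦ ?_
    have := measure_le_of_locally_le (μ := pullbackHausdorff Ψ S)
      (ν := ((K : ENNReal) ^ (m + 1)) • volume.withDensity fun a ↦ ENNReal.ofReal (J a)) (S := S)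
      (fun z hz ↦ by
        obtain ⟨U, hUo, hzU, hU⟩ := h.local_bounds hz hK
        refine ⟨U, hUo, hzU, fun B' hB' hB'm ↦ ?_⟩
        rw [h.pullbackHausdorff_apply hB'm (hB'.trans inter_subset_right), Measure.smul_apply,
          hwd _ hB'm]
        exact (hU B' hB' hB'm).1) hB hBS
    rwa [h.pullbackHausdorff_apply hB hBS, Measure.smul_apply, hwd _ hB] at this
  · refine ENNReal_le_of_forall_one_lt_pow (n := m + 1) fun K hK ↦ ?_
    have := measure_le_of_locally_le
      (μ := volume.withDensity fun a ↦ ENNReal.ofReal (J a))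
      (ν := ((K : ENNReal) ^ (m + 1)) • pullbackHausdorff Ψ S) (S := S)
      (fun z hz ↦ by
        obtain ⟨U, hUo, hzU, hU⟩ := h.local_bounds hz hK
        refine ⟨U, hUo, hzU, fun B' hB' hB'm ↦ ?_⟩
        rw [Measure.smul_apply, h.pullbackHausdorff_apply hB'm (hB'.trans inter_subset_right),
          hwd _ hB'm]
        exact (hU B' hB' hB'm).2) hB hBS
    rwa [Measure.smul_apply, h.pullbackHausdorff_apply hB hBS, hwd _ hB] at this

/-- The area formula as an identity of measures, the form in which integrals and integrability are
transported to the parameter domain. -/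
theorem HasMetricJacobian.map_eq (h : HasMetricJacobian Ψ S J) :
    Measure.map (S.domRestrict Ψ)
      (Measure.comap (↑) (volume.withDensity fun a ↦ ENNReal.ofReal (J a))) =
      μHE[m].restrict (Ψ '' S) := by
  have he := h.measurableEmbedding
  ext B hB
  rw [Measure.map_apply he.measurable hB, (MeasurableEmbedding.subtype_coe h.meas).comap_apply,
    Measure.restrict_apply hB]
  have hBm : MeasurableSet (Subtype.val '' (S.domRestrict Ψ ⁻¹' B) : Set (EuclideanSpace ℝ (Fin m))) :=
    (MeasurableEmbedding.subtype_coe h.meas).measurableSet_image.2 (he.measurable hB)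
  rw [withDensity_apply _ hBm, ← h.measure_image hBm (by simp)]
  congr 1
  ext x
  simp only [mem_image, mem_preimage, Subtype.exists, domRestrict_apply, mem_inter_iff]
  constructor
  · rintro ⟨a, ⟨b, hb, hbB, rfl⟩, rfl⟩
    exact ⟨hbB, b, hb, rfl⟩
  · rintro ⟨hx, a, ha, rfl⟩
    exact ⟨a, ⟨a, ha, hx, rfl⟩, rfl⟩

theorem HasMetricJacobian.aemeasurable (h : HasMetricJacobian Ψ S J) :
    AEMeasurable (fun a ↦ (J a).toNNReal) (volume.restrict S) :=
  (h.cont.aemeasurable h.meas).real_toNNReal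

theorem HasMetricJacobian.integral_image (h : HasMetricJacobian Ψ S J) (g : X → ℝ) :
    ∫ x in Ψ '' S, g x ∂μHE[m] = ∫ a in S, J a * g (Ψ a) := by
  rw [← h.map_eq, h.measurableEmbedding.integral_map]
  simp only [Set.domRestrict_apply, ← Function.comp_apply (f := g), ENNReal.ofReal]
  rw [← (MeasurableEmbedding.subtype_coe h.meas).integral_map (g := fun a ↦ (g ∘ Ψ) a),
    map_comap_subtype_coe h.meas,
    setIntegral_withDensity_eq_setIntegral_smul₀ h.aemeasurable _ h.meas]
  refine setIntegral_congr_fun h.meas fun a ha ↦ ?_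
  simp only [NNReal.smul_def, Real.coe_toNNReal _ (h.pos a ha).le, Function.comp, smul_eq_mul]

theorem HasMetricJacobian.integrableOn_image (h : HasMetricJacobian Ψ S J) (g : X → ℝ) :
    IntegrableOn g (Ψ '' S) μHE[m] ↔ IntegrableOn (fun a ↦ J a * g (Ψ a)) S := by
  rw [IntegrableOn, ← h.map_eq, h.measurableEmbedding.integrable_map_iff]
  simp only [Set.domRestrict_eq, ENNReal.ofReal]
  rw [← Function.comp_assoc, ← (MeasurableEmbedding.subtype_coe h.meas).integrable_map_iff,
    map_comap_subtype_coe h.meas, restrict_withDensity h.meas,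
    integrable_withDensity_iff_integrable_smul₀ h.aemeasurable]
  refine integrableOn_congr_fun (fun a ha ↦ ?_) h.meas
  simp only [NNReal.smul_def, Real.coe_toNNReal _ (h.pos a ha).le, Function.comp, smul_eq_mul]

end Area

/-! ### Gram determinants and the metric in a chart -/

noncomputable section

/-- An injective linear map from `ℝ^m` to an inner product space has the same norms as an
endomorphism of `ℝ^m` whose determinant is the square root of the Gram determinant. -/
theorem exists_linearMap_norm_eq_of_injective {m : ℕ} {T : Type*} [NormedAddCommGroup T]
    [InnerProductSpace ℝ T] (D : EuclideanSpace ℝ (Fin m) →ₗ[ℝ] T) (hD : Function.Injective D)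
    (Gm : Matrix (Fin m) (Fin m) ℝ)
    (hG : ∀ i j, Gm i j = inner ℝ (D (EuclideanSpace.single i 1)) (D (EuclideanSpace.single j 1))) :
    0 < Gm.det ∧ ∃ A : EuclideanSpace ℝ (Fin m) →ₗ[ℝ] EuclideanSpace ℝ (Fin m),
      |LinearMap.det A| = √Gm.det ∧ ∀ v, ‖A v‖ = ‖D v‖ := by
  have hfr : Module.finrank ℝ (LinearMap.range D) = m := by
    rw [LinearMap.finrank_range_of_inj hD]; simp
  let b : OrthonormalBasis (Fin m) ℝ (LinearMap.range D) :=
    (stdOrthonormalBasis ℝ (LinearMap.range D)).reindex (finCongr hfr)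
  let A : EuclideanSpace ℝ (Fin m) →ₗ[ℝ] EuclideanSpace ℝ (Fin m) :=
    b.repr.toLinearEquiv.toLinearMap ∘ₗ D.rangeRestrict
  have hA : ∀ v, A v = b.repr (D.rangeRestrict v) := fun v ↦ rfl
  have hAin : ∀ v w, inner ℝ (A v) (A w) = inner ℝ (D v) (D w) := fun v w ↦ by
    rw [hA, hA, LinearIsometryEquiv.inner_map_map]; rfl
  let B := LinearMap.toMatrix (EuclideanSpace.basisFun (Fin m) ℝ).toBasis
    (EuclideanSpace.basisFun (Fin m) ℝ).toBasis A
  have hB : Gm = B.transpose * B := by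
    ext i j
    rw [hG, ← hAin, Matrix.mul_apply, PiLp.inner_apply]
    refine Finset.sum_congr rfl fun k _ ↦ ?_
    simp [B, LinearMap.toMatrix_apply, mul_comm]
  have hdet : Gm.det = LinearMap.det A ^ 2 := by
    rw [hB, Matrix.det_mul, Matrix.det_transpose, LinearMap.det_toMatrix, sq]
  have hinj : Function.Injective A := by
    intro v w h
    apply hD
    rw [hA, hA] at h
    exact congrArg Subtype.val (b.repr.injective h)
  have hne : LinearMap.det A ≠ 0 := by
    have hu : IsUnit A := (LinearMap.isUnit_iff_ker_eq_bot A).2 (LinearMap.ker_eq_bot.2 hinj)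
    exact (hu.map LinearMap.det).ne_zero
  refine ⟨by rw [hdet]; positivity, A, by rw [hdet, Real.sqrt_sq_eq_abs], fun v ↦ ?_⟩
  rw [hA, LinearIsometryEquiv.norm_map]; rfl

section ChartMetric

variable {M : Type*} [MetricSpace M] [ChartedSpace (EuclideanHalfSpace 3) M]
  [IsManifold (𝓡∂ 3) ∞ M] [RiemannianBundle (fun x : M ↦ TangentSpace (𝓡∂ 3) x)]

/-- The inverse of the preferred chart at `p`. -/
abbrev chartParam (p : M) : E3 → M := (extChartAt (𝓡∂ 3) p).symm

/-- The domain of the inverse of the preferred chart at `p`. -/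
abbrev chartDom (p : M) : Set E3 := (extChartAt (𝓡∂ 3) p).target

/-- The closed half-space on which charts are modelled. -/
abbrev halfSpace3 : Set E3 := range (𝓡∂ 3)

theorem mem_halfSpace3 {y : E3} : y ∈ halfSpace3 ↔ 0 ≤ y 0 := by
  rw [halfSpace3, range_modelWithCornersEuclideanHalfSpace]; rfl

/-- The derivative of the inverse of the preferred chart at `p`. -/
abbrev chartDeriv (p : M) (y : E3) : E3 →L[ℝ] TangentSpace (𝓡∂ 3) (chartParam p y) :=
  mfderivWithin 𝓘(ℝ, E3) (𝓡∂ 3) (chartParam p) halfSpace3 y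

/-- The metric coefficients in the preferred chart at `p`. -/
abbrev chartMetric (p : M) (y : E3) : Matrix (Fin 3) (Fin 3) ℝ :=
  metricCoeff (chartParam p) halfSpace3 y

theorem chartMetric_apply (p : M) (y : E3) (i j : Fin 3) :
    chartMetric p y i j = inner ℝ (chartDeriv p y (stdVec i)) (chartDeriv p y (stdVec j)) := rfl

theorem chartParam_mem {p : M} {y : E3} (hy : y ∈ chartDom p) :
    chartParam p y ∈ (chartAt (EuclideanHalfSpace 3) p).source := by
  rw [← extChartAt_source (𝓡∂ 3)]
  exact (extChartAt (𝓡∂ 3) p).map_target hy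

/-- In the trivialization of the tangent bundle at `p` this section has constant fibre component
`v`. Smoothness of the metric coefficients, up to the boundary, follows from it. -/
theorem chartDeriv_section_contMDiffOn (p : M) (v : E3) :
    ContMDiffOn 𝓘(ℝ, E3) ((𝓡∂ 3).prod 𝓘(ℝ, E3)) ∞
      (fun y ↦ (⟨chartParam p y, chartDeriv p y v⟩ : TotalSpace E3 (TangentSpace (𝓡∂ 3) (M := M))))
      (chartDom p) := by
  have hbase : MapsTo (fun y ↦ (⟨chartParam p y, chartDeriv p y v⟩ :
      TotalSpace E3 (TangentSpace (𝓡∂ 3) (M := M)))) (chartDom p)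
      (trivializationAt E3 (TangentSpace (𝓡∂ 3)) p).source := by
    intro y hy
    rw [Trivialization.mem_source, TangentBundle.trivializationAt_baseSet]
    exact chartParam_mem hy
  rw [Trivialization.contMDiffOn_iff (e := trivializationAt E3 (TangentSpace (𝓡∂ 3)) p) hbase]
  refine ⟨contMDiffOn_extChartAt_symm p, ?_⟩
  refine (contMDiffOn_const (c := v)).congr fun y hy ↦ ?_
  have hs : chartParam p y ∈ (chartAt (EuclideanHalfSpace 3) p).source :=
    chartParam_mem hy
  have h1 := TangentBundle.symmL_trivializationAt (I := 𝓡∂ 3) hs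
  rw [(extChartAt (𝓡∂ 3) p).right_inv hy] at h1
  have h2 : chartDeriv p y v = (trivializationAt E3 (TangentSpace (𝓡∂ 3)) p).symm (chartParam p y) v := by
    have := congrArg (fun L ↦ L v) h1
    exact this.symm.trans (Trivialization.symmL_apply _
      (by rwa [TangentBundle.trivializationAt_baseSet]) v)
  rw [h2]
  exact congrArg Prod.snd (Trivialization.apply_mk_symm (trivializationAt E3 (TangentSpace (𝓡∂ 3)) p)
    (by rwa [TangentBundle.trivializationAt_baseSet]) v)

variable [IsContMDiffRiemannianBundle (𝓡∂ 3) ∞ E3 (fun x : M ↦ TangentSpace (𝓡∂ 3) x)]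

theorem chartMetric_contDiffOn (p : M) (i j : Fin 3) :
    ContDiffOn ℝ ∞ (fun y ↦ chartMetric p y i j) (chartDom p) := by
  rw [← contMDiffOn_iff_contDiffOn]
  exact ContMDiffOn.inner_bundle (chartDeriv_section_contMDiffOn p (stdVec i))
    (chartDeriv_section_contMDiffOn p (stdVec j))

theorem chartDeriv_injective {p : M} {y : E3} (hy : y ∈ chartDom p) :
    Function.Injective (chartDeriv p y) :=
  (isInvertible_mfderivWithin_extChartAt_symm (I := 𝓡∂ 3) hy).injective

theorem chartDeriv_surjective {p : M} {y : E3} (hy : y ∈ chartDom p) :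
    Function.Surjective (chartDeriv p y) :=
  (isInvertible_mfderivWithin_extChartAt_symm (I := 𝓡∂ 3) hy).surjective

theorem chartMetric_det_pos {p : M} {y : E3} (hy : y ∈ chartDom p) :
    0 < (chartMetric p y).det :=
  (exists_linearMap_norm_eq_of_injective (chartDeriv p y).toLinearMap (chartDeriv_injective hy)
    (chartMetric p y) (fun _ _ ↦ rfl)).1

theorem exists_chartMetric_factor {p : M} {y : E3} (hy : y ∈ chartDom p) :
    ∃ A : E3 →ₗ[ℝ] E3, |LinearMap.det A| = √(chartMetric p y).det ∧
      ∀ v, ‖A v‖ = ‖chartDeriv p y v‖ :=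
  (exists_linearMap_norm_eq_of_injective (chartDeriv p y).toLinearMap (chartDeriv_injective hy)
    (chartMetric p y) (fun _ _ ↦ rfl)).2

theorem E3_eq_sum (v : E3) : v = ∑ i, v i • stdVec i := by
  ext j
  fin_cases j <;> simp [stdVec, Fin.sum_univ_three]

theorem norm_chartDeriv_sq (p : M) (y v : E3) :
    ‖chartDeriv p y v‖ ^ 2 = ∑ i, ∑ j, v i * v j * chartMetric p y i j := by
  rw [← real_inner_self_eq_norm_sq]
  conv_lhs => rw [E3_eq_sum v]
  simp only [map_sum, map_smul, sum_inner, inner_sum, real_inner_smul_left, real_inner_smul_right,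
    chartMetric_apply]
  refine Finset.sum_congr rfl fun i _ ↦ Finset.sum_congr rfl fun j _ ↦ ?_
  rw [real_inner_comm]
  ring

/-- The metric in a chart is nearly constant near a point. -/
theorem chartDeriv_norm_near {p : M} {y₀ : E3} (hy₀ : y₀ ∈ chartDom p) {ε : ℝ} (hε : 0 < ε)
    (hε1 : ε < 1) :
    ∀ᶠ y in 𝓝[halfSpace3] y₀, y ∈ chartDom p ∧ ∀ v,
      (1 - ε) * ‖chartDeriv p y₀ v‖ ≤ ‖chartDeriv p y v‖ ∧
      ‖chartDeriv p y v‖ ≤ (1 + ε) * ‖chartDeriv p y₀ v‖ := by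
  obtain ⟨A, -, hA⟩ := exists_chartMetric_factor hy₀
  have hAinj : Function.Injective A := by
    rw [injective_iff_map_eq_zero]
    intro v hv
    have h0 : ‖chartDeriv p y₀ v‖ = 0 := by rw [← hA, hv, norm_zero]
    exact (injective_iff_map_eq_zero (chartDeriv p y₀)).1 (chartDeriv_injective hy₀) v
      (norm_eq_zero.1 h0)
  obtain ⟨c, hc, hcA⟩ := A.exists_antilipschitzWith (LinearMap.ker_eq_bot.2 hAinj)
  have hcv : ∀ v, ‖v‖ ≤ c * ‖chartDeriv p y₀ v‖ := fun v ↦ by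
    rw [← hA]; simpa [dist_eq_norm] using hcA.le_mul_dist v 0
  have hc' : (0 : ℝ) < c := by exact_mod_cast hc
  -- Nine coefficient errors of size δ‖v‖², with ‖v‖ at most c times the norm in the metric at `y₀`,
  -- add up to the relative error ε in the squared norm.
  set δ : ℝ := ε / (9 * c ^ 2) with hδ
  have hδ0 : 0 < δ := by positivity
  have hdom : ∀ᶠ y in 𝓝[halfSpace3] y₀, y ∈ chartDom p := by
    have := extChartAt_target_mem_nhdsWithin' (I := 𝓡∂ 3) (x := p) (y := chartParam p y₀)
      ((extChartAt (𝓡∂ 3) p).map_target hy₀)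
    rwa [(extChartAt (𝓡∂ 3) p).right_inv hy₀] at this
  have hcont : ∀ i j, ∀ᶠ y in 𝓝[halfSpace3] y₀, |chartMetric p y i j - chartMetric p y₀ i j| < δ := by
    intro i j
    have h1 : ContinuousWithinAt (fun y ↦ chartMetric p y i j) (chartDom p) y₀ :=
      (chartMetric_contDiffOn p i j).continuousOn y₀ hy₀
    have h2 := h1.mono_of_mem_nhdsWithin hdom
    have := (Metric.tendsto_nhds.1 h2) δ hδ0
    simpa [Real.dist_eq] using this
  have hall : ∀ᶠ y in 𝓝[halfSpace3] y₀, ∀ i j, |chartMetric p y i j - chartMetric p y₀ i j| < δ := by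
    rw [eventually_all]; intro i; rw [eventually_all]; exact hcont i
  filter_upwards [hall, hdom] with y hy hyd
  refine ⟨hyd, fun v ↦ ?_⟩
  have hdiff : |‖chartDeriv p y v‖ ^ 2 - ‖chartDeriv p y₀ v‖ ^ 2| ≤ ε * ‖chartDeriv p y₀ v‖ ^ 2 := by
    rw [norm_chartDeriv_sq, norm_chartDeriv_sq, ← Finset.sum_sub_distrib]
    simp only [← Finset.sum_sub_distrib, ← mul_sub]
    rw [← norm_chartDeriv_sq]
    calc _ ≤ ∑ i : Fin 3, ∑ j : Fin 3, ‖v‖ * ‖v‖ * δ := by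
          refine (Finset.abs_sum_le_sum_abs _ _).trans (Finset.sum_le_sum fun i _ ↦ ?_)
          refine (Finset.abs_sum_le_sum_abs _ _).trans (Finset.sum_le_sum fun j _ ↦ ?_)
          rw [abs_mul, abs_mul]
          have h1 := PiLp.norm_apply_le v i
          have h2 := PiLp.norm_apply_le v j
          rw [Real.norm_eq_abs] at h1 h2
          have := (hy i j).le
          gcongr
      _ = 9 * δ * ‖v‖ ^ 2 := by simp; ring
      _ ≤ 9 * δ * (c * ‖chartDeriv p y₀ v‖) ^ 2 := by gcongr; exact hcv v
      _ = ε * ‖chartDeriv p y₀ v‖ ^ 2 := by rw [hδ]; field_simp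
  rw [abs_le] at hdiff
  have hn := norm_nonneg (chartDeriv p y₀ v)
  have hn' := norm_nonneg (chartDeriv p y v)
  constructor
  · refine le_of_sq_le_sq ?_ hn'
    nlinarith [sq_nonneg ‖chartDeriv p y₀ v‖, mul_nonneg hε.le (sq_nonneg ‖chartDeriv p y₀ v‖),
      mul_nonneg (mul_nonneg hε.le (sub_nonneg.2 hε1.le)) (sq_nonneg ‖chartDeriv p y₀ v‖)]
  · refine le_of_sq_le_sq ?_ (by positivity)
    nlinarith [sq_nonneg ‖chartDeriv p y₀ v‖, mul_nonneg hε.le (sq_nonneg ‖chartDeriv p y₀ v‖),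
      mul_nonneg (mul_nonneg hε.le hε.le) (sq_nonneg ‖chartDeriv p y₀ v‖)]

end ChartMetric

/-! ### Riemannian distance compared with a constant metric -/

section ChartDistance

variable {M : Type*} [MetricSpace M] [ChartedSpace (EuclideanHalfSpace 3) M]
  [IsManifold (𝓡∂ 3) ∞ M] [RiemannianBundle (fun x : M ↦ TangentSpace (𝓡∂ 3) x)]

theorem chartDeriv_mfderiv_extChartAt {p : M} {y : E3} (hy : y ∈ chartDom p)
    (w : TangentSpace (𝓡∂ 3) (chartParam p y)) :
    chartDeriv p y (mfderiv (𝓡∂ 3) 𝓘(ℝ, E3) (extChartAt (𝓡∂ 3) p) (chartParam p y) w) = w := by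
  have := mfderivWithin_extChartAt_symm_comp_mfderiv_extChartAt (I := 𝓡∂ 3) (x := p)
    (y := y) hy
  exact congrArg (fun L ↦ L w) this

/-- The chart derivative inverts the differential of the chart, so a lower bound for the metric
becomes an upper bound for the coordinate velocity of a curve. -/
theorem norm_comp_mfderiv_extChartAt_le {p : M} {y₀ : E3} {ε : ℝ} (hε1 : ε < 1)
    {A : E3 →ₗ[ℝ] E3} (hA : ∀ v, ‖A v‖ = ‖chartDeriv p y₀ v‖) {x : M}
    (hx : x ∈ (extChartAt (𝓡∂ 3) p).source)
    (h : ∀ v, (1 - ε) * ‖chartDeriv p y₀ v‖ ≤ ‖chartDeriv p (extChartAt (𝓡∂ 3) p x) v‖)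
    (w : TangentSpace (𝓡∂ 3) x) :
    ‖A (mfderiv (𝓡∂ 3) 𝓘(ℝ, E3) (extChartAt (𝓡∂ 3) p) x w)‖ ≤ (1 - ε)⁻¹ * ‖w‖ := by
  obtain ⟨y, hy, rfl⟩ : ∃ y ∈ chartDom p, x = chartParam p y :=
    ⟨_, (extChartAt (𝓡∂ 3) p).map_source hx, ((extChartAt (𝓡∂ 3) p).left_inv hx).symm⟩
  rw [(extChartAt (𝓡∂ 3) p).right_inv hy] at h
  refine (hA _).le.trans ?_
  rw [le_inv_mul_iff₀ (by linarith)]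
  refine (h _).trans (le_of_eq ?_)
  exact congrArg norm (chartDeriv_mfderiv_extChartAt hy w)

/-- A path that stays in a region of a chart where the metric dominates a constant one is at least
as long as the constant-metric distance of its endpoints. -/
theorem norm_sub_le_pathELength {p : M} {y₀ : E3} {ε : ℝ} (hε1 : ε < 1)
    {A : E3 →ₗ[ℝ] E3} (hA : ∀ v, ‖A v‖ = ‖chartDeriv p y₀ v‖) {γ : ℝ → M}
    (hγ : ContMDiff 𝓘(ℝ, ℝ) (𝓡∂ 3) 1 γ)
    (hs : ∀ t ∈ Icc (0 : ℝ) 1, γ t ∈ (extChartAt (𝓡∂ 3) p).source ∧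
      ∀ v, (1 - ε) * ‖chartDeriv p y₀ v‖ ≤ ‖chartDeriv p (extChartAt (𝓡∂ 3) p (γ t)) v‖) :
    ‖A (extChartAt (𝓡∂ 3) p (γ 1) - extChartAt (𝓡∂ 3) p (γ 0))‖ₑ ≤
      ENNReal.ofReal (1 - ε)⁻¹ * Manifold.pathELength (𝓡∂ 3) γ 0 1 := by
  let Ac : E3 →L[ℝ] E3 := LinearMap.toContinuousLinearMap A
  let c : ℝ → E3 := fun t ↦ Ac (extChartAt (𝓡∂ 3) p (γ t))
  have hφγ : ContMDiffOn 𝓘(ℝ, ℝ) 𝓘(ℝ, E3) 1 (extChartAt (𝓡∂ 3) p ∘ γ) (Icc 0 1) :=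
    contMDiffOn_extChartAt.comp (I' := 𝓡∂ 3) (t := (chartAt (EuclideanHalfSpace 3) p).source)
      hγ.contMDiffOn (fun t ht ↦ by
        have := (hs t ht).1; rwa [extChartAt_source] at this)
  have hφγ' : ContDiffOn ℝ 1 (extChartAt (𝓡∂ 3) p ∘ γ) (Icc 0 1) :=
    contMDiffOn_iff_contDiffOn.1 hφγ
  have hc : ContDiffOn ℝ 1 c (Icc 0 1) := Ac.contDiff.comp_contDiffOn hφγ'
  have h1 := enorm_sub_le_lintegral_derivWithin_Icc_of_contDiffOn_Icc hc zero_le_one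
  have hc01 : c 1 - c 0 = A (extChartAt (𝓡∂ 3) p (γ 1) - extChartAt (𝓡∂ 3) p (γ 0)) := by
    simp [c, Ac, map_sub]
  rw [hc01] at h1
  refine h1.trans ?_
  rw [Manifold.pathELength_eq_lintegral_mfderivWithin_Icc, ← lintegral_const_mul' _ _ (by simp)]
  refine setLIntegral_mono' measurableSet_Icc fun t ht ↦ ?_
  have hu : UniqueDiffWithinAt ℝ (Icc (0 : ℝ) 1) t := uniqueDiffOn_Icc zero_lt_one t ht
  have hmf : mfderivWithin 𝓘(ℝ, ℝ) 𝓘(ℝ, E3) (extChartAt (𝓡∂ 3) p ∘ γ) (Icc 0 1) t =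
      (mfderiv (𝓡∂ 3) 𝓘(ℝ, E3) (extChartAt (𝓡∂ 3) p) (γ t)) ∘L
        (mfderivWithin 𝓘(ℝ, ℝ) (𝓡∂ 3) γ (Icc 0 1) t) := by
    apply mfderiv_comp_mfderivWithin
    · refine mdifferentiableAt_extChartAt ?_
      have := (hs t ht).1; rwa [extChartAt_source] at this
    · exact (hγ.mdifferentiable one_ne_zero).mdifferentiableOn _ ht
    · rwa [uniqueMDiffWithinAt_iff_uniqueDiffWithinAt]
  have hder : derivWithin c (Icc 0 1) t = A (mfderiv (𝓡∂ 3) 𝓘(ℝ, E3) (extChartAt (𝓡∂ 3) p) (γ t)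
      (mfderivWithin 𝓘(ℝ, ℝ) (𝓡∂ 3) γ (Icc 0 1) t (1 : ℝ))) := by
    have h2 : HasFDerivWithinAt (extChartAt (𝓡∂ 3) p ∘ γ)
        (fderivWithin ℝ (extChartAt (𝓡∂ 3) p ∘ γ) (Icc 0 1) t) (Icc 0 1) t :=
      ((hφγ'.differentiableOn one_ne_zero) t ht).hasFDerivWithinAt
    have h3 := (Ac.hasFDerivAt.comp_hasFDerivWithinAt t h2).hasDerivWithinAt.derivWithin hu
    rw [mfderivWithin_eq_fderivWithin] at hmf
    refine h3.trans ?_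
    have h4 := congrArg (fun L : ℝ →L[ℝ] E3 ↦ A (L 1)) hmf
    exact h4
  rw [hder, ← ofReal_norm, ← ofReal_norm, ← ENNReal.ofReal_mul
    (inv_nonneg.2 (by linarith))]
  exact ENNReal.ofReal_le_ofReal (norm_comp_mfderiv_extChartAt_le hε1 hA (hs t ht).1 (hs t ht).2 _)

/-- The image of a segment in a chart where the metric is dominated by a constant one is at most
as long as the constant-metric distance of its endpoints. -/
theorem riemannianEDist_chartParam_le {p : M} {y₀ a b : E3} {ε : ℝ} (hε : 0 < ε)
    (hs : ∀ y ∈ segment ℝ a b, y ∈ chartDom p ∧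
      ∀ v, ‖chartDeriv p y v‖ ≤ (1 + ε) * ‖chartDeriv p y₀ v‖) :
    Manifold.riemannianEDist (𝓡∂ 3) (chartParam p a) (chartParam p b) ≤
      ENNReal.ofReal ((1 + ε) * ‖chartDeriv p y₀ (a - b)‖) := by
  let η : ℝ →ᴬ[ℝ] E3 := ContinuousAffineMap.lineMap (R := ℝ) a b
  have hη : ∀ t ∈ Icc (0 : ℝ) 1, η t ∈ segment ℝ a b := fun t ht ↦ by
    rw [segment_eq_image_lineMap]; exact ⟨t, ht, by simp [η, ContinuousAffineMap.coe_lineMap_eq]⟩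
  have hηs : ContMDiffOn 𝓘(ℝ, ℝ) 𝓘(ℝ, E3) 1 η (Icc 0 1) :=
    (contMDiff_iff_contDiff.2 η.contDiff).contMDiffOn
  have h1 : Manifold.riemannianEDist (𝓡∂ 3) (chartParam p a) (chartParam p b) ≤
      Manifold.pathELength (𝓡∂ 3) (chartParam p ∘ η) 0 1 := by
    apply Manifold.riemannianEDist_le_pathELength _ _ _ zero_le_one
    · exact (contMDiffOn_extChartAt_symm p).comp hηs fun t ht ↦ (hs _ (hη t ht)).1
    · simp [η, ContinuousAffineMap.coe_lineMap_eq]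
    · simp [η, ContinuousAffineMap.coe_lineMap_eq]
  refine h1.trans ?_
  rw [Manifold.pathELength_eq_lintegral_mfderivWithin_Icc]
  have hconst : ∫⁻ _ in Icc (0 : ℝ) 1, ENNReal.ofReal ((1 + ε) * ‖chartDeriv p y₀ (a - b)‖) =
      ENNReal.ofReal ((1 + ε) * ‖chartDeriv p y₀ (a - b)‖) := by simp
  rw [← hconst]
  refine setLIntegral_mono' measurableSet_Icc fun t ht ↦ ?_
  have hu : UniqueDiffWithinAt ℝ (Icc (0 : ℝ) 1) t := uniqueDiffOn_Icc zero_lt_one t ht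
  have hd := hs _ (hη t ht)
  have hmf : mfderivWithin 𝓘(ℝ, ℝ) (𝓡∂ 3) (chartParam p ∘ η) (Icc 0 1) t =
      (chartDeriv p (η t)) ∘L (mfderivWithin 𝓘(ℝ, ℝ) 𝓘(ℝ, E3) η (Icc 0 1) t) := by
    apply mfderivWithin_comp
    · exact mdifferentiableWithinAt_extChartAt_symm hd.1
    · exact hηs.mdifferentiableOn one_ne_zero t ht
    · exact fun s hs' ↦ extChartAt_target_subset_range p (hs _ (hη s hs')).1
    · rwa [uniqueMDiffWithinAt_iff_uniqueDiffWithinAt]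
  have hηd : (mfderivWithin 𝓘(ℝ, ℝ) 𝓘(ℝ, E3) η (Icc 0 1) t : ℝ →L[ℝ] E3) 1 = b - a := by
    rw [mfderivWithin_eq_fderivWithin, fderivWithin_eq_fderiv hu η.differentiableAt]
    have h2 : HasDerivAt η (b - a) t := AffineMap.hasDerivAt_lineMap (a := a) (b := b) (x := t)
    rw [h2.hasFDerivAt.fderiv]
    exact one_smul ℝ (b - a)
  have hval : mfderivWithin 𝓘(ℝ, ℝ) (𝓡∂ 3) (chartParam p ∘ η) (Icc 0 1) t (1 : ℝ) =
      chartDeriv p (η t) (b - a) := by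
    rw [hmf]
    exact congrArg (chartDeriv p (η t)) hηd
  refine (congrArg enorm hval).le.trans ?_
  rw [← ofReal_norm]
  refine ENNReal.ofReal_le_ofReal ((hd.2 _).trans (le_of_eq ?_))
  rw [← neg_sub a b, map_neg, norm_neg]

variable [IsContMDiffRiemannianBundle (𝓡∂ 3) ∞ E3 (fun x : M ↦ TangentSpace (𝓡∂ 3) x)]
  [IsRiemannianManifold (𝓡∂ 3) M]

/-- The Riemannian distance is, to first order near a point, the distance given by the metric at
that point. -/
theorem chartParam_hasMetricDeriv {p : M} {y₀ : E3} (hy₀ : y₀ ∈ chartDom p) :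
    HasMetricDeriv (chartParam p) halfSpace3 y₀ (fun v ↦ ‖chartDeriv p y₀ v‖) := by
  suffices h : ∀ ε > 0, ε < 1 → ∃ r > 0, ∀ a ∈ Metric.ball y₀ r ∩ halfSpace3,
      ∀ b ∈ Metric.ball y₀ r ∩ halfSpace3,
      (1 - ε) * ‖chartDeriv p y₀ (a - b)‖ ≤ dist (chartParam p a) (chartParam p b) ∧
      dist (chartParam p a) (chartParam p b) ≤ (1 + ε) * ‖chartDeriv p y₀ (a - b)‖ by
    intro ε hε
    obtain ⟨r, hr, H⟩ := h (min ε 2⁻¹) (by positivity) ((min_le_right _ _).trans_lt (by norm_num))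
    refine ⟨r, hr, fun a ha b hb ↦ ⟨le_trans ?_ (H a ha b hb).1, (H a ha b hb).2.trans ?_⟩⟩
    · exact mul_le_mul_of_nonneg_right (by linarith [min_le_left ε 2⁻¹]) (norm_nonneg _)
    · exact mul_le_mul_of_nonneg_right (by linarith [min_le_left ε 2⁻¹]) (norm_nonneg _)
  intro ε hε hε1
  obtain ⟨A, -, hA⟩ := exists_chartMetric_factor hy₀
  obtain ⟨r₁, hr₁, hball⟩ := Metric.mem_nhdsWithin_iff.1 (chartDeriv_norm_near hy₀ hε hε1)
  have hsrc : chartParam p y₀ ∈ (extChartAt (𝓡∂ 3) p).source :=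
    (extChartAt (𝓡∂ 3) p).map_target hy₀
  have hnear : ∀ᶠ x in 𝓝 (chartParam p y₀), x ∈ (extChartAt (𝓡∂ 3) p).source ∧
      extChartAt (𝓡∂ 3) p x ∈ Metric.ball y₀ r₁ := by
    refine Eventually.and ((isOpen_extChartAt_source p).mem_nhds hsrc) ?_
    have := (continuousAt_extChartAt' (I := 𝓡∂ 3) hsrc)
    refine this.preimage_mem_nhds ?_
    rw [(extChartAt (𝓡∂ 3) p).right_inv hy₀]
    exact Metric.ball_mem_nhds _ hr₁
  obtain ⟨ρ, hρ, hρs⟩ := Metric.mem_nhds_iff.1 hnear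
  have hcont : ContinuousWithinAt (chartParam p) halfSpace3 y₀ :=
    ((contMDiffOn_extChartAt_symm (n := ∞) p).continuousOn y₀ hy₀).mono_of_mem_nhdsWithin
      (mem_of_superset (chartDeriv_norm_near hy₀ hε hε1) fun y hy ↦ hy.1)
  obtain ⟨r₂, hr₂, hball₂⟩ := Metric.mem_nhdsWithin_iff.1
    (hcont.preimage_mem_nhdsWithin (Metric.ball_mem_nhds _ (by positivity : 0 < ρ / 4)))
  refine ⟨min r₁ r₂, lt_min hr₁ hr₂, fun a ha b hb ↦ ?_⟩
  have ha₁ : a ∈ Metric.ball y₀ r₁ ∩ halfSpace3 := ⟨Metric.ball_subset_ball (min_le_left _ _) ha.1, ha.2⟩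
  have hb₁ : b ∈ Metric.ball y₀ r₁ ∩ halfSpace3 := ⟨Metric.ball_subset_ball (min_le_left _ _) hb.1, hb.2⟩
  have ha₂ : dist (chartParam p a) (chartParam p y₀) < ρ / 4 :=
    hball₂ ⟨Metric.ball_subset_ball (min_le_right _ _) ha.1, ha.2⟩
  have hb₂ : dist (chartParam p b) (chartParam p y₀) < ρ / 4 :=
    hball₂ ⟨Metric.ball_subset_ball (min_le_right _ _) hb.1, hb.2⟩
  constructor
  · rw [← inv_inv (1 - ε), inv_mul_le_iff₀ (inv_pos.2 (by linarith))]
    refine le_of_forall_pos_le_add fun κ hκ ↦ ?_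
    -- The slack κ' has two bounds. Being at most κ(1 − ε), it is absorbed into κ after division by
    -- 1 − ε. Being at most ρ/4, it confines the almost minimal path to the ball of radius ρ where
    -- the chart estimate holds: the path starts within ρ/4 of the centre and is shorter than ρ/2 +
    -- ρ/4.
    set κ' : ℝ := min (κ * (1 - ε)) (ρ / 4) with hκ'
    have hκ'0 : 0 < κ' := lt_min (mul_pos hκ (by linarith)) (by positivity)
    have hlt : Manifold.riemannianEDist (𝓡∂ 3) (chartParam p a) (chartParam p b) <
        ENNReal.ofReal (dist (chartParam p a) (chartParam p b) + κ') := by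
      rw [← IsRiemannianManifold.out (I := 𝓡∂ 3), edist_dist]
      exact (ENNReal.ofReal_lt_ofReal_iff (by positivity)).2 (by linarith)
    obtain ⟨γ, hγ0, hγ1, hγs, hγl, -⟩ :=
      Manifold.exists_lt_locally_constant_of_riemannianEDist_lt hlt zero_lt_one
    have hab : dist (chartParam p a) (chartParam p b) < ρ / 2 := by
      have := dist_triangle_right (chartParam p a) (chartParam p b) (chartParam p y₀)
      linarith
    have hstay : ∀ t ∈ Icc (0 : ℝ) 1, γ t ∈ Metric.ball (chartParam p y₀) ρ := by
      intro t ht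
      have h1 : edist (chartParam p a) (γ t) ≤ Manifold.pathELength (𝓡∂ 3) γ 0 1 := by
        rw [IsRiemannianManifold.out (I := 𝓡∂ 3)]
        refine (Manifold.riemannianEDist_le_pathELength (hγs.contMDiffOn) hγ0 rfl ht.1).trans ?_
        exact Manifold.pathELength_mono le_rfl ht.2
      have h2 := h1.trans_lt hγl
      rw [edist_dist, ENNReal.ofReal_lt_ofReal_iff (by positivity)] at h2
      rw [Metric.mem_ball, dist_comm]
      have := dist_triangle (chartParam p y₀) (chartParam p a) (γ t)
      rw [dist_comm (chartParam p y₀) (chartParam p a)] at this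
      linarith [min_le_right (κ * (1 - ε)) (ρ / 4)]
    have hmain := norm_sub_le_pathELength hε1 hA hγs fun t ht ↦ by
      have h1 := hρs (hstay t ht)
      refine ⟨h1.1, fun v ↦ ?_⟩
      exact ((hball ⟨h1.2, extChartAt_target_subset_range p
        ((extChartAt (𝓡∂ 3) p).map_source h1.1)⟩).2 v).1
    rw [hγ0, hγ1, (extChartAt (𝓡∂ 3) p).right_inv (hball ha₁).1,
      (extChartAt (𝓡∂ 3) p).right_inv (hball hb₁).1] at hmain
    have hfin := hmain.trans (mul_le_mul_right hγl.le _)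
    rw [← ofReal_norm, ← ENNReal.ofReal_mul (inv_nonneg.2 (by linarith)),
      ENNReal.ofReal_le_ofReal_iff (mul_nonneg (inv_nonneg.2 (by linarith)) (by positivity)),
      hA, ← neg_sub a b, map_neg, norm_neg, mul_add] at hfin
    refine hfin.trans ?_
    gcongr
    rw [inv_mul_le_iff₀ (by linarith)]
    exact (min_le_left _ _).trans_eq (mul_comm _ _)
  -- A half-ball is convex, so the coordinate segment is an admissible competitor even at the
  -- boundary.
  · have hseg : segment ℝ a b ⊆ Metric.ball y₀ r₁ ∩ halfSpace3 :=
      ((convex_ball _ _).inter (𝓡∂ 3).convex_range).segment_subset ha₁ hb₁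
    have := riemannianEDist_chartParam_le (p := p) (y₀ := y₀) (a := a) (b := b) hε
      fun y hy ↦ ⟨(hball (hseg hy)).1, fun v ↦ ((hball (hseg hy)).2 v).2⟩
    rwa [← IsRiemannianManifold.out (I := 𝓡∂ 3), edist_dist,
      ENNReal.ofReal_le_ofReal_iff (by positivity)] at this

end ChartDistance

/-! ### Gradients in coordinates -/

theorem contDiffOn_matrix_det {V : Type*} [NormedAddCommGroup V] [NormedSpace ℝ V] {n : ℕ}
    {k : WithTop ℕ∞} {s : Set V} {A : V → Matrix (Fin n) (Fin n) ℝ}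
    (hA : ∀ i j, ContDiffOn ℝ k (fun y ↦ A y i j) s) : ContDiffOn ℝ k (fun y ↦ (A y).det) s := by
  simp only [Matrix.det_apply]
  refine ContDiffOn.sum fun σ _ ↦ ContDiffOn.const_smul _ ?_
  exact contDiffOn_prod fun i _ ↦ hA _ _

theorem contDiffOn_matrix_inv {V : Type*} [NormedAddCommGroup V] [NormedSpace ℝ V] {n : ℕ}
    {k : WithTop ℕ∞} {s : Set V} {A : V → Matrix (Fin n) (Fin n) ℝ}
    (hA : ∀ i j, ContDiffOn ℝ k (fun y ↦ A y i j) s) (hdet : ∀ y ∈ s, (A y).det ≠ 0)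
    (i j : Fin n) : ContDiffOn ℝ k (fun y ↦ (A y)⁻¹ i j) s := by
  simp only [Matrix.inv_def, Matrix.smul_apply, smul_eq_mul, Ring.inverse_eq_inv']
  refine ((contDiffOn_matrix_det hA).inv hdet).mul ?_
  simp only [Matrix.adjugate_apply]
  refine contDiffOn_matrix_det fun a b ↦ ?_
  by_cases h : a = j
  · subst h; simpa using contDiffOn_const
  · simpa [Matrix.updateRow_ne h] using hA a b

/-- The inner product in terms of the covariant components. -/
theorem inner_eq_gram_inv {n : ℕ} {T : Type*} [NormedAddCommGroup T] [InnerProductSpace ℝ T]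
    (D : EuclideanSpace ℝ (Fin n) →ₗ[ℝ] T) (hD : Function.Surjective D)
    (G : Matrix (Fin n) (Fin n) ℝ) (hdet : G.det ≠ 0)
    (hG : ∀ i j, G i j = inner ℝ (D (EuclideanSpace.single i 1)) (D (EuclideanSpace.single j 1)))
    (P Q : T) :
    inner ℝ P Q = ∑ i, ∑ j, inner ℝ P (D (EuclideanSpace.single i 1)) * G⁻¹ i j *
      inner ℝ Q (D (EuclideanSpace.single j 1)) := by
  obtain ⟨c, rfl⟩ := hD Q
  have hc : D c = ∑ i, c i • D (EuclideanSpace.single i 1) := by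
    have : c = ∑ i, c i • (EuclideanSpace.single i (1 : ℝ) : EuclideanSpace ℝ (Fin n)) := by
      conv_lhs => rw [← (EuclideanSpace.basisFun (Fin n) ℝ).sum_repr c]
      simp
    conv_lhs => rw [this]
    simp
  have hb : ∀ j, inner ℝ (D c) (D (EuclideanSpace.single j 1)) = (G.mulVec c) j := fun j ↦ by
    conv_lhs => rw [hc]
    rw [sum_inner, Matrix.mulVec, dotProduct]
    refine Finset.sum_congr rfl fun i _ ↦ ?_
    rw [real_inner_smul_left, hG, real_inner_comm, mul_comm]
  have hinv : G⁻¹.mulVec (G.mulVec c) = c := by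
    rw [Matrix.mulVec_mulVec, Matrix.nonsing_inv_mul _ (isUnit_iff_ne_zero.2 hdet),
      Matrix.one_mulVec]
  have h2 : ∀ i, ∑ j, G⁻¹ i j * (G.mulVec c) j = c i := fun i ↦ congrFun hinv i
  simp only [hb]
  simp only [mul_assoc, ← Finset.mul_sum, h2]
  conv_lhs => rw [hc]
  rw [inner_sum]
  exact Finset.sum_congr rfl fun i _ ↦ by rw [real_inner_smul_right, mul_comm]

section ChartCalculus

variable {M : Type*} [MetricSpace M] [ChartedSpace (EuclideanHalfSpace 3) M]
  [IsManifold (𝓡∂ 3) ∞ M] [RiemannianBundle (fun x : M ↦ TangentSpace (𝓡∂ 3) x)]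

/-- The pairing `⟨∇f, ∇g⟩`. -/
def gradPair (f g : M → ℝ) (x : M) : ℝ := inner ℝ (riemGradient f x) (riemGradient g x)

/-- The `i`-th partial derivative in the preferred chart at `p`. -/
def chartPartial (p : M) (f : M → ℝ) (i : Fin 3) (y : E3) : ℝ :=
  fderivWithin ℝ (f ∘ chartParam p) halfSpace3 y (stdVec i)

theorem chartDom_subset (p : M) : chartDom p ⊆ halfSpace3 := extChartAt_target_subset_range p

theorem uniqueDiffOn_halfSpace3 : UniqueDiffOn ℝ halfSpace3 := (𝓡∂ 3).uniqueDiffOn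

theorem chartDom_mem_nhdsWithin {p : M} {y : E3} (hy : y ∈ chartDom p) :
    chartDom p ∈ 𝓝[halfSpace3] y := by
  have := extChartAt_target_mem_nhdsWithin' (I := 𝓡∂ 3) (x := p) (y := chartParam p y)
    ((extChartAt (𝓡∂ 3) p).map_target hy)
  rwa [(extChartAt (𝓡∂ 3) p).right_inv hy] at this

theorem chartDom_eq_inter (p : M) : ∃ O : Set E3, IsOpen O ∧ chartDom p = O ∩ halfSpace3 := by
  refine ⟨(𝓡∂ 3).symm ⁻¹' (chartAt (EuclideanHalfSpace 3) p).target,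
    (chartAt (EuclideanHalfSpace 3) p).open_target.preimage (𝓡∂ 3).continuous_symm, ?_⟩
  rw [chartDom, extChartAt_target]

/-- The chart domain is relatively open in the half-space, so the two one-sided derivatives agree.
-/
theorem fderivWithin_chartDom {F : Type*} [NormedAddCommGroup F] [NormedSpace ℝ F] {p : M} {y : E3}
    (hy : y ∈ chartDom p) (h : E3 → F) :
    fderivWithin ℝ h (chartDom p) y = fderivWithin ℝ h halfSpace3 y := by
  obtain ⟨O, hO, heq⟩ := chartDom_eq_inter p
  rw [heq] at hy ⊢
  rw [inter_comm, fderivWithin_inter (hO.mem_nhds hy.1)]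

theorem measurableSet_chartDom (p : M) : MeasurableSet (chartDom p) := by
  obtain ⟨O, hO, h⟩ := chartDom_eq_inter p
  rw [h]
  exact hO.measurableSet.inter (𝓡∂ 3).isClosed_range.measurableSet

theorem gradPair_eq_mfderiv (f g : M → ℝ) (x : M) :
    gradPair f g x = mfderiv (𝓡∂ 3) 𝓘(ℝ, ℝ) f x (riemGradient g x) :=
  inner_riemGradient f x _

theorem gradPair_mul {f₁ f₂ g : M → ℝ} {x : M} (h₁ : MDifferentiableAt (𝓡∂ 3) 𝓘(ℝ, ℝ) f₁ x)
    (h₂ : MDifferentiableAt (𝓡∂ 3) 𝓘(ℝ, ℝ) f₂ x) :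
    gradPair (fun x ↦ f₁ x * f₂ x) g x = f₁ x * gradPair f₂ g x + f₂ x * gradPair f₁ g x := by
  have h := (h₁.hasMFDerivAt.mul h₂.hasMFDerivAt).mfderiv
  have h' : mfderiv (𝓡∂ 3) 𝓘(ℝ, ℝ) (fun x ↦ f₁ x * f₂ x) x = _ := h
  rw [gradPair_eq_mfderiv, gradPair_eq_mfderiv, gradPair_eq_mfderiv, h']
  rfl

theorem gradPair_comp {f g : M → ℝ} {x : M} {Φ : ℝ → ℝ} {c : ℝ} (hΦ : HasDerivAt Φ c (f x))
    (hf : MDifferentiableAt (𝓡∂ 3) 𝓘(ℝ, ℝ) f x) :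
    gradPair (fun x ↦ Φ (f x)) g x = c * gradPair f g x := by
  have h := (HasMFDerivAt.comp x hΦ.hasFDerivAt.hasMFDerivAt hf.hasMFDerivAt).mfderiv
  have h' : mfderiv (𝓡∂ 3) 𝓘(ℝ, ℝ) (fun x ↦ Φ (f x)) x = _ := h
  rw [gradPair_eq_mfderiv, gradPair_eq_mfderiv, h']
  exact @mul_comm ℝ _ _ _

theorem gradPair_add {f₁ f₂ g : M → ℝ} {x : M} (h₁ : MDifferentiableAt (𝓡∂ 3) 𝓘(ℝ, ℝ) f₁ x)
    (h₂ : MDifferentiableAt (𝓡∂ 3) 𝓘(ℝ, ℝ) f₂ x) :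
    gradPair (fun x ↦ f₁ x + f₂ x) g x = gradPair f₁ g x + gradPair f₂ g x := by
  have h := (h₁.hasMFDerivAt.add h₂.hasMFDerivAt).mfderiv
  have h' : mfderiv (𝓡∂ 3) 𝓘(ℝ, ℝ) (fun x ↦ f₁ x + f₂ x) x = _ := h
  rw [gradPair_eq_mfderiv, gradPair_eq_mfderiv, gradPair_eq_mfderiv, h']
  rfl

theorem gradPair_sum {ι : Type*} {t : Finset ι} {f : ι → M → ℝ} {g : M → ℝ}
    (h : ∀ i, MDifferentiable (𝓡∂ 3) 𝓘(ℝ, ℝ) (f i)) (x : M) :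
    gradPair (fun x ↦ ∑ i ∈ t, f i x) g x = ∑ i ∈ t, gradPair (f i) g x := by
  classical
  suffices H : MDifferentiable (𝓡∂ 3) 𝓘(ℝ, ℝ) (fun x ↦ ∑ i ∈ t, f i x) ∧
      gradPair (fun x ↦ ∑ i ∈ t, f i x) g x = ∑ i ∈ t, gradPair (f i) g x from H.2
  induction t using Finset.induction_on with
  | empty =>
    simp only [Finset.sum_empty]
    refine ⟨mdifferentiable_const, ?_⟩
    rw [gradPair_eq_mfderiv, mfderiv_const]
    rfl
  | insert a t ha ih =>
    simp only [Finset.sum_insert ha]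
    refine ⟨fun z ↦ (h a z).add (ih.1 z), ?_⟩
    rw [gradPair_add (h a x) (ih.1 x), ih.2]

theorem gradPair_congr {f f' g : M → ℝ} {x : M} (h : f =ᶠ[𝓝 x] f') :
    gradPair f g x = gradPair f' g x := by
  simp only [gradPair_eq_mfderiv]
  rw [h.mfderiv_eq]
  rfl

theorem gradPair_eq_zero_of_notMem_tsupport {f g : M → ℝ} {x : M} (h : x ∉ tsupport f) :
    gradPair f g x = 0 := by
  have h1 : f =ᶠ[𝓝 x] fun _ ↦ 0 := notMem_tsupport_iff_eventuallyEq.1 h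
  rw [gradPair_congr h1, gradPair_eq_mfderiv, mfderiv_const]
  rfl

set_option linter.unusedSectionVars false

theorem gradPair_self (f : M → ℝ) (x : M) : gradPair f f x = ‖riemGradient f x‖ ^ 2 :=
  real_inner_self_eq_norm_sq _

theorem gradPair_self_nonneg (f : M → ℝ) (x : M) : 0 ≤ gradPair f f x := real_inner_self_nonneg

theorem norm_riemGradient (f : M → ℝ) (x : M) : ‖riemGradient f x‖ = √(gradPair f f x) := by
  rw [gradPair_self, Real.sqrt_sq (norm_nonneg _)]

theorem mfderiv_chartDeriv {p : M} {f : M → ℝ} {y : E3} (hy : y ∈ chartDom p)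
    (hf : MDifferentiableAt (𝓡∂ 3) 𝓘(ℝ, ℝ) f (chartParam p y)) (v : E3) :
    mfderiv (𝓡∂ 3) 𝓘(ℝ, ℝ) f (chartParam p y) (chartDeriv p y v) =
      fderivWithin ℝ (f ∘ chartParam p) halfSpace3 y v := by
  have h := mfderiv_comp_mfderivWithin (I := 𝓘(ℝ, E3)) (I' := 𝓡∂ 3) (I'' := 𝓘(ℝ, ℝ)) y hf
    (mdifferentiableWithinAt_extChartAt_symm (I := 𝓡∂ 3) hy)
    (uniqueMDiffWithinAt_iff_uniqueDiffWithinAt.2 (uniqueDiffOn_halfSpace3 y (chartDom_subset p hy)))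
  rw [mfderivWithin_eq_fderivWithin] at h
  exact (congrArg (fun L : E3 →L[ℝ] ℝ ↦ L v) h).symm

theorem inner_riemGradient_chartDeriv {p : M} {f : M → ℝ} {y : E3} (hy : y ∈ chartDom p)
    (hf : MDifferentiableAt (𝓡∂ 3) 𝓘(ℝ, ℝ) f (chartParam p y)) (i : Fin 3) :
    inner ℝ (riemGradient f (chartParam p y)) (chartDeriv p y (stdVec i)) =
      chartPartial p f i y :=
  (inner_riemGradient f _ _).trans (mfderiv_chartDeriv hy hf _)

variable [IsContMDiffRiemannianBundle (𝓡∂ 3) ∞ E3 (fun x : M ↦ TangentSpace (𝓡∂ 3) x)]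

theorem gradPair_chartParam {p : M} {f g : M → ℝ} {y : E3} (hy : y ∈ chartDom p)
    (hf : MDifferentiableAt (𝓡∂ 3) 𝓘(ℝ, ℝ) f (chartParam p y))
    (hg : MDifferentiableAt (𝓡∂ 3) 𝓘(ℝ, ℝ) g (chartParam p y)) :
    gradPair f g (chartParam p y) = ∑ i, ∑ j, chartPartial p f i y * (chartMetric p y)⁻¹ i j *
      chartPartial p g j y := by
  have := inner_eq_gram_inv (chartDeriv p y).toLinearMap (chartDeriv_surjective hy)
    (chartMetric p y) (chartMetric_det_pos hy).ne' (fun _ _ ↦ rfl)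
    (riemGradient f (chartParam p y)) (riemGradient g (chartParam p y))
  refine this.trans (Finset.sum_congr rfl fun i _ ↦ Finset.sum_congr rfl fun j _ ↦ ?_)
  exact congrArg₂ (fun a b ↦ a * (chartMetric p y)⁻¹ i j * b)
    (inner_riemGradient_chartDeriv hy hf i) (inner_riemGradient_chartDeriv hy hg j)

theorem contDiffOn_chartMetric_inv (p : M) (i j : Fin 3) :
    ContDiffOn ℝ ∞ (fun y ↦ (chartMetric p y)⁻¹ i j) (chartDom p) :=
  contDiffOn_matrix_inv (chartMetric_contDiffOn p) (fun _ hy ↦ (chartMetric_det_pos hy).ne') i j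

theorem contDiffOn_sqrt_chartMetric_det (p : M) :
    ContDiffOn ℝ ∞ (fun y ↦ √(chartMetric p y).det) (chartDom p) :=
  (contDiffOn_matrix_det (chartMetric_contDiffOn p)).sqrt fun _ hy ↦ (chartMetric_det_pos hy).ne'

theorem contDiffOn_comp_chartParam {k : WithTop ℕ∞} (hk : k ≤ ∞) {f : M → ℝ}
    (hf : ContMDiff (𝓡∂ 3) 𝓘(ℝ, ℝ) k f) (p : M) : ContDiffOn ℝ k (f ∘ chartParam p) (chartDom p) :=
  contMDiffOn_iff_contDiffOn.1
    (hf.comp_contMDiffOn ((contMDiffOn_extChartAt_symm (n := ∞) p).of_le hk))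

theorem contMDiff_of_chartParam {k : WithTop ℕ∞} (hk : k ≤ ∞) {f : M → ℝ}
    (hf : ∀ p, ContDiffOn ℝ k (f ∘ chartParam p) (chartDom p)) :
    ContMDiff (𝓡∂ 3) 𝓘(ℝ, ℝ) k f := by
  intro p
  have h1 : ContMDiffOn (𝓡∂ 3) 𝓘(ℝ, E3) k (extChartAt (𝓡∂ 3) p)
      (chartAt (EuclideanHalfSpace 3) p).source := (contMDiffOn_extChartAt (n := ∞)).of_le hk
  have h2 := (contMDiffOn_iff_contDiffOn.2 (hf p)).comp h1 fun x hx ↦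
    (extChartAt (𝓡∂ 3) p).map_source (by rwa [extChartAt_source])
  have hnh : (chartAt (EuclideanHalfSpace 3) p).source ∈ 𝓝 p := chart_source_mem_nhds _ p
  refine (h2.contMDiffAt hnh).congr_of_eventuallyEq ?_
  filter_upwards [hnh] with x hx
  exact congrArg f ((extChartAt (𝓡∂ 3) p).left_inv (by rwa [extChartAt_source])).symm

theorem contDiffOn_chartPartial {k m : WithTop ℕ∞} (hk : k ≤ ∞) (hmk : m + 1 ≤ k) {f : M → ℝ}
    (hf : ContMDiff (𝓡∂ 3) 𝓘(ℝ, ℝ) k f) (p : M) (i : Fin 3) :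
    ContDiffOn ℝ m (chartPartial p f i) (chartDom p) := by
  have h1 := (contDiffOn_comp_chartParam hk hf p).fderivWithin
    (uniqueDiffOn_extChartAt_target p) hmk
  have h2 : ContDiffOn ℝ m (fun y ↦ fderivWithin ℝ (f ∘ chartParam p) (chartDom p) y (stdVec i))
    (chartDom p) := h1.clm_apply contDiffOn_const
  refine h2.congr fun y hy ↦ ?_
  rw [chartPartial, fderivWithin_chartDom hy]

theorem contDiffOn_gradPair {m : WithTop ℕ∞} {k l : WithTop ℕ∞} (hm : m ≤ ∞) (hk : k ≤ ∞)
    (hl : l ≤ ∞) (hmk : m + 1 ≤ k) (hml : m + 1 ≤ l)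
    {f g : M → ℝ} (hf : ContMDiff (𝓡∂ 3) 𝓘(ℝ, ℝ) k f) (hg : ContMDiff (𝓡∂ 3) 𝓘(ℝ, ℝ) l g)
    (hk0 : k ≠ 0) (hl0 : l ≠ 0) (p : M) :
    ContDiffOn ℝ m (gradPair f g ∘ chartParam p) (chartDom p) := by
  have h : ContDiffOn ℝ m (fun y ↦ ∑ i, ∑ j, chartPartial p f i y * (chartMetric p y)⁻¹ i j *
      chartPartial p g j y) (chartDom p) :=
    ContDiffOn.sum fun i _ ↦ ContDiffOn.sum fun j _ ↦
      ((contDiffOn_chartPartial hk hmk hf p i).mul ((contDiffOn_chartMetric_inv p i j).of_le hm)).mul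
        (contDiffOn_chartPartial hl hml hg p j)
  exact h.congr fun y hy ↦ gradPair_chartParam hy (hf.mdifferentiable hk0 _) (hg.mdifferentiable hl0 _)

theorem contMDiff_gradPair {m : WithTop ℕ∞} {k l : WithTop ℕ∞} (hm : m ≤ ∞) (hk : k ≤ ∞)
    (hl : l ≤ ∞) (hmk : m + 1 ≤ k) (hml : m + 1 ≤ l)
    {f g : M → ℝ} (hf : ContMDiff (𝓡∂ 3) 𝓘(ℝ, ℝ) k f) (hg : ContMDiff (𝓡∂ 3) 𝓘(ℝ, ℝ) l g)
    (hk0 : k ≠ 0) (hl0 : l ≠ 0) :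
    ContMDiff (𝓡∂ 3) 𝓘(ℝ, ℝ) m (gradPair f g) :=
  contMDiff_of_chartParam hm fun p ↦ contDiffOn_gradPair hm hk hl hmk hml hf hg hk0 hl0 p

end ChartCalculus

theorem one_le_infty : (1 : WithTop ℕ∞) ≤ ∞ := by exact_mod_cast (le_top : (1 : ℕ∞) ≤ ⊤)

theorem two_le_infty : (2 : WithTop ℕ∞) ≤ ∞ := 
  WithTop.coe_le_coe.2 (le_top : (2 : ℕ∞) ≤ ⊤)

theorem HasMetricDeriv.mono {V X : Type*} [NormedAddCommGroup V] [MetricSpace X] {Ψ : V → X}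
    {S S' : Set V} {z : V} {q : V → ℝ} (h : HasMetricDeriv Ψ S z q) (hS : S' ⊆ S) :
    HasMetricDeriv Ψ S' z q := fun ε hε ↦ by
  obtain ⟨r, hr, H⟩ := h ε hε
  exact ⟨r, hr, fun a ha b hb ↦ H a ⟨ha.1, hS ha.2⟩ b ⟨hb.1, hS hb.2⟩⟩

/-- Integration by parts against the constant function 1. -/
theorem integral_fderiv_eq_zero_of_hasCompactSupport {h : E3 → ℝ} (hh : ContDiff ℝ 1 h)
    (hc : HasCompactSupport h) (v : E3) :
    Integrable (fun y ↦ fderiv ℝ h y v) ∧ ∫ y, fderiv ℝ h y v = 0 := by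
  have hcont : Continuous fun y ↦ fderiv ℝ h y v :=
    (hh.continuous_fderiv one_ne_zero).clm_apply continuous_const
  have hc' : HasCompactSupport fun y ↦ fderiv ℝ h y v := hc.fderiv_apply ℝ v
  have hint : Integrable (fun y ↦ fderiv ℝ h y v) := hcont.integrable_of_hasCompactSupport hc'
  refine ⟨hint, ?_⟩
  have := integral_bilinear_hasLineDerivAt_right_eq_neg_left_of_integrable
    (μ := (volume : Measure E3)) (f := fun _ ↦ (1 : ℝ)) (f' := fun _ ↦ 0) (g := h)
    (g' := fun y ↦ fderiv ℝ h y v) (v := v) (B := ContinuousLinearMap.mul ℝ ℝ)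
    (by simp) (by simpa using hint) (by simpa using hh.continuous.integrable_of_hasCompactSupport hc)
    (fun x _ ↦ by simpa using (hasFDerivAt_const (1 : ℝ) x).hasLineDerivAt v)
    (fun x _ ↦ ((hh.differentiable one_ne_zero) x).hasFDerivAt.hasLineDerivAt v)
  simpa using this

/-! ### Riemannian volume and weak harmonicity in one chart -/

section Volume

variable {M : Type*} [MetricSpace M] [ChartedSpace (EuclideanHalfSpace 3) M]
  [IsManifold (𝓡∂ 3) ∞ M] [RiemannianBundle (fun x : M ↦ TangentSpace (𝓡∂ 3) x)]
  [IsContMDiffRiemannianBundle (𝓡∂ 3) ∞ E3 (fun x : M ↦ TangentSpace (𝓡∂ 3) x)]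

set_option linter.unusedSectionVars false

/-- The density of the Riemannian volume in the preferred chart at `p`. -/
def chartDensity (p : M) (y : E3) : ℝ := √(chartMetric p y).det

theorem chartDensity_pos {p : M} {y : E3} (hy : y ∈ chartDom p) : 0 < chartDensity p y :=
  Real.sqrt_pos.2 (chartMetric_det_pos hy)

/-- The components of the vector density `√(det g) ∇u` in the preferred chart at `p`. -/
def fluxField (p : M) (u : M → ℝ) (i : Fin 3) (y : E3) : ℝ :=
  chartDensity p y * ∑ j, (chartMetric p y)⁻¹ i j * chartPartial p u j y

theorem contDiffOn_fluxField {u : M → ℝ} (hu : ContMDiff (𝓡∂ 3) 𝓘(ℝ, ℝ) 2 u) (p : M) (i : Fin 3) :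
    ContDiffOn ℝ 1 (fluxField p u i) (chartDom p) :=
  ((contDiffOn_sqrt_chartMetric_det p).of_le one_le_infty).mul <|
    ContDiffOn.sum fun j _ ↦ ((contDiffOn_chartMetric_inv p i j).of_le one_le_infty).mul
      (contDiffOn_chartPartial (k := 2) two_le_infty one_add_one_eq_two.le hu p j)

theorem fluxField_divergence {u : M → ℝ} (hu : IsHarmonic u) {p : M} {y : E3} (hy : y ∈ chartDom p) :
    ∑ i, fderivWithin ℝ (fluxField p u i) halfSpace3 y (stdVec i) = 0 := by
  have h := hu.2 (chartAt (EuclideanHalfSpace 3) p) (IsManifold.chart_mem_maximalAtlas p)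
    (chartParam p y) (chartParam_mem hy)
  have hy' : (chartAt (EuclideanHalfSpace 3) p).extend (𝓡∂ 3) (chartParam p y) = y :=
    (extChartAt (𝓡∂ 3) p).right_inv hy
  rw [hy', coordLaplacian] at h
  rcases mul_eq_zero.1 h with h | h
  · exact absurd h (inv_ne_zero (chartDensity_pos hy).ne')
  · exact h

theorem gradPair_mul_chartDensity {p : M} {f g : M → ℝ} {y : E3} (hy : y ∈ chartDom p)
    (hf : MDifferentiableAt (𝓡∂ 3) 𝓘(ℝ, ℝ) f (chartParam p y))
    (hg : MDifferentiableAt (𝓡∂ 3) 𝓘(ℝ, ℝ) g (chartParam p y)) :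
    chartDensity p y * gradPair f g (chartParam p y) =
      ∑ i, fluxField p g i y * chartPartial p f i y := by
  rw [gradPair_chartParam hy hf hg, Finset.mul_sum]
  refine Finset.sum_congr rfl fun i _ ↦ ?_
  rw [fluxField, mul_assoc, Finset.sum_mul]
  congr 1
  exact Finset.sum_congr rfl fun j _ ↦ by ring

/-- Being an interior point does not depend on the chart, so it can be tested in the chart at `p`
instead of the one at `x`. -/
theorem mem_interior_chartDom {p x : M} (hx : x ∈ (extChartAt (𝓡∂ 3) p).source)
    (hb : x ∉ (𝓡∂ 3).boundary M) : extChartAt (𝓡∂ 3) p x ∈ interior (chartDom p) := by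
  have h1 : (𝓡∂ 3).IsInteriorPoint x :=
    (ModelWithCorners.isInteriorPoint_iff_not_isBoundaryPoint x).2 hb
  rw [extChartAt_source] at hx
  exact ((𝓡∂ 3).isInteriorPoint_iff_of_mem_atlas (n := ∞) (by simp) (chart_mem_atlas _ p) hx).1 h1

variable [IsRiemannianManifold (𝓡∂ 3) M] [MeasurableSpace M] [BorelSpace M]

theorem chartParam_hasMetricJacobian (p : M) :
    HasMetricJacobian (chartParam p) (chartDom p) (chartDensity p) where
  meas := measurableSet_chartDom p
  inj := (extChartAt (𝓡∂ 3) p).symm.injOn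
  cont := (contDiffOn_sqrt_chartMetric_det p).continuousOn
  pos _ hy := chartDensity_pos hy
  deriv z hz := by
    obtain ⟨A, hdet, hA⟩ := exists_chartMetric_factor hz
    refine ⟨A, hdet, ?_⟩
    simp only [hA]
    exact (chartParam_hasMetricDeriv hz).mono (chartDom_subset p)

theorem chartParam_image (p : M) : chartParam p '' chartDom p = (extChartAt (𝓡∂ 3) p).source :=
  (extChartAt (𝓡∂ 3) p).symm_image_target_eq_source

theorem setIntegral_chart (p : M) (g : M → ℝ) :
    ∫ x in (extChartAt (𝓡∂ 3) p).source, g x ∂μHE[3] =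
      ∫ y in chartDom p, chartDensity p y * g (chartParam p y) := by
  rw [← chartParam_image, (chartParam_hasMetricJacobian p).integral_image]

/-- The density is bounded on small half-balls. This makes continuous functions with compact support
integrable. -/
theorem isLocallyFiniteMeasure_volume : IsLocallyFiniteMeasure (μHE[3] : Measure M) := by
  refine ⟨fun p ↦ ?_⟩
  set y₀ := extChartAt (𝓡∂ 3) p p with hy₀
  have hy : y₀ ∈ chartDom p := mem_extChartAt_target p
  have hcont : ContinuousWithinAt (chartDensity p) halfSpace3 y₀ :=
    ((chartParam_hasMetricJacobian p).cont y₀ hy).mono_of_mem_nhdsWithin (chartDom_mem_nhdsWithin hy)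
  have hev : ∀ᶠ y in 𝓝[halfSpace3] y₀, chartDensity p y < chartDensity p y₀ + 1 ∧ y ∈ chartDom p :=
    (hcont.eventually_lt continuousWithinAt_const (by simp)).and (chartDom_mem_nhdsWithin hy)
  obtain ⟨r, hr, hrs⟩ := Metric.mem_nhdsWithin_iff.1 hev
  refine ⟨chartParam p '' (Metric.ball y₀ r ∩ halfSpace3), ?_, ?_⟩
  · have h1 : extChartAt (𝓡∂ 3) p ⁻¹' Metric.ball y₀ r ∩ (extChartAt (𝓡∂ 3) p).source ∈ 𝓝 p :=
      inter_mem ((continuousAt_extChartAt p).preimage_mem_nhds (Metric.ball_mem_nhds _ hr))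
        (extChartAt_source_mem_nhds p)
    refine mem_of_superset h1 fun x hx ↦ ⟨extChartAt (𝓡∂ 3) p x, ⟨hx.1, chartDom_subset p
      ((extChartAt (𝓡∂ 3) p).map_source hx.2)⟩, (extChartAt (𝓡∂ 3) p).left_inv hx.2⟩
  · have hm : MeasurableSet (Metric.ball y₀ r ∩ halfSpace3) :=
      measurableSet_ball.inter (𝓡∂ 3).isClosed_range.measurableSet
    rw [(chartParam_hasMetricJacobian p).measure_image hm fun y hy ↦ (hrs hy).2]
    calc _ ≤ ∫⁻ _ in Metric.ball y₀ r ∩ halfSpace3, ENNReal.ofReal (chartDensity p y₀ + 1) :=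
          setLIntegral_mono' hm fun y hy ↦ ENNReal.ofReal_le_ofReal (hrs hy).1.le
      _ = ENNReal.ofReal (chartDensity p y₀ + 1) * volume (Metric.ball y₀ r ∩ halfSpace3) :=
          setLIntegral_const ..
      _ < ⊤ := ENNReal.mul_lt_top ENNReal.ofReal_lt_top
          ((measure_mono inter_subset_left).trans_lt measure_ball_lt_top)

/-- Every half-ball around a point of the half-space meets the open half-space, and the density is
positive. In the maximum principle this turns a vanishing weighted energy into a vanishing gradient.
-/
theorem isOpenPosMeasure_volume : Measure.IsOpenPosMeasure (μHE[3] : Measure M) := by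
  refine ⟨fun U hU ⟨p, hp⟩ h0 ↦ ?_⟩
  obtain ⟨O, hO, hdom⟩ := chartDom_eq_inter p
  set y₀ := extChartAt (𝓡∂ 3) p p with hy₀
  have hy : y₀ ∈ chartDom p := mem_extChartAt_target p
  have hpy : chartParam p y₀ = p := extChartAt_to_inv p
  have hcont : ContinuousWithinAt (chartParam p) halfSpace3 y₀ :=
    ((chartParam_hasMetricJacobian p).continuousOn y₀ hy).mono_of_mem_nhdsWithin
      (chartDom_mem_nhdsWithin hy)
  have hev : ∀ᶠ y in 𝓝[halfSpace3] y₀, chartParam p y ∈ U ∧ y ∈ chartDom p :=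
    Eventually.and (hcont.preimage_mem_nhdsWithin (hU.mem_nhds (by rwa [hpy])))
      (chartDom_mem_nhdsWithin hy)
  obtain ⟨r, hr, hrs⟩ := Metric.mem_nhdsWithin_iff.1 hev
  have hm : MeasurableSet (Metric.ball y₀ r ∩ halfSpace3) :=
    measurableSet_ball.inter (𝓡∂ 3).isClosed_range.measurableSet
  have h1 : μHE[3] (chartParam p '' (Metric.ball y₀ r ∩ halfSpace3)) = 0 :=
    measure_mono_null (by rintro _ ⟨y, hy, rfl⟩; exact (hrs hy).1) h0
  rw [(chartParam_hasMetricJacobian p).measure_image hm fun y hy ↦ (hrs hy).2] at h1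
  have hpos : volume (Metric.ball y₀ r ∩ halfSpace3) ≠ 0 := by
    have hsub : (Metric.ball y₀ r ∩ interior halfSpace3).Nonempty := by
      have hcl : y₀ ∈ closure (interior halfSpace3) := by
        have := (𝓡∂ 3).range_subset_closure_interior
        exact this (chartDom_subset p hy)
      exact mem_closure_iff.1 hcl _ Metric.isOpen_ball (Metric.mem_ball_self hr)
    have := (Metric.isOpen_ball.inter isOpen_interior).measure_pos volume hsub
    exact (this.trans_le (measure_mono (inter_subset_inter_right _ interior_subset))).ne'
  have hae := (setLIntegral_eq_zero_iff' hm (((chartParam_hasMetricJacobian p).cont.mono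
    fun y hy ↦ (hrs hy).2).aemeasurable hm).ennreal_ofReal).1 h1
  apply hpos
  refine measure_mono_null (fun y hy ↦ ?_) (ae_iff.1 hae)
  intro hy'
  exact (ENNReal.ofReal_pos.2 (chartDensity_pos (hrs hy).2)).ne' (hy' hy)

/-- Weak harmonicity, tested against functions supported in the interior part of one chart. -/
theorem integral_gradPair_eq_zero_of_chart {u : M → ℝ} (hu : IsHarmonic u) {ζ : M → ℝ}
    (hζ : ContMDiff (𝓡∂ 3) 𝓘(ℝ, ℝ) 1 ζ) (hζc : HasCompactSupport ζ) {p : M}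
    (hsupp : tsupport ζ ⊆ (extChartAt (𝓡∂ 3) p).source)
    (hbd : ∀ x ∈ tsupport ζ, x ∉ (𝓡∂ 3).boundary M) :
    ∫ x, gradPair ζ u x ∂μHE[3] = 0 := by
  set K : Set E3 := extChartAt (𝓡∂ 3) p '' tsupport ζ with hK
  have hKc : IsCompact K := hζc.isCompact.image_of_continuousOn
    ((continuousOn_extChartAt p).mono hsupp)
  set O : Set E3 := interior (chartDom p) with hO
  have hOo : IsOpen O := isOpen_interior
  have hKO : K ⊆ O := by
    rintro _ ⟨x, hx, rfl⟩
    exact mem_interior_chartDom (hsupp hx) (hbd x hx)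
  have hOd : O ⊆ chartDom p := interior_subset
  have hnotK : ∀ y ∈ chartDom p, y ∉ K → chartParam p y ∉ tsupport ζ := fun y hy hyK hmem ↦
    hyK ⟨_, hmem, (extChartAt (𝓡∂ 3) p).right_inv hy⟩
  -- The vector density √(det g) ∇u times ζ, extended by zero. It is C¹ on all of ℝ³ because the
  -- support is a compact subset of the open set `O`. Its divergence is √(det g)⟨∇ζ, ∇u⟩, since the
  -- flux field itself is divergence free.
  let h : Fin 3 → E3 → ℝ := fun i ↦ O.indicator fun y ↦ fluxField p u i y * ζ (chartParam p y)
  have hζd : ContDiffOn ℝ 1 (ζ ∘ chartParam p) (chartDom p) :=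
    contDiffOn_comp_chartParam one_le_infty hζ p
  have hprod : ∀ i, ContDiffOn ℝ 1 (fun y ↦ fluxField p u i y * ζ (chartParam p y)) (chartDom p) :=
    fun i ↦ (contDiffOn_fluxField hu.1 p i).mul hζd
  have hzero : ∀ i, ∀ y ∉ K, h i y = 0 := by
    intro i y hy
    by_cases hyO : y ∈ O
    · simp only [h, indicator_of_mem hyO]
      rw [image_eq_zero_of_notMem_tsupport (hnotK y (hOd hyO) hy), mul_zero]
    · exact indicator_of_notMem hyO _
  have hhO : ∀ i, ∀ y ∈ O, h i =ᶠ[𝓝 y] fun y ↦ fluxField p u i y * ζ (chartParam p y) :=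
    fun i y hy ↦ by
      filter_upwards [hOo.mem_nhds hy] with z hz using indicator_of_mem hz _
  have hhK : ∀ i, ∀ y ∉ K, h i =ᶠ[𝓝 y] fun _ ↦ 0 := fun i y hy ↦ by
    filter_upwards [hKc.isClosed.isOpen_compl.mem_nhds hy] with z hz using hzero i z hz
  have hhs : ∀ i, ContDiff ℝ 1 (h i) := by
    intro i
    rw [contDiff_iff_contDiffAt]
    intro y
    by_cases hy : y ∈ K
    · exact (((hprod i).mono hOd).contDiffAt (hOo.mem_nhds (hKO hy))).congr_of_eventuallyEq
        (hhO i y (hKO hy))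
    · exact contDiffAt_const.congr_of_eventuallyEq (hhK i y hy)
  have hhc : ∀ i, HasCompactSupport (h i) := fun i ↦
    HasCompactSupport.intro hKc fun y hy ↦ hzero i y hy
  have hkey : ∀ y ∈ chartDom p, chartDensity p y * gradPair ζ u (chartParam p y) =
      ∑ i, fderiv ℝ (h i) y (stdVec i) := by
    intro y hy
    by_cases hyK : y ∈ K
    · have hyO := hKO hyK
      have hnh : halfSpace3 ∈ 𝓝 y := mem_of_superset (hOo.mem_nhds hyO) (hOd.trans (chartDom_subset p))
      have hdiv := fluxField_divergence hu hy
      rw [gradPair_mul_chartDensity hy (hζ.mdifferentiable one_ne_zero _)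
        (hu.1.mdifferentiable two_ne_zero _)]
      have hdom : chartDom p ∈ 𝓝 y := mem_of_superset (hOo.mem_nhds hyO) hOd
      have hterm : ∀ i, fderiv ℝ (h i) y (stdVec i) =
          fluxField p u i y * chartPartial p ζ i y +
            ζ (chartParam p y) * fderivWithin ℝ (fluxField p u i) halfSpace3 y (stdVec i) := by
        intro i
        have h1 : DifferentiableAt ℝ (fluxField p u i) y :=
          ((contDiffOn_fluxField hu.1 p i).contDiffAt hdom).differentiableAt one_ne_zero
        have h2 : DifferentiableAt ℝ (ζ ∘ chartParam p) y :=
          (hζd.contDiffAt hdom).differentiableAt one_ne_zero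
        have h3 := fderiv_fun_mul h1 h2
        rw [(hhO i y hyO).fderiv_eq, chartPartial,
          fderivWithin_of_mem_nhds hnh, fderivWithin_of_mem_nhds hnh]
        exact congrArg (fun L : E3 →L[ℝ] ℝ ↦ L (stdVec i)) h3
      simp only [hterm, Finset.sum_add_distrib, ← Finset.mul_sum, hdiv, mul_zero, add_zero]
    · rw [gradPair_eq_zero_of_notMem_tsupport (hnotK y hy hyK), mul_zero]
      symm
      refine Finset.sum_eq_zero fun i _ ↦ ?_
      rw [(hhK i y hyK).fderiv_eq]
      simp
  have hout : ∀ y ∉ chartDom p, ∑ i, fderiv ℝ (h i) y (stdVec i) = 0 := fun y hy ↦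
    Finset.sum_eq_zero fun i _ ↦ by
      rw [(hhK i y fun hyK ↦ hy (hOd (hKO hyK))).fderiv_eq]
      simp
  rw [← setIntegral_eq_integral_of_forall_compl_eq_zero (s := (extChartAt (𝓡∂ 3) p).source)
    fun x hx ↦ gradPair_eq_zero_of_notMem_tsupport fun hx' ↦ hx (hsupp hx'), setIntegral_chart,
    setIntegral_congr_fun (measurableSet_chartDom p) hkey,
    setIntegral_eq_integral_of_forall_compl_eq_zero hout,
    integral_finsetSum _ fun i _ ↦ (integral_fderiv_eq_zero_of_hasCompactSupport (hhs i) (hhc i) _).1]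
  exact Finset.sum_eq_zero fun i _ ↦
    (integral_fderiv_eq_zero_of_hasCompactSupport (hhs i) (hhc i) _).2

end Volume

/-! ### Weak harmonicity on the whole manifold -/

section Partition

variable {M : Type*} [MetricSpace M] [ChartedSpace (EuclideanHalfSpace 3) M]
  [IsManifold (𝓡∂ 3) ∞ M] [SigmaCompactSpace M]

/-- A finite smooth partition of unity on a compact set, subordinate to an open cover. -/
theorem exists_finite_partition {K : Set M} (hK : IsCompact K) (U : M → Set M)
    (hU : ∀ x ∈ K, IsOpen (U x)) (hxU : ∀ x ∈ K, x ∈ U x) :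
    ∃ (t : Finset M) (ρ : t → M → ℝ), (∀ i : t, (i : M) ∈ K) ∧
      (∀ i, ContMDiff (𝓡∂ 3) 𝓘(ℝ, ℝ) ∞ (ρ i)) ∧ (∀ i, tsupport (ρ i) ⊆ U i) ∧
      ∀ x ∈ K, ∑ i, ρ i x = 1 := by
  obtain ⟨t, htK, ht⟩ := hK.elim_nhds_subcover U fun x hx ↦ (hU x hx).mem_nhds (hxU x hx)
  obtain ⟨f, hf⟩ := SmoothPartitionOfUnity.exists_isSubordinate (𝓡∂ 3) hK.isClosed
    (fun i : t ↦ U i) (fun i ↦ hU i (htK i i.2)) (fun x hx ↦ by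
      obtain ⟨i, hi, hxi⟩ := mem_iUnion₂.1 (ht hx)
      exact mem_iUnion.2 ⟨⟨i, hi⟩, hxi⟩)
  refine ⟨t, fun i ↦ f i, fun i ↦ htK i i.2, fun i ↦ (f i).contMDiff, hf, fun x hx ↦ ?_⟩
  rw [← finsum_eq_sum_of_fintype]
  exact f.sum_eq_one hx

variable [RiemannianBundle (fun x : M ↦ TangentSpace (𝓡∂ 3) x)]
  [IsContMDiffRiemannianBundle (𝓡∂ 3) ∞ E3 (fun x : M ↦ TangentSpace (𝓡∂ 3) x)]
  [IsRiemannianManifold (𝓡∂ 3) M] [MeasurableSpace M] [BorelSpace M]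

theorem continuous_gradPair {f g : M → ℝ} (hf : ContMDiff (𝓡∂ 3) 𝓘(ℝ, ℝ) 1 f)
    (hg : ContMDiff (𝓡∂ 3) 𝓘(ℝ, ℝ) 1 g) : Continuous (gradPair f g) :=
  (contMDiff_gradPair (m := 0) (k := 1) (l := 1) (zero_le_one.trans one_le_infty) one_le_infty
    one_le_infty (zero_add 1).le (zero_add 1).le hf hg one_ne_zero one_ne_zero).continuous

theorem integrable_gradPair {f g : M → ℝ} (hf : ContMDiff (𝓡∂ 3) 𝓘(ℝ, ℝ) 1 f)
    (hfc : HasCompactSupport f) (hg : ContMDiff (𝓡∂ 3) 𝓘(ℝ, ℝ) 1 g) :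
    Integrable (gradPair f g) μHE[3] := by
  have := isLocallyFiniteMeasure_volume (M := M)
  refine (continuous_gradPair hf hg).integrable_of_hasCompactSupport
    (HasCompactSupport.intro hfc.isCompact fun x hx ↦ gradPair_eq_zero_of_notMem_tsupport hx)

/-- **Weak harmonicity**: a harmonic function is orthogonal, in the Dirichlet form, to every `C¹`
function with compact support in the interior. -/
theorem integral_gradPair_eq_zero {u : M → ℝ} (hu : IsHarmonic u) {ζ : M → ℝ}
    (hζ : ContMDiff (𝓡∂ 3) 𝓘(ℝ, ℝ) 1 ζ) (hζc : HasCompactSupport ζ)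
    (hbd : ∀ x ∈ tsupport ζ, x ∉ (𝓡∂ 3).boundary M) :
    ∫ x, gradPair ζ u x ∂μHE[3] = 0 := by
  obtain ⟨t, ρ, -, hρs, hρU, hρ1⟩ := exists_finite_partition hζc.isCompact
    (fun p ↦ (extChartAt (𝓡∂ 3) p).source) (fun p _ ↦ isOpen_extChartAt_source p)
    (fun p _ ↦ mem_extChartAt_source p)
  have hsum : ζ = fun x ↦ ∑ i, ρ i x * ζ x := by
    ext x
    rw [← Finset.sum_mul]
    by_cases hx : x ∈ tsupport ζ
    · rw [hρ1 x hx, one_mul]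
    · rw [image_eq_zero_of_notMem_tsupport hx, mul_zero]
  have hsm : ∀ i, ContMDiff (𝓡∂ 3) 𝓘(ℝ, ℝ) 1 fun x ↦ ρ i x * ζ x := fun i ↦
    ((hρs i).of_le one_le_infty).mul hζ
  have hcs : ∀ i, HasCompactSupport fun x ↦ ρ i x * ζ x := fun i ↦ hζc.mul_left
  have hts : ∀ i, tsupport (fun x ↦ ρ i x * ζ x) ⊆ tsupport ζ := fun i ↦
    closure_mono fun x hx ↦ right_ne_zero_of_mul hx
  have hts' : ∀ i, tsupport (fun x ↦ ρ i x * ζ x) ⊆ tsupport (ρ i) := fun i ↦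
    closure_mono fun x hx ↦ left_ne_zero_of_mul hx
  have hu1 : ContMDiff (𝓡∂ 3) 𝓘(ℝ, ℝ) 1 u := hu.1.of_le one_le_two
  have heq : gradPair ζ u = fun x ↦ ∑ i, gradPair (fun x ↦ ρ i x * ζ x) u x := by
    ext x
    conv_lhs => rw [hsum]
    exact gradPair_sum (fun i ↦ (hsm i).mdifferentiable one_ne_zero) x
  rw [heq, integral_finsetSum _ fun i _ ↦ integrable_gradPair (hsm i) (hcs i) hu1]
  exact Finset.sum_eq_zero fun i _ ↦ integral_gradPair_eq_zero_of_chart hu (hsm i) (hcs i)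
    ((hts' i).trans (hρU i)) fun x hx ↦ hbd x (hts i hx)

end Partition

theorem contDiff_one_primitive {φ : ℝ → ℝ} (hφ : Continuous φ) (a : ℝ) :
    (∀ s, HasDerivAt (fun s ↦ ∫ r in a..s, φ r) (φ s) s) ∧
      ContDiff ℝ 1 (fun s ↦ ∫ r in a..s, φ r) := by
  have h : ∀ s, HasDerivAt (fun s ↦ ∫ r in a..s, φ r) (φ s) s := fun s ↦
    intervalIntegral.integral_hasDerivAt_right (hφ.intervalIntegrable _ _)
      hφ.aestronglyMeasurable.stronglyMeasurableAtFilter hφ.continuousAt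
  refine ⟨h, contDiff_one_iff_deriv.2 ⟨fun s ↦ (h s).differentiableAt, ?_⟩⟩
  rwa [funext fun s ↦ (h s).deriv]

/-! ### A weak maximum principle -/

section Consequences

variable {M : Type*} [MetricSpace M] [ChartedSpace (EuclideanHalfSpace 3) M]
  [IsManifold (𝓡∂ 3) ∞ M] [RiemannianBundle (fun x : M ↦ TangentSpace (𝓡∂ 3) x)]

set_option linter.unusedSectionVars false

/-- The end is homeomorphic to an open subset of ℝ³, hence σ-compact, and the rest is compact. -/
theorem IsAsymptoticallyFlat.sigmaCompactSpace (h : IsAsymptoticallyFlat M) : SigmaCompactSpace M := by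
  obtain ⟨K, R, τ, C, Φ, hK, -, -, hsrc, htgt, -⟩ := h
  have h1 : IsSigmaCompact Φ.target := by
    rw [isSigmaCompact_iff_sigmaCompactSpace]
    have : LocallyCompactSpace Φ.target := Φ.open_target.locallyCompactSpace
    infer_instance
  have h2 : IsSigmaCompact Φ.source := by
    rw [← Φ.symm_image_target_eq_source]
    exact h1.image_of_continuousOn Φ.symm.continuousOn
  rw [← isSigmaCompact_univ_iff, ← union_compl_self K, ← hsrc]
  obtain ⟨S, hS, hSU⟩ := h2
  refine ⟨fun n ↦ K ∪ S n, fun n ↦ hK.union (hS n), ?_⟩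
  rw [← union_iUnion, hSU]

variable [IsContMDiffRiemannianBundle (𝓡∂ 3) ∞ E3 (fun x : M ↦ TangentSpace (𝓡∂ 3) x)]
  [IsRiemannianManifold (𝓡∂ 3) M] [MeasurableSpace M] [BorelSpace M] [SigmaCompactSpace M]

theorem isCompact_abs_ge {u : M → ℝ} (huc : Continuous u)
    (hinf : Tendsto u (cocompact M) (𝓝 0)) {c : ℝ} (hc : 0 < c) : IsCompact {x | c ≤ |u x|} := by
  have h1 : ∀ᶠ x in cocompact M, |u x| < c := by
    have := (continuous_abs.tendsto (0 : ℝ)).comp hinf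
    rw [abs_zero] at this
    exact this.eventually (gt_mem_nhds hc)
  obtain ⟨K, hK, hKs⟩ := mem_cocompact.1 h1
  refine hK.of_isClosed_subset (isClosed_le continuous_const huc.abs) fun x hx ↦ ?_
  by_contra hxK
  have h2 : |u x| < c := hKs hxK
  have h3 : c ≤ |u x| := hx
  linarith

/-- A harmonic function has vanishing gradient wherever the derivative of a test profile is
positive, if the profile, composed with the function, is an admissible test function. -/
theorem gradPair_self_eq_zero_of_profile {u : M → ℝ} (hu : IsHarmonic u) {φ : ℝ → ℝ}
    (hφ : Continuous φ) (hφ0 : ∀ s, 0 ≤ φ s) {a : ℝ} {C : Set M} (hC : IsCompact C)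
    (hCb : ∀ x ∈ C, x ∉ (𝓡∂ 3).boundary M) (hsupp : ∀ x ∉ C, ∫ r in a..u x, φ r = 0)
    (hφC : ∀ x ∉ C, φ (u x) = 0) {x : M} (hx : φ (u x) ≠ 0) : gradPair u u x = 0 := by
  have hu1 : ContMDiff (𝓡∂ 3) 𝓘(ℝ, ℝ) 1 u := hu.1.of_le one_le_two
  obtain ⟨hder, hsm⟩ := contDiff_one_primitive hφ a
  -- The gradient of this test function is φ(u)∇u, so the weak equation reads ∫ φ(u)|∇u|² = 0 with a
  -- continuous nonnegative integrand.
  set ζ : M → ℝ := fun x ↦ ∫ r in a..u x, φ r with hζ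
  have hζs : ContMDiff (𝓡∂ 3) 𝓘(ℝ, ℝ) 1 ζ := hsm.contMDiff.comp hu1
  have hts : tsupport ζ ⊆ C := closure_minimal
    (fun x hx ↦ by by_contra h; exact hx (hsupp x h)) hC.isClosed
  have h0 := integral_gradPair_eq_zero hu hζs (HasCompactSupport.intro hC hsupp)
    fun x hx ↦ hCb x (hts hx)
  have heq : gradPair ζ u = fun x ↦ φ (u x) * gradPair u u x := by
    ext x
    exact gradPair_comp (hder (u x)) (hu1.mdifferentiable one_ne_zero x)
  rw [heq] at h0
  have := isLocallyFiniteMeasure_volume (M := M)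
  have := isOpenPosMeasure_volume (M := M)
  by_contra hne
  have hpos := Continuous.integral_pos_of_hasCompactSupport_nonneg_nonzero
    (μ := (μHE[3] : Measure M)) (f := fun x ↦ φ (u x) * gradPair u u x)
    ((hφ.comp hu1.continuous).mul (continuous_gradPair hu1 hu1))
    (HasCompactSupport.intro hC fun x hx ↦ by rw [hφC x hx, zero_mul])
    (fun x ↦ mul_nonneg (hφ0 _) (gradPair_self_nonneg _ _)) (mul_ne_zero hx hne)
  exact hpos.ne' h0

/-- The profile is the positive part of s − c, with c midway between 1 and `u x`. The set {u ≥ c} is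
compact by the decay of u and misses the boundary, where u = 1. -/
theorem gradPair_self_eq_zero_of_one_lt {u : M → ℝ} (hu : IsHarmonic u)
    (hub : ∀ x ∈ (𝓡∂ 3).boundary M, u x = 1) (hinf : Tendsto u (cocompact M) (𝓝 0)) {x : M}
    (hx : 1 < u x) : gradPair u u x = 0 := by
  set c := (1 + u x) / 2 with hc
  have hz : ∀ s ≤ c, max (s - c) 0 = 0 := fun s hs ↦ max_eq_right (by linarith)
  have hcomp := isCompact_abs_ge hu.1.continuous hinf (c := c) (by linarith)
  refine gradPair_self_eq_zero_of_profile hu (φ := fun s ↦ max (s - c) 0) (by fun_prop)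
    (fun s ↦ le_max_right _ _) (a := c) (C := {x | c ≤ u x})
    (hcomp.of_isClosed_subset (isClosed_le continuous_const hu.1.continuous)
      fun y hy ↦ show c ≤ |u y| from le_trans hy (le_abs_self _))
    (fun y hy hb ↦ ?_) (fun y hy ↦ ?_) (fun y hy ↦ hz _ (not_le.1 hy).le) ?_
  · have : c ≤ u y := hy
    rw [hub y hb] at this
    linarith
  · refine intervalIntegral.integral_zero_ae (Eventually.of_forall fun r hr ↦ hz r ?_)
    rw [uIoc_of_ge (not_le.1 hy).le] at hr
    exact hr.2
  · rw [max_eq_left (by linarith)]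
    linarith

/-- The same argument below 0, with c = `u x` / 2. Negative values matter because `Real.log` of a
negative number is the logarithm of its absolute value. -/
theorem gradPair_self_eq_zero_of_neg {u : M → ℝ} (hu : IsHarmonic u)
    (hub : ∀ x ∈ (𝓡∂ 3).boundary M, u x = 1) (hinf : Tendsto u (cocompact M) (𝓝 0)) {x : M}
    (hx : u x < 0) : gradPair u u x = 0 := by
  set c := u x / 2 with hc
  have hz : ∀ s, c ≤ s → max (c - s) 0 = 0 := fun s hs ↦ max_eq_right (by linarith)
  have hcomp := isCompact_abs_ge hu.1.continuous hinf (c := -c) (by linarith)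
  refine gradPair_self_eq_zero_of_profile hu (φ := fun s ↦ max (c - s) 0) (by fun_prop)
    (fun s ↦ le_max_right _ _) (a := c) (C := {x | u x ≤ c})
    (hcomp.of_isClosed_subset (isClosed_le hu.1.continuous continuous_const)
      fun y hy ↦ show -c ≤ |u y| from le_trans (neg_le_neg hy) (neg_le_abs _))
    (fun y hy hb ↦ ?_) (fun y hy ↦ ?_) (fun y hy ↦ hz _ (not_le.1 hy).le) ?_
  · have : u y ≤ c := hy
    rw [hub y hb] at this
    linarith
  · refine intervalIntegral.integral_zero_ae (Eventually.of_forall fun r hr ↦ hz r ?_)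
    rw [uIoc_of_le (not_le.1 hy).le] at hr
    exact hr.1.le
  · rw [max_eq_left (by linarith)]
    linarith

/-- Near a regular point, `u ≤ 1`. -/
theorem eventually_le_one {u : M → ℝ} (hu : IsHarmonic u)
    (hub : ∀ x ∈ (𝓡∂ 3).boundary M, u x = 1) (hinf : Tendsto u (cocompact M) (𝓝 0)) {x : M}
    (hx : gradPair u u x ≠ 0) : ∀ᶠ z in 𝓝 x, u z ≤ 1 := by
  have hu1 : ContMDiff (𝓡∂ 3) 𝓘(ℝ, ℝ) 1 u := hu.1.of_le one_le_two
  filter_upwards [(continuous_gradPair hu1 hu1).continuousAt.eventually_ne hx] with z hz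
  by_contra h
  exact hz (gradPair_self_eq_zero_of_one_lt hu hub hinf (not_le.1 h))

/-- Since u ≤ 1 near a regular point, the value 1 at an interior one would be a local maximum, where
the derivative vanishes. -/
theorem lt_one_of_regular_interior {u : M → ℝ} (hu : IsHarmonic u)
    (hub : ∀ x ∈ (𝓡∂ 3).boundary M, u x = 1) (hinf : Tendsto u (cocompact M) (𝓝 0)) {x : M}
    (hx : gradPair u u x ≠ 0) (hxb : x ∉ (𝓡∂ 3).boundary M) : u x < 1 := by
  have hle := eventually_le_one hu hub hinf hx
  refine lt_of_le_of_ne hle.self_of_nhds fun h1 ↦ hx ?_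
  set y₀ := extChartAt (𝓡∂ 3) x x with hy₀
  have hy : y₀ ∈ chartDom x := mem_extChartAt_target x
  have hyi : y₀ ∈ interior (chartDom x) := mem_interior_chartDom (mem_extChartAt_source x) hxb
  have hxy : chartParam x y₀ = x := extChartAt_to_inv x
  have hnh : halfSpace3 ∈ 𝓝 y₀ := mem_of_superset (isOpen_interior.mem_nhds hyi)
    (interior_subset.trans (chartDom_subset x))
  have hmax : IsLocalMax (u ∘ chartParam x) y₀ := by
    have hc : ContinuousAt (chartParam x) y₀ := continuousAt_extChartAt_symm x
    have := hc.tendsto.eventually (by rw [hxy]; exact hle)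
    filter_upwards [this] with z hz
    simpa [hxy, h1] using hz
  have hmd : MDifferentiableAt (𝓡∂ 3) 𝓘(ℝ, ℝ) u (chartParam x y₀) :=
    hu.1.mdifferentiable two_ne_zero _
  rw [← hxy, gradPair_chartParam hy hmd hmd]
  have hz : ∀ i, chartPartial x u i y₀ = 0 := fun i ↦ by
    rw [chartPartial, fderivWithin_of_mem_nhds hnh, hmax.fderiv_eq_zero]
    rfl
  simp [hz]

end Consequences

/-! ### Odd reflection across the flat boundary -/

section Reflection

/-- The reflection of `ℝ³` in the boundary of the half-space. -/
def reflect3 : E3 →L[ℝ] E3 :=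
  ContinuousLinearMap.id ℝ E3 -
    (2 : ℝ) • (EuclideanSpace.proj (0 : Fin 3) : E3 →L[ℝ] ℝ).smulRight (stdVec 0)

theorem reflect3_apply (v : E3) : reflect3 v = v - (2 * v 0) • stdVec 0 := by
  simp [reflect3, smul_smul]

theorem reflect3_zero (v : E3) : reflect3 v 0 = - v 0 := by
  simp [reflect3_apply, stdVec]; ring

theorem reflect3_of_zero {v : E3} (h : v 0 = 0) : reflect3 v = v := by
  simp [reflect3_apply, h]

theorem dist_reflect3 (v : E3) {y₀ : E3} (h : y₀ 0 = 0) : dist (reflect3 v) y₀ = dist v y₀ := by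
  rw [EuclideanSpace.dist_eq, EuclideanSpace.dist_eq]
  congr 1
  simp only [Fin.sum_univ_three, reflect3_apply, stdVec, Real.dist_eq, sq_abs]
  simp [h]
  ring

/-- Vertical motion towards the flat boundary does not leave a ball centred on it. -/
theorem dist_sub_smul_le (y y₀ : E3) (h : y₀ 0 = 0) {c : ℝ} (hc : |y 0 - c| ≤ |y 0|) :
    dist (y - c • stdVec 0) y₀ ≤ dist y y₀ := by
  rw [EuclideanSpace.dist_eq, EuclideanSpace.dist_eq]
  apply Real.sqrt_le_sqrt
  simp only [Fin.sum_univ_three, stdVec, Real.dist_eq, sq_abs]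
  have := sq_le_sq.2 hc
  simp [h]
  linarith

variable {f : E3 → ℝ} {y₀ : E3} {r : ℝ}

theorem continuousOn_fderivWithin_halfSpace3
    (hf : ContDiffOn ℝ 1 f (Metric.ball y₀ r ∩ halfSpace3)) :
    ContinuousOn (fderivWithin ℝ f halfSpace3) (Metric.ball y₀ r ∩ halfSpace3) := by
  have hu : UniqueDiffOn ℝ (Metric.ball y₀ r ∩ halfSpace3) := by
    rw [inter_comm]; exact uniqueDiffOn_halfSpace3.inter Metric.isOpen_ball
  refine (hf.continuousOn_fderivWithin hu le_rfl).congr fun y hy ↦ ?_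
  rw [inter_comm, fderivWithin_inter (Metric.isOpen_ball.mem_nhds hy.1)]

theorem hasFDerivWithinAt_halfSpace3
    (hf : ContDiffOn ℝ 1 f (Metric.ball y₀ r ∩ halfSpace3)) {y : E3}
    (hy : y ∈ Metric.ball y₀ r ∩ halfSpace3) :
    HasFDerivWithinAt f (fderivWithin ℝ f halfSpace3 y) halfSpace3 y := by
  have h1 := (hf.differentiableOn one_ne_zero) y hy
  rw [inter_comm, differentiableWithinAt_inter (Metric.isOpen_ball.mem_nhds hy.1)] at h1
  exact h1.hasFDerivWithinAt

/-- Along a line in the flat part the function is constantly 1 near `y`. -/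
theorem fderivWithin_tangential
    (hf : ContDiffOn ℝ 1 f (Metric.ball y₀ r ∩ halfSpace3))
    (hf1 : ∀ y ∈ Metric.ball y₀ r, y 0 = 0 → f y = 1) {y : E3} (hy : y ∈ Metric.ball y₀ r)
    (hy0 : y 0 = 0) {v : E3} (hv : v 0 = 0) : fderivWithin ℝ f halfSpace3 y v = 0 := by
  have hyH : y ∈ halfSpace3 := mem_halfSpace3.2 hy0.ge
  have h1 := hasFDerivWithinAt_halfSpace3 hf ⟨hy, hyH⟩
  have hc : HasDerivAt (fun t : ℝ ↦ y + t • v) v 0 := by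
    simpa using ((hasDerivAt_id (0 : ℝ)).smul_const v).const_add y
  have h2 : HasDerivAt (fun t : ℝ ↦ f (y + t • v)) (fderivWithin ℝ f halfSpace3 y v) 0 := by
    have := HasFDerivWithinAt.comp_hasDerivWithinAt_of_eq (0 : ℝ) (t := halfSpace3) (s := univ)
      (f := fun t : ℝ ↦ y + t • v) (l := f) h1 hc.hasDerivWithinAt
      (fun t _ ↦ mem_halfSpace3.2 (by simp [hy0, hv])) (by simp)
    exact this.hasDerivAt univ_mem
  have hev : (fun t : ℝ ↦ f (y + t • v)) =ᶠ[𝓝 0] fun _ ↦ 1 := by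
    have hcont : ContinuousAt (fun t : ℝ ↦ y + t • v) 0 := hc.continuousAt
    have : ∀ᶠ t in 𝓝 (0 : ℝ), y + t • v ∈ Metric.ball y₀ r :=
      hcont.preimage_mem_nhds (by simpa using Metric.isOpen_ball.mem_nhds hy)
    filter_upwards [this] with t ht
    exact hf1 _ ht (by simp [hy0, hv])
  exact h2.unique ((hasDerivAt_const (0 : ℝ) (1 : ℝ)).congr_of_eventuallyEq hev)

/-- The function decreases strictly along the vertical segment from the flat part, where it is 1, up
to `y`. -/
theorem lt_one_of_fderivWithin_neg (hy₀ : y₀ 0 = 0)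
    (hf : ContDiffOn ℝ 1 f (Metric.ball y₀ r ∩ halfSpace3))
    (hf1 : ∀ y ∈ Metric.ball y₀ r, y 0 = 0 → f y = 1)
    (hneg : ∀ y ∈ Metric.ball y₀ r ∩ halfSpace3, fderivWithin ℝ f halfSpace3 y (stdVec 0) < 0)
    {y : E3} (hy : y ∈ Metric.ball y₀ r) (hpos : 0 < y 0) : f y < 1 := by
  let c : ℝ → E3 := fun t ↦ y - (y 0 - t) • stdVec 0
  have hc0 : ∀ t, c t 0 = t := fun t ↦ by simp [c, stdVec]
  have hcB : ∀ t ∈ Icc 0 (y 0), c t ∈ Metric.ball y₀ r := fun t ht ↦ by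
    refine lt_of_le_of_lt (dist_sub_smul_le y y₀ hy₀ ?_) hy
    rw [sub_sub_cancel, abs_of_nonneg ht.1, abs_of_pos hpos]
    exact ht.2
  have hcS : ∀ t ∈ Icc 0 (y 0), c t ∈ Metric.ball y₀ r ∩ halfSpace3 := fun t ht ↦
    ⟨hcB t ht, mem_halfSpace3.2 (by rw [hc0]; exact ht.1)⟩
  have hcd : ∀ t, HasDerivAt c (stdVec 0) t := fun t ↦ by
    have h := (((hasDerivAt_id t).const_sub (y 0)).smul_const (stdVec 0)).const_sub y
    simpa using h
  have hanti : StrictAntiOn (fun t ↦ f (c t)) (Icc 0 (y 0)) := by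
    refine strictAntiOn_of_deriv_neg (convex_Icc _ _) ?_ ?_
    · exact hf.continuousOn.comp (fun t _ ↦ (hcd t).continuousAt.continuousWithinAt) hcS
    · intro t ht
      rw [interior_Icc] at ht
      have htS := hcS t ⟨ht.1.le, ht.2.le⟩
      have hnh : halfSpace3 ∈ 𝓝 (c t) := by
        have ho : IsOpen {z : E3 | 0 < z 0} := isOpen_lt continuous_const (by fun_prop)
        refine mem_of_superset (ho.mem_nhds (show 0 < c t 0 by rw [hc0]; exact ht.1)) fun z hz ↦ ?_
        exact mem_halfSpace3.2 (le_of_lt hz)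
      have h1 := (hasFDerivWithinAt_halfSpace3 hf htS).hasFDerivAt hnh
      have h2 := h1.comp_hasDerivAt t (hcd t)
      have h3 : deriv (fun t ↦ f (c t)) t = fderivWithin ℝ f halfSpace3 (c t) (stdVec 0) := h2.deriv
      rw [h3]
      exact hneg _ htS
  have h := hanti ⟨le_rfl, hpos.le⟩ ⟨hpos.le, le_rfl⟩ hpos
  have he : c (y 0) = y := by simp [c]
  simp only [he] at h
  rwa [hf1 _ (hcB 0 ⟨le_rfl, hpos.le⟩) (hc0 0)] at h

/-- A `C¹` function on a half-ball, equal to `1` on the flat part and decreasing in the normal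
direction, extends by odd reflection to a `C¹` function on the ball. -/
theorem exists_reflection_extension (hy₀ : y₀ 0 = 0)
    (hf : ContDiffOn ℝ 1 f (Metric.ball y₀ r ∩ halfSpace3))
    (hf1 : ∀ y ∈ Metric.ball y₀ r, y 0 = 0 → f y = 1)
    (hneg : ∀ y ∈ Metric.ball y₀ r ∩ halfSpace3, fderivWithin ℝ f halfSpace3 y (stdVec 0) < 0) :
    ∃ F : E3 → ℝ, ContDiffOn ℝ 1 F (Metric.ball y₀ r) ∧
      (∀ y ∈ Metric.ball y₀ r ∩ halfSpace3, F y = f y) ∧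
      ∀ y ∈ Metric.ball y₀ r, (y ∈ halfSpace3 ↔ F y ≤ 1) := by
  classical
  have hRB : ∀ y ∈ Metric.ball y₀ r, reflect3 y ∈ Metric.ball y₀ r := fun y hy ↦ by
    rw [Metric.mem_ball, dist_reflect3 y hy₀]; exact hy
  have hRS : ∀ y ∈ Metric.ball y₀ r, y 0 ≤ 0 → reflect3 y ∈ Metric.ball y₀ r ∩ halfSpace3 :=
    fun y hy h ↦ ⟨hRB y hy, mem_halfSpace3.2 (by rw [reflect3_zero]; linarith)⟩
  -- Odd reflection of f − 1. The two sign changes preserve the normal derivative, and tangential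
  -- derivatives vanish on the flat part, so the pieces match to first order.
  let F : E3 → ℝ := fun y ↦ if 0 ≤ y 0 then f y else 2 - f (reflect3 y)
  let F' : E3 → E3 →L[ℝ] ℝ := fun y ↦ if 0 ≤ y 0 then fderivWithin ℝ f halfSpace3 y else
    - (fderivWithin ℝ f halfSpace3 (reflect3 y)).comp reflect3
  let N : Set E3 := {y | y 0 ≤ 0}
  have hNc : IsClosed N := isClosed_le (by fun_prop) continuous_const
  have hHc : IsClosed halfSpace3 := (𝓡∂ 3).isClosed_range
  have hFN : ∀ y ∈ Metric.ball y₀ r, y ∈ N → F y = 2 - f (reflect3 y) := by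
    intro y hy hyN
    by_cases h : 0 ≤ y 0
    · have h0 : y 0 = 0 := le_antisymm hyN h
      simp only [F, if_pos h]
      rw [reflect3_of_zero h0, hf1 y hy h0]
      norm_num
    · simp only [F, if_neg h]
  have hFH : ∀ y ∈ halfSpace3, F y = f y := fun y hy ↦ if_pos (mem_halfSpace3.1 hy)
  have hF'N : ∀ y ∈ Metric.ball y₀ r, y ∈ N →
      F' y = - (fderivWithin ℝ f halfSpace3 (reflect3 y)).comp reflect3 := by
    intro y hy hyN
    by_cases h : 0 ≤ y 0
    · have h0 : y 0 = 0 := le_antisymm hyN h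
      simp only [F', if_pos h]
      ext v
      -- The vector v + Rv is tangential, so the derivative sends Rv to minus its value at v.
      have h1 := fderivWithin_tangential hf hf1 hy h0 (v := v + reflect3 v)
        (by simp [reflect3_zero])
      rw [map_add] at h1
      simp only [reflect3_of_zero h0, neg_apply, ContinuousLinearMap.comp_apply]
      linarith
    · simp only [F', if_neg h]
  have hF'H : ∀ y ∈ halfSpace3, F' y = fderivWithin ℝ f halfSpace3 y := fun y hy ↦
    if_pos (mem_halfSpace3.1 hy)
  have hder : ∀ y ∈ Metric.ball y₀ r, HasFDerivAt F (F' y) y := by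
    intro y hy
    have hB : Metric.ball y₀ r ∈ 𝓝 y := Metric.isOpen_ball.mem_nhds hy
    -- Differentiability within the two closed half-spaces, which cover ℝ³, gives differentiability.
    -- At points off one of them the condition there is vacuous.
    have hH : HasFDerivWithinAt F (F' y) halfSpace3 y := by
      by_cases h : y ∈ halfSpace3
      · rw [hF'H y h]
        exact (hasFDerivWithinAt_halfSpace3 hf ⟨hy, h⟩).congr hFH (hFH y h)
      · exact HasFDerivWithinAt.of_notMem_closure (by rwa [hHc.closure_eq])
    have hN : HasFDerivWithinAt F (F' y) N y := by
      by_cases h : y ∈ N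
      · rw [hF'N y hy h]
        have h1 := hasFDerivWithinAt_halfSpace3 hf (hRS y hy h)
        have h2 := (h1.comp y reflect3.hasFDerivWithinAt (t := halfSpace3) (s := N)
          fun z hz ↦ mem_halfSpace3.2 (by rw [reflect3_zero]; linarith [show z 0 ≤ 0 from hz])).const_sub 2
        refine h2.congr_of_eventuallyEq ?_ (hFN y hy h)
        filter_upwards [self_mem_nhdsWithin, mem_nhdsWithin_of_mem_nhds hB] with z hz hzB
        exact hFN z hzB hz
      · exact HasFDerivWithinAt.of_notMem_closure (by rwa [hNc.closure_eq])
    have hun : halfSpace3 ∪ N = univ := by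
      ext z
      simp only [mem_union, mem_halfSpace3, mem_univ, iff_true]
      exact le_total 0 (z 0)
    have := hH.union hN
    rwa [hun, hasFDerivWithinAt_univ] at this
  have hcont : ContinuousOn F' (Metric.ball y₀ r) := by
    have hf'c := continuousOn_fderivWithin_halfSpace3 hf
    have h1 : ContinuousOn F' (Metric.ball y₀ r ∩ halfSpace3) :=
      hf'c.congr fun y hy ↦ hF'H y hy.2
    have h2 : ContinuousOn F' (Metric.ball y₀ r ∩ N) := by
      have h3 : ContinuousOn (fun y ↦ - (fderivWithin ℝ f halfSpace3 (reflect3 y)).comp reflect3)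
          (Metric.ball y₀ r ∩ N) := by
        refine ((hf'c.comp reflect3.continuous.continuousOn
          fun y hy ↦ hRS y hy.1 hy.2).clm_comp continuousOn_const).neg
      exact h3.congr fun y hy ↦ hF'N y hy.1 hy.2
    intro y hy
    have hB : Metric.ball y₀ r ∈ 𝓝 y := Metric.isOpen_ball.mem_nhds hy
    have a1 : ContinuousWithinAt F' halfSpace3 y := by
      by_cases h : y ∈ halfSpace3
      · have := h1 y ⟨hy, h⟩
        rwa [inter_comm, continuousWithinAt_inter hB] at this
      · exact continuousWithinAt_of_notMem_closure (by rwa [hHc.closure_eq])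
    have a2 : ContinuousWithinAt F' N y := by
      by_cases h : y ∈ N
      · have := h2 y ⟨hy, h⟩
        rwa [inter_comm, continuousWithinAt_inter hB] at this
      · exact continuousWithinAt_of_notMem_closure (by rwa [hNc.closure_eq])
    have hun : halfSpace3 ∪ N = univ := by
      ext z
      simp only [mem_union, mem_halfSpace3, mem_univ, iff_true]
      exact le_total 0 (z 0)
    have := a1.union a2
    rw [hun] at this
    exact this.mono (subset_univ _)
  refine ⟨F, ?_, fun y hy ↦ hFH y hy.2, fun y hy ↦ ?_⟩
  · rw [show (1 : WithTop ℕ∞) = 0 + 1 from (zero_add 1).symm,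
      contDiffOn_succ_iff_fderiv_of_isOpen Metric.isOpen_ball]
    refine ⟨fun y hy ↦ (hder y hy).differentiableAt.differentiableWithinAt, by simp, ?_⟩
    rw [contDiffOn_zero]
    exact hcont.congr fun y hy ↦ (hder y hy).fderiv
  · constructor
    · intro h
      rw [hFH y h]
      rcases (mem_halfSpace3.1 h).eq_or_lt with h0 | h0
      · rw [hf1 y hy h0.symm]
      · exact (lt_one_of_fderivWithin_neg hy₀ hf hf1 hneg hy h0).le
    · intro h
      by_contra hn
      rw [mem_halfSpace3, not_le] at hn
      rw [hFN y hy hn.le] at h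
      have := lt_one_of_fderivWithin_neg hy₀ hf hf1 hneg (hRB y hy) (by rw [reflect3_zero]; linarith)
      linarith

end Reflection

/-! ### Straightening the level sets near a regular point -/

section Straightening

variable {M : Type*} [MetricSpace M] [ChartedSpace (EuclideanHalfSpace 3) M]
  [IsManifold (𝓡∂ 3) ∞ M] [RiemannianBundle (fun x : M ↦ TangentSpace (𝓡∂ 3) x)]
  [IsContMDiffRiemannianBundle (𝓡∂ 3) ∞ E3 (fun x : M ↦ TangentSpace (𝓡∂ 3) x)]
  [IsRiemannianManifold (𝓡∂ 3) M] [MeasurableSpace M] [BorelSpace M] [SigmaCompactSpace M]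

set_option linter.unusedSectionVars false

theorem chartParam_mem_boundary {p : M} {y : E3} (hy : y ∈ chartDom p) (h0 : y 0 = 0) :
    chartParam p y ∈ (𝓡∂ 3).boundary M := by
  by_contra h
  have h1 := mem_interior_chartDom ((extChartAt (𝓡∂ 3) p).map_target hy) h
  rw [(extChartAt (𝓡∂ 3) p).right_inv hy] at h1
  have h2 : y ∈ interior (range (𝓡∂ 3)) := interior_mono (chartDom_subset p) h1
  rw [interior_range_modelWithCornersEuclideanHalfSpace] at h2
  exact absurd (show 0 < y 0 from h2) h0.not_gt

/-- Near a regular point, `u` in the preferred chart is the restriction to the half-space of a `C¹`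
function on an open set, and the half-space is the sublevel set of this function. -/
theorem exists_levelExtension {u : M → ℝ} (hu : IsHarmonic u)
    (hub : ∀ x ∈ (𝓡∂ 3).boundary M, u x = 1) (hinf : Tendsto u (cocompact M) (𝓝 0)) {p : M}
    (hp : gradPair u u p ≠ 0) :
    ∃ (O : Set E3) (F : E3 → ℝ), IsOpen O ∧ extChartAt (𝓡∂ 3) p p ∈ O ∧ ContDiffOn ℝ 1 F O ∧
      O ∩ halfSpace3 ⊆ chartDom p ∧ (∀ y ∈ O ∩ halfSpace3, F y = u (chartParam p y)) ∧
      ∀ y ∈ O, (y ∈ halfSpace3 ↔ F y ≤ 1) := by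
  set y₀ := extChartAt (𝓡∂ 3) p p with hy₀
  have hu1 : ContMDiff (𝓡∂ 3) 𝓘(ℝ, ℝ) 1 u := hu.1.of_le one_le_two
  have hf : ContDiffOn ℝ 1 (u ∘ chartParam p) (chartDom p) :=
    contDiffOn_comp_chartParam one_le_infty hu1 p
  have hy : y₀ ∈ chartDom p := mem_extChartAt_target p
  have hxy : chartParam p y₀ = p := extChartAt_to_inv p
  by_cases hb : p ∈ (𝓡∂ 3).boundary M
  · have h00 : y₀ 0 = 0 := by
      have h1 : y₀ ∈ frontier (range (𝓡∂ 3)) := hb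
      rw [frontier_range_modelWithCornersEuclideanHalfSpace] at h1
      exact (show 0 = y₀ 0 from h1).symm
    obtain ⟨O, hO, hOd⟩ := chartDom_eq_inter p
    have hyO : y₀ ∈ O := by rw [hOd] at hy; exact hy.1
    obtain ⟨r₁, hr₁, hr₁O⟩ := Metric.isOpen_iff.1 hO y₀ hyO
    have hsub : ∀ r ≤ r₁, Metric.ball y₀ r ∩ halfSpace3 ⊆ chartDom p := fun r hr ↦ by
      rw [hOd]
      exact inter_subset_inter_left _ ((Metric.ball_subset_ball hr).trans hr₁O)
    have hone : ∀ r ≤ r₁, ∀ y ∈ Metric.ball y₀ r, y 0 = 0 → (u ∘ chartParam p) y = 1 :=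
      fun r hr y hyr h0 ↦ hub _ <|
        chartParam_mem_boundary (hsub r hr ⟨hyr, mem_halfSpace3.2 h0.ge⟩) h0
    have hfr₁ := hf.mono (hsub r₁ le_rfl)
    have hmem : y₀ ∈ Metric.ball y₀ r₁ ∩ halfSpace3 :=
      ⟨Metric.mem_ball_self hr₁, mem_halfSpace3.2 h00.ge⟩
    -- The inward normal derivative. It is nonzero because tangential derivatives vanish and p is
    -- regular, and it is nonpositive because u ≤ 1 near p. Hence it is negative, as the reflection
    -- requires.
    set c := fderivWithin ℝ (u ∘ chartParam p) halfSpace3 y₀ (stdVec 0) with hc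
    have hc0 : c ≠ 0 := by
      intro h
      apply hp
      have hmd : MDifferentiableAt (𝓡∂ 3) 𝓘(ℝ, ℝ) u (chartParam p y₀) :=
        hu.1.mdifferentiable two_ne_zero _
      have hz : ∀ i, chartPartial p u i y₀ = 0 := by
        intro i
        by_cases hi : i = 0
        · rw [hi]; exact h
        · refine fderivWithin_tangential hfr₁ (hone r₁ le_rfl) hmem.1 h00 ?_
          simp [stdVec, Ne.symm hi]
      have := gradPair_chartParam hy hmd hmd
      rw [hxy] at this
      rw [this]
      simp [hz]
    have hle : c ≤ 0 := by
      have hd := hasFDerivWithinAt_halfSpace3 hfr₁ hmem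
      have hcd : HasDerivAt (fun t : ℝ ↦ y₀ + t • stdVec 0) (stdVec 0) 0 := by
        simpa using ((hasDerivAt_id (0 : ℝ)).smul_const (stdVec 0)).const_add y₀
      have hmaps : ∀ t ∈ Ici (0 : ℝ), y₀ + t • stdVec 0 ∈ halfSpace3 := fun t ht ↦
        mem_halfSpace3.2 (by simpa [h00, stdVec] using ht)
      have h2 : HasDerivWithinAt (fun t : ℝ ↦ (u ∘ chartParam p) (y₀ + t • stdVec 0)) c (Ici 0) 0 :=
        HasFDerivWithinAt.comp_hasDerivWithinAt_of_eq (0 : ℝ) (t := halfSpace3) (s := Ici 0)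
          (f := fun t : ℝ ↦ y₀ + t • stdVec 0) (l := u ∘ chartParam p) hd hcd.hasDerivWithinAt
          hmaps (by simp)
      have h3 := hasDerivWithinAt_iff_tendsto_slope.1 h2
      rw [Ici_sdiff_left] at h3
      refine le_of_tendsto h3 ?_
      have hcont : ContinuousAt (fun t : ℝ ↦ chartParam p (y₀ + t • stdVec 0)) 0 := by
        have hca : ContinuousAt (chartParam p) y₀ := continuousAt_extChartAt_symm p
        exact ContinuousAt.comp_of_eq hca hcd.continuousAt (by simp)
      have hev : ∀ᶠ t in 𝓝 (0 : ℝ), u (chartParam p (y₀ + t • stdVec 0)) ≤ 1 :=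
        hcont.tendsto.eventually (by
          rw [zero_smul, add_zero, hxy]; exact eventually_le_one hu hub hinf hp)
      filter_upwards [mem_nhdsWithin_of_mem_nhds hev, self_mem_nhdsWithin] with t ht htpos
      have h1 : u (chartParam p y₀) = 1 := by rw [hxy]; exact hub p hb
      have ht' : 0 < t := htpos
      have ht'' : u (chartParam p (y₀ + t • stdVec 0)) ≤ 1 := ht
      rw [slope_def_field]
      simp only [Function.comp, zero_smul, add_zero, sub_zero, h1]
      exact div_nonpos_of_nonpos_of_nonneg (by linarith) ht'.le
    have hlt : c < 0 := lt_of_le_of_ne hle hc0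
    have hcont : ContinuousWithinAt
        (fun y ↦ fderivWithin ℝ (u ∘ chartParam p) halfSpace3 y (stdVec 0))
        (Metric.ball y₀ r₁ ∩ halfSpace3) y₀ :=
      ((continuousOn_fderivWithin_halfSpace3 hfr₁).clm_apply continuousOn_const) y₀ hmem
    rw [inter_comm, continuousWithinAt_inter (Metric.ball_mem_nhds _ hr₁)] at hcont
    obtain ⟨r₂, hr₂, hr₂s⟩ := Metric.mem_nhdsWithin_iff.1 (hcont.eventually (gt_mem_nhds hlt))
    set r := min r₁ r₂ with hr
    obtain ⟨F, hF1, hF2, hF3⟩ := exists_reflection_extension (r := r) h00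
      (hf.mono (hsub r (min_le_left _ _))) (hone r (min_le_left _ _))
      fun y hy ↦ hr₂s ⟨Metric.ball_subset_ball (min_le_right _ _) hy.1, hy.2⟩
    exact ⟨Metric.ball y₀ r, F, Metric.isOpen_ball, Metric.mem_ball_self (lt_min hr₁ hr₂), hF1,
      hsub r (min_le_left _ _), hF2, hF3⟩
  · have hyi : y₀ ∈ interior (chartDom p) := mem_interior_chartDom (mem_extChartAt_source p) hb
    have hlt : u (chartParam p y₀) < 1 := by
      rw [hxy]; exact lt_one_of_regular_interior hu hub hinf hp hb
    have hfi := hf.mono (interior_subset (s := chartDom p))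
    -- At an interior regular point u < 1, so on a small neighbourhood both sides of the required
    -- equivalence hold and no extension is needed.
    refine ⟨interior (chartDom p) ∩ (u ∘ chartParam p) ⁻¹' Iio 1, u ∘ chartParam p,
      hfi.continuousOn.isOpen_inter_preimage isOpen_interior isOpen_Iio, ⟨hyi, hlt⟩,
      hfi.mono inter_subset_left, fun y hy ↦ interior_subset hy.1.1, fun y _ ↦ rfl,
      fun y hy ↦ ⟨fun _ ↦ le_of_lt hy.2, fun _ ↦ chartDom_subset p (interior_subset hy.1)⟩⟩

/-- Straightening of the level sets of `u` near a regular point: a `C¹` change of coordinates in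
which `u` is the `j`-th coordinate and the half-space is `{z | z j ≤ 1}`. -/
theorem exists_straightening {u : M → ℝ} (hu : IsHarmonic u)
    (hub : ∀ x ∈ (𝓡∂ 3).boundary M, u x = 1) (hinf : Tendsto u (cocompact M) (𝓝 0)) {p : M}
    (hp : gradPair u u p ≠ 0) :
    ∃ (j : Fin 3) (e : OpenPartialHomeomorph E3 E3), extChartAt (𝓡∂ 3) p p ∈ e.source ∧
      e.source ∩ halfSpace3 ⊆ chartDom p ∧ ContDiffOn ℝ 1 e e.source ∧
      ContDiffOn ℝ 1 e.symm e.target ∧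
      (∀ y ∈ e.source, (y ∈ halfSpace3 ↔ e y j ≤ 1)) ∧
      ∀ y ∈ e.source ∩ halfSpace3, u (chartParam p y) = e y j := by
  obtain ⟨O, F, hO, hy₀O, hF, hOd, hFu, hFH⟩ := exists_levelExtension hu hub hinf hp
  set y₀ := extChartAt (𝓡∂ 3) p p with hy₀
  have hy : y₀ ∈ chartDom p := mem_extChartAt_target p
  have hxy : chartParam p y₀ = p := extChartAt_to_inv p
  have hyH : y₀ ∈ halfSpace3 := chartDom_subset p hy
  have hFd : ∀ y ∈ O, HasFDerivAt F (fderiv ℝ F y) y := fun y hy ↦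
    ((hF.contDiffAt (hO.mem_nhds hy)).differentiableAt one_ne_zero).hasFDerivAt
  obtain ⟨j, hj⟩ : ∃ j, fderiv ℝ F y₀ (stdVec j) ≠ 0 := by
    by_contra! h
    apply hp
    have hmd : MDifferentiableAt (𝓡∂ 3) 𝓘(ℝ, ℝ) u (chartParam p y₀) :=
      hu.1.mdifferentiable two_ne_zero _
    have hz : ∀ i, chartPartial p u i y₀ = 0 := by
      intro i
      have h1 : HasFDerivWithinAt (u ∘ chartParam p) (fderiv ℝ F y₀) halfSpace3 y₀ := by
        refine (hFd y₀ hy₀O).hasFDerivWithinAt.congr_of_eventuallyEq ?_ (hFu y₀ ⟨hy₀O, hyH⟩).symm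
        filter_upwards [self_mem_nhdsWithin, mem_nhdsWithin_of_mem_nhds (hO.mem_nhds hy₀O)]
          with z hz hzO
        exact (hFu z ⟨hzO, hz⟩).symm
      rw [chartPartial, h1.fderivWithin (uniqueDiffOn_halfSpace3 y₀ hyH)]
      exact h i
    have := gradPair_chartParam hy hmd hmd
    rw [hxy] at this
    rw [this]
    simp [hz]
  -- The `j`-th coordinate is replaced by `F`. The derivative of this map is injective wherever ∂ⱼF
  -- ≠ 0, so the inverse function theorem applies.
  let θ : E3 → E3 := fun y ↦ y + (F y - y j) • stdVec j
  have hθj : ∀ y, θ y j = F y := fun y ↦ by simp [θ, stdVec]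
  have hθ : ContDiffOn ℝ 1 θ O :=
    contDiffOn_id.add ((hF.sub (by fun_prop)).smul contDiffOn_const)
  let L : E3 → E3 →L[ℝ] E3 := fun y ↦ ContinuousLinearMap.id ℝ E3 +
    (fderiv ℝ F y - (EuclideanSpace.proj j : E3 →L[ℝ] ℝ)).smulRight (stdVec j)
  have hL : ∀ y ∈ O, HasFDerivAt θ (L y) y := fun y hy ↦
    (hasFDerivAt_id y).add (((hFd y hy).sub
      (EuclideanSpace.proj j : E3 →L[ℝ] ℝ).hasFDerivAt).smul_const (stdVec j))
  have hLinj : ∀ y, fderiv ℝ F y (stdVec j) ≠ 0 → Function.Injective (L y) := by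
    intro y hy
    rw [injective_iff_map_eq_zero]
    intro v hv
    have hv1 : v + (fderiv ℝ F y v - v j) • stdVec j = 0 := hv
    have hv2 : v = (v j - fderiv ℝ F y v) • stdVec j := by
      rw [← sub_eq_zero, ← hv1]; module
    have hv3 : fderiv ℝ F y v = 0 := by
      have := congrArg (fun w : E3 ↦ w j) hv1
      simpa [stdVec] using this
    rw [hv3, sub_zero] at hv2
    rw [hv2, map_smul, smul_eq_mul] at hv3
    rcases mul_eq_zero.1 hv3 with h | h
    · rw [hv2, h, zero_smul]
    · exact absurd h hy
  -- Restricting to ∂ⱼF ≠ 0 makes the local inverse C¹ on its whole domain and not only at the image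
  -- of the base point.
  let O' : Set E3 := O ∩ (fun y ↦ fderiv ℝ F y (stdVec j)) ⁻¹' {0}ᶜ
  have hO' : IsOpen O' := by
    have hc : ContinuousOn (fun y ↦ fderiv ℝ F y (stdVec j)) O :=
      (hF.continuousOn_fderiv_of_isOpen hO le_rfl).clm_apply continuousOn_const
    exact hc.isOpen_inter_preimage hO isOpen_compl_singleton
  have hequiv : ∀ y ∈ O', ∃ L' : E3 ≃L[ℝ] E3, HasFDerivAt θ (L' : E3 →L[ℝ] E3) y := by
    intro y hy
    let L' := (LinearEquiv.ofInjectiveEndo (L y).toLinearMap (hLinj y hy.2)).toContinuousLinearEquiv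
    exact ⟨L', (hL y hy.1).congr_fderiv (by ext v; rfl)⟩
  obtain ⟨L₀, hL₀⟩ := hequiv y₀ ⟨hy₀O, hj⟩
  let e₀ := (hθ.contDiffAt (hO.mem_nhds hy₀O)).toOpenPartialHomeomorph θ hL₀ one_ne_zero
  have he₀ : (e₀ : E3 → E3) = θ := rfl
  have hy₀e : y₀ ∈ e₀.source :=
    (hθ.contDiffAt (hO.mem_nhds hy₀O)).mem_toOpenPartialHomeomorph_source hL₀ one_ne_zero
  let e := e₀.restrOpen O' hO'
  have hsrc : e.source = e₀.source ∩ O' := rfl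
  have heO' : e.source ⊆ O' := inter_subset_right
  have heO : e.source ⊆ O := heO'.trans inter_subset_left
  have heθ : (e : E3 → E3) = θ := rfl
  refine ⟨j, e, ⟨hy₀e, hy₀O, hj⟩, (inter_subset_inter_left _ heO).trans hOd, hθ.mono heO, ?_, ?_, ?_⟩
  · intro z hz
    obtain ⟨L', hL'⟩ := hequiv _ (heO' (e.map_target hz))
    exact (e.contDiffAt_symm (f₀' := L') hz hL'
      (hθ.contDiffAt (hO.mem_nhds (heO (e.map_target hz))))).contDiffWithinAt
  · intro y hy
    rw [heθ, hθj]
    exact hFH y (heO hy)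
  · intro y hy
    rw [heθ, hθj]
    exact (hFu y ⟨heO hy.1, hy.2⟩).symm

end Straightening

/-- The chain rule for metric derivatives. -/
theorem HasMetricDeriv.comp_hasStrictFDerivAt {V W X G : Type*} [NormedAddCommGroup V]
    [NormedSpace ℝ V] [FiniteDimensional ℝ V] [NormedAddCommGroup W] [NormedSpace ℝ W]
    [FiniteDimensional ℝ W] [MetricSpace X] [NormedAddCommGroup G] [NormedSpace ℝ G]
    {ψ : W → X} {S : Set W} {S' : Set V} {T : V → W} {T' : V →L[ℝ] W} {z : V} {D : W →ₗ[ℝ] G}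
    (h : HasMetricDeriv ψ S (T z) fun w ↦ ‖D w‖) (hT : HasStrictFDerivAt T T' z)
    (hinj : Function.Injective (D ∘ₗ T'.toLinearMap)) (hS : MapsTo T S' S) :
    HasMetricDeriv (ψ ∘ T) S' z fun v ↦ ‖D (T' v)‖ := by
  obtain ⟨c, hc, hcD⟩ := (D ∘ₗ T'.toLinearMap).exists_antilipschitzWith (LinearMap.ker_eq_bot.2 hinj)
  have hlow : ∀ v, ‖v‖ ≤ c * ‖D (T' v)‖ := fun v ↦ by
    simpa [dist_eq_norm] using hcD.le_mul_dist v 0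
  obtain ⟨C, hC, hCD⟩ : ∃ C > 0, ∀ w, ‖D w‖ ≤ C * ‖w‖ := by
    refine ⟨‖LinearMap.toContinuousLinearMap D‖ + 1, by positivity, fun w ↦ ?_⟩
    have h1 : ‖D w‖ ≤ _ := (LinearMap.toContinuousLinearMap D).le_opNorm w
    nlinarith [norm_nonneg w]
  intro ε hε
  -- The metric derivative of `ψ` and the linearization of `T` each cost a factor 1 ± η. As η ≤ 1
  -- and 3η ≤ ε, one has (1 + η)² ≤ 1 + ε and (1 − η)² ≥ 1 − ε.
  set η : ℝ := min ε 1 / 3 with hη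
  have hη0 : 0 < η := by positivity
  have hηε : 3 * η ≤ ε := by rw [hη]; linarith [min_le_left ε 1]
  have hη1 : 3 * η ≤ 1 := by rw [hη]; linarith [min_le_right ε 1]
  obtain ⟨r, hr, hrψ⟩ := h η hη0
  have hc0 : (0 : ℝ) < c := by exact_mod_cast hc
  -- With this constant the strict-differentiability error, relative to ‖a − b‖, becomes a relative
  -- error η in the norm of D(T'(a − b)).
  have hδ : 0 < η / (C * c) := by positivity
  have h1 := hT.isLittleO.def hδ
  have h2 : ∀ᶠ a in 𝓝 z, T a ∈ Metric.ball (T z) r :=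
    hT.continuousAt.eventually (Metric.ball_mem_nhds _ hr)
  obtain ⟨r₁, hr₁, H₁⟩ := Metric.eventually_nhds_iff_ball.1 h1
  obtain ⟨r₂, hr₂, H₂⟩ := Metric.eventually_nhds_iff_ball.1 h2
  refine ⟨min r₁ r₂, lt_min hr₁ hr₂, fun a ha b hb ↦ ?_⟩
  have ha2 := H₂ a (Metric.ball_subset_ball (min_le_right _ _) ha.1)
  have hb2 := H₂ b (Metric.ball_subset_ball (min_le_right _ _) hb.1)
  have hab := H₁ (a, b) (by
    rw [← ball_prod_same]
    exact ⟨Metric.ball_subset_ball (min_le_left _ _) ha.1,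
      Metric.ball_subset_ball (min_le_left _ _) hb.1⟩)
  obtain ⟨hlo, hhi⟩ := hrψ (T a) ⟨ha2, hS ha.2⟩ (T b) ⟨hb2, hS hb.2⟩
  have hdiff : ‖D (T a - T b) - D (T' (a - b))‖ ≤ η * ‖D (T' (a - b))‖ := by
    rw [← map_sub]
    calc ‖D (T a - T b - T' (a - b))‖ ≤ C * (η / (C * c) * ‖a - b‖) :=
          (hCD _).trans (mul_le_mul_of_nonneg_left hab hC.le)
      _ ≤ C * (η / (C * c) * (c * ‖D (T' (a - b))‖)) := by
          gcongr; exact hlow _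
      _ = η * ‖D (T' (a - b))‖ := by field_simp
  have hup := norm_le_norm_add_norm_sub (D (T' (a - b))) (D (T a - T b))
  have hdn := norm_le_norm_add_norm_sub (D (T a - T b)) (D (T' (a - b)))
  have hn := norm_nonneg (D (T' (a - b)))
  simp only [Function.comp]
  constructor
  · refine le_trans ?_ hlo
    have : (1 - η) * ‖D (T' (a - b))‖ ≤ ‖D (T a - T b)‖ := by
      linarith [norm_sub_rev (D (T a - T b)) (D (T' (a - b)))]
    nlinarith [mul_nonneg hη0.le (mul_nonneg hη0.le hn)]
  · refine hhi.trans ?_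
    have : ‖D (T a - T b)‖ ≤ (1 + η) * ‖D (T' (a - b))‖ := by
      linarith [norm_sub_rev (D (T a - T b)) (D (T' (a - b)))]
    nlinarith [mul_nonneg hη0.le hn, mul_le_mul_of_nonneg_left this (show 0 ≤ 1 + η by linarith)]

/-! ### Area formula for parametrizations factoring through a chart -/

section Pullback

variable {M : Type*} [MetricSpace M] [ChartedSpace (EuclideanHalfSpace 3) M]
  [IsManifold (𝓡∂ 3) ∞ M] [RiemannianBundle (fun x : M ↦ TangentSpace (𝓡∂ 3) x)]
  [IsContMDiffRiemannianBundle (𝓡∂ 3) ∞ E3 (fun x : M ↦ TangentSpace (𝓡∂ 3) x)]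

set_option linter.unusedSectionVars false

/-- The Gram matrix of the linear map `L`, with respect to the metric in the preferred chart at `p`,
at the point `y`. -/
def pullGram {m : ℕ} (p : M) (y : E3) (L : EuclideanSpace ℝ (Fin m) →L[ℝ] E3) :
    Matrix (Fin m) (Fin m) ℝ :=
  Matrix.of fun a b ↦ ∑ k, ∑ l, L (EuclideanSpace.single a 1) k * L (EuclideanSpace.single b 1) l *
    chartMetric p y k l

theorem inner_chartDeriv (p : M) (y v w : E3) :
    inner ℝ (chartDeriv p y v) (chartDeriv p y w) = ∑ k, ∑ l, v k * w l * chartMetric p y k l := by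
  conv_lhs => rw [E3_eq_sum v, E3_eq_sum w]
  simp only [map_sum, map_smul, sum_inner, inner_sum, real_inner_smul_left, real_inner_smul_right,
    chartMetric_apply]
  rw [Finset.sum_comm]
  refine Finset.sum_congr rfl fun i _ ↦ Finset.sum_congr rfl fun j _ ↦ ?_
  ring

theorem pullGram_apply {m : ℕ} (p : M) (y : E3) (L : EuclideanSpace ℝ (Fin m) →L[ℝ] E3)
    (a b : Fin m) : pullGram p y L a b =
      inner ℝ (((chartDeriv p y).toLinearMap ∘ₗ L.toLinearMap) (EuclideanSpace.single a 1))
        (((chartDeriv p y).toLinearMap ∘ₗ L.toLinearMap) (EuclideanSpace.single b 1)) :=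
  (inner_chartDeriv p y _ _).symm

theorem injective_chartDeriv_comp {m : ℕ} {p : M} {y : E3} (hy : y ∈ chartDom p)
    {L : EuclideanSpace ℝ (Fin m) →L[ℝ] E3} (hL : Function.Injective L) :
    Function.Injective ((chartDeriv p y).toLinearMap ∘ₗ L.toLinearMap) :=
  (chartDeriv_injective hy).comp hL

theorem pullGram_det_pos {m : ℕ} {p : M} {y : E3} (hy : y ∈ chartDom p)
    {L : EuclideanSpace ℝ (Fin m) →L[ℝ] E3} (hL : Function.Injective L) :
    0 < (pullGram p y L).det :=
  (exists_linearMap_norm_eq_of_injective _ (injective_chartDeriv_comp hy hL) _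
    (pullGram_apply p y L)).1

theorem continuousOn_pullGram_det {m n : ℕ} {p : M} {T : EuclideanSpace ℝ (Fin n) → E3}
    {T' : EuclideanSpace ℝ (Fin n) → EuclideanSpace ℝ (Fin m) →L[ℝ] E3}
    {S : Set (EuclideanSpace ℝ (Fin n))} (hS : MapsTo T S (chartDom p)) (hT : ContinuousOn T S)
    (hT' : ContinuousOn T' S) : ContinuousOn (fun z ↦ √(pullGram p (T z) (T' z)).det) S := by
  have hco : ∀ (a : Fin m) (k : Fin 3),
      ContinuousOn (fun z ↦ T' z (EuclideanSpace.single a 1) k) S := fun a k ↦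
    (EuclideanSpace.proj k : E3 →L[ℝ] ℝ).continuous.comp_continuousOn
      (hT'.clm_apply continuousOn_const)
  have hent : ∀ a b, ContinuousOn (fun z ↦ pullGram p (T z) (T' z) a b) S := fun a b ↦ by
    simp only [pullGram, Matrix.of_apply]
    refine continuousOn_finsetSum _ fun k _ ↦ continuousOn_finsetSum _ fun l _ ↦ ?_
    exact ((hco a k).mul (hco b l)).mul ((chartMetric_contDiffOn p k l).continuousOn.comp hT hS)
  exact Real.continuous_sqrt.comp_continuousOn (contDiffOn_zero.1
    (contDiffOn_matrix_det (k := 0) fun a b ↦ contDiffOn_zero.2 (hent a b)))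

variable [IsRiemannianManifold (𝓡∂ 3) M] [MeasurableSpace M] [BorelSpace M]

/-- The chain rule for metric derivatives, with the Jacobian read off as a Gram determinant. The
case m = 3 gives the volume and m = 2 the area of the level surfaces. -/
theorem chartParam_comp_hasMetricJacobian {m : ℕ} {p : M} {T : EuclideanSpace ℝ (Fin m) → E3}
    {T' : EuclideanSpace ℝ (Fin m) → EuclideanSpace ℝ (Fin m) →L[ℝ] E3}
    {S : Set (EuclideanSpace ℝ (Fin m))} (hSm : MeasurableSet S) (hS : MapsTo T S (chartDom p))
    (hT : ∀ z ∈ S, HasStrictFDerivAt T (T' z) z) (hT' : ContinuousOn T' S)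
    (hinj : ∀ z ∈ S, Function.Injective (T' z)) (hTinj : InjOn T S) :
    HasMetricJacobian (chartParam p ∘ T) S (fun z ↦ √(pullGram p (T z) (T' z)).det) where
  meas := hSm
  inj := (extChartAt (𝓡∂ 3) p).symm.injOn.comp hTinj hS
  cont := continuousOn_pullGram_det hS
    (fun z hz ↦ (hT z hz).continuousAt.continuousWithinAt) hT'
  pos z hz := Real.sqrt_pos.2 (pullGram_det_pos (hS hz) (hinj z hz))
  deriv z hz := by
    have hD := injective_chartDeriv_comp (hS hz) (hinj z hz)
    obtain ⟨-, A, hdet, hA⟩ := exists_linearMap_norm_eq_of_injective _ hD _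
      (pullGram_apply p (T z) (T' z))
    refine ⟨A, hdet, ?_⟩
    have h1 := HasMetricDeriv.comp_hasStrictFDerivAt (D := (chartDeriv p (T z)).toLinearMap)
      ((chartParam_hasMetricDeriv (hS hz)).mono (chartDom_subset p)) (hT z hz) hD hS
    simp only [hA]
    exact h1

end Pullback

/-! ### Slicing ℝ³ by coordinate hyperplanes -/

section Slices

/-- The inclusion of `ℝ²` in `ℝ³` as the hyperplane orthogonal to the `j`-th coordinate axis. -/
def sliceLin (j : Fin 3) : EuclideanSpace ℝ (Fin 2) →L[ℝ] E3 :=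
  LinearMap.toContinuousLinearMap
    { toFun := fun v ↦ WithLp.toLp 2 (j.insertNth 0 v.ofLp)
      map_add' := fun v w ↦ by
        ext i
        refine Fin.succAboveCases j ?_ (fun a ↦ ?_) i <;> simp
      map_smul' := fun c v ↦ by
        ext i
        refine Fin.succAboveCases j ?_ (fun a ↦ ?_) i <;> simp }

theorem sliceLin_same (j : Fin 3) (v : EuclideanSpace ℝ (Fin 2)) : sliceLin j v j = 0 := by
  simp [sliceLin]

theorem sliceLin_succAbove (j : Fin 3) (v : EuclideanSpace ℝ (Fin 2)) (a : Fin 2) :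
    sliceLin j v (j.succAbove a) = v a := by
  simp [sliceLin]

theorem sliceLin_single (j : Fin 3) (a : Fin 2) :
    sliceLin j (EuclideanSpace.single a 1) = stdVec (j.succAbove a) := by
  ext i
  refine Fin.succAboveCases j ?_ (fun b ↦ ?_) i
  · rw [sliceLin_same]; simp [stdVec, Fin.ne_succAbove]
  · rw [sliceLin_succAbove]
    simp [stdVec]

theorem sliceLin_injective (j : Fin 3) : Function.Injective (sliceLin j) := by
  intro v w h
  ext a
  rw [← sliceLin_succAbove j v, h, sliceLin_succAbove]

/-- The parametrization of the hyperplane `{z | z j = s}`. -/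
def slice (j : Fin 3) (s : ℝ) (v : EuclideanSpace ℝ (Fin 2)) : E3 := sliceLin j v + s • stdVec j

theorem slice_same (j : Fin 3) (s : ℝ) (v : EuclideanSpace ℝ (Fin 2)) : slice j s v j = s := by
  simp [slice, sliceLin_same, stdVec]

theorem slice_succAbove (j : Fin 3) (s : ℝ) (v : EuclideanSpace ℝ (Fin 2)) (a : Fin 2) :
    slice j s v (j.succAbove a) = v a := by
  simp [slice, sliceLin_succAbove, stdVec]

/-- The orthogonal projection along the `j`-th coordinate axis. -/
def sliceProj (j : Fin 3) (z : E3) : EuclideanSpace ℝ (Fin 2) :=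
  WithLp.toLp 2 fun a ↦ z (j.succAbove a)

theorem continuous_sliceProj (j : Fin 3) : Continuous (sliceProj j) := by
  unfold sliceProj; fun_prop

theorem sliceProj_slice (j : Fin 3) (s : ℝ) (v : EuclideanSpace ℝ (Fin 2)) :
    sliceProj j (slice j s v) = v := by
  ext a
  simp only [sliceProj, slice_succAbove]

theorem slice_sliceProj (j : Fin 3) (z : E3) : slice j (z j) (sliceProj j z) = z := by
  ext i
  refine Fin.succAboveCases j ?_ (fun a ↦ ?_) i
  · rw [slice_same]
  · rw [slice_succAbove]; rfl

theorem slice_injective (j : Fin 3) (s : ℝ) : Function.Injective (slice j s) := fun v w h ↦ by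
  rw [← sliceProj_slice j s v, h, sliceProj_slice]

theorem continuous_slice (j : Fin 3) :
    Continuous fun q : ℝ × EuclideanSpace ℝ (Fin 2) ↦ slice j q.1 q.2 := by
  unfold slice; fun_prop

theorem hasStrictFDerivAt_slice (j : Fin 3) (s : ℝ) (v : EuclideanSpace ℝ (Fin 2)) :
    HasStrictFDerivAt (slice j s) (sliceLin j) v :=
  (sliceLin j).hasStrictFDerivAt.add_const _

theorem measurePreserving_slice (j : Fin 3) :
    MeasurePreserving (fun q : ℝ × EuclideanSpace ℝ (Fin 2) ↦ slice j q.1 q.2) ∧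
      MeasurableEmbedding (fun q : ℝ × EuclideanSpace ℝ (Fin 2) ↦ slice j q.1 q.2) := by
  let e₁ : ℝ × EuclideanSpace ℝ (Fin 2) ≃ᵐ ℝ × (Fin 2 → ℝ) :=
    (MeasurableEquiv.refl ℝ).prodCongr (MeasurableEquiv.toLp 2 (Fin 2 → ℝ)).symm
  let e₂ : ℝ × (Fin 2 → ℝ) ≃ᵐ (Fin 3 → ℝ) := (MeasurableEquiv.piFinSuccAbove (fun _ ↦ ℝ) j).symm
  let e₃ : (Fin 3 → ℝ) ≃ᵐ E3 := MeasurableEquiv.toLp 2 (Fin 3 → ℝ)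
  have h₁ : MeasurePreserving e₁ := by
    have := (MeasurePreserving.id (volume : Measure ℝ)).prod (PiLp.volume_preserving_ofLp (Fin 2))
    exact this
  have h₂ : MeasurePreserving e₂ :=
    (volume_preserving_piFinSuccAbove (fun _ : Fin 3 ↦ ℝ) j).symm _
  have h₃ : MeasurePreserving e₃ := PiLp.volume_preserving_toLp (Fin 3)
  have heq : (fun q : ℝ × EuclideanSpace ℝ (Fin 2) ↦ slice j q.1 q.2) = (e₁.trans e₂).trans e₃ := by
    ext q i
    have hq : ((e₁.trans e₂).trans e₃) q =
        WithLp.toLp 2 (j.insertNth (α := fun _ ↦ ℝ) q.1 q.2.ofLp) := rfl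
    rw [hq]
    refine Fin.succAboveCases j ?_ (fun a ↦ ?_) i
    · rw [slice_same]
      simp
    · rw [slice_succAbove]
      simp
  rw [heq]
  exact ⟨h₃.comp (h₂.comp h₁), MeasurableEquiv.measurableEmbedding _⟩

theorem integral_eq_integral_slice (j : Fin 3) {f : E3 → ℝ} (hf : Integrable f) :
    ∫ z, f z = ∫ s, ∫ v, f (slice j s v) := by
  obtain ⟨h, he⟩ := measurePreserving_slice j
  rw [← h.integral_comp he, Measure.volume_eq_prod, integral_prod]
  rw [← Measure.volume_eq_prod]
  exact (h.integrable_comp_emb he).2 hf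

end Slices

/-! ### Geometry in straightened coordinates -/

section Straightened

variable {M : Type*} [MetricSpace M] [ChartedSpace (EuclideanHalfSpace 3) M]
  [IsManifold (𝓡∂ 3) ∞ M] [RiemannianBundle (fun x : M ↦ TangentSpace (𝓡∂ 3) x)]
  [IsContMDiffRiemannianBundle (𝓡∂ 3) ∞ E3 (fun x : M ↦ TangentSpace (𝓡∂ 3) x)]

set_option linter.unusedSectionVars false

/-- The change of coordinates `e`, in the preferred chart at `p`, makes `u` the `j`-th coordinate
and the half-space the set `{z | z j ≤ 1}`. -/
structure IsStraightening (u : M → ℝ) (p : M) (j : Fin 3) (e : OpenPartialHomeomorph E3 E3) :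
    Prop where
  smooth : ContMDiff (𝓡∂ 3) 𝓘(ℝ, ℝ) 1 u
  source_subset : e.source ∩ halfSpace3 ⊆ chartDom p
  contDiffOn : ContDiffOn ℝ 1 e e.source
  contDiffOn_symm : ContDiffOn ℝ 1 e.symm e.target
  mem_iff : ∀ y ∈ e.source, (y ∈ halfSpace3 ↔ e y j ≤ 1)
  eq_coord : ∀ y ∈ e.source ∩ halfSpace3, u (chartParam p y) = e y j

/-- The domain of the straightened coordinates. -/
def straightDom (j : Fin 3) (e : OpenPartialHomeomorph E3 E3) : Set E3 := e.target ∩ {z | z j ≤ 1}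

variable {u : M → ℝ} {p : M} {j : Fin 3} {e : OpenPartialHomeomorph E3 E3}

namespace IsStraightening

theorem symm_mem (h : IsStraightening u p j e) {z : E3} (hz : z ∈ straightDom j e) :
    e.symm z ∈ e.source ∩ halfSpace3 := by
  have h1 := e.map_target hz.1
  exact ⟨h1, (h.mem_iff _ h1).2 (by rw [e.right_inv hz.1]; exact hz.2)⟩

theorem mapsTo (h : IsStraightening u p j e) : MapsTo e.symm (straightDom j e) (chartDom p) :=
  fun _ hz ↦ h.source_subset (h.symm_mem hz)

theorem apply_symm (h : IsStraightening u p j e) {z : E3} (hz : z ∈ straightDom j e) :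
    u (chartParam p (e.symm z)) = z j := by
  rw [h.eq_coord _ (h.symm_mem hz), e.right_inv hz.1]

theorem hasStrictFDerivAt_symm (h : IsStraightening u p j e) {z : E3} (hz : z ∈ e.target) :
    HasStrictFDerivAt e.symm (fderiv ℝ e.symm z) z :=
  (h.contDiffOn_symm.contDiffAt (e.open_target.mem_nhds hz)).hasStrictFDerivAt one_ne_zero

theorem hasFDerivAt (h : IsStraightening u p j e) {y : E3} (hy : y ∈ e.source) :
    HasFDerivAt e (fderiv ℝ e y) y :=
  ((h.contDiffOn.contDiffAt (e.open_source.mem_nhds hy)).differentiableAt one_ne_zero).hasFDerivAt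

theorem continuousOn_fderiv_symm (h : IsStraightening u p j e) :
    ContinuousOn (fderiv ℝ e.symm) e.target :=
  h.contDiffOn_symm.continuousOn_fderiv_of_isOpen e.open_target le_rfl

theorem fderiv_comp_symm (h : IsStraightening u p j e) {z : E3} (hz : z ∈ e.target) (v : E3) :
    fderiv ℝ e (e.symm z) (fderiv ℝ e.symm z v) = v := by
  have h1 := (h.hasFDerivAt (e.map_target hz)).comp z (h.hasStrictFDerivAt_symm hz).hasFDerivAt
  have h2 : e ∘ e.symm =ᶠ[𝓝 z] id := by
    filter_upwards [e.open_target.mem_nhds hz] with w hw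
    exact e.right_inv hw
  have h3 := h1.unique ((hasFDerivAt_id z).congr_of_eventuallyEq h2)
  exact congrArg (fun L : E3 →L[ℝ] E3 ↦ L v) h3

theorem fderiv_symm_injective (h : IsStraightening u p j e) {z : E3} (hz : z ∈ e.target) :
    Function.Injective (fderiv ℝ e.symm z) := fun v w hvw ↦ by
  rw [← h.fderiv_comp_symm hz v, hvw, h.fderiv_comp_symm hz]

theorem fderivWithin_symm (h : IsStraightening u p j e) {z : E3} (hz : z ∈ straightDom j e)
    (v : E3) :
    fderivWithin ℝ (u ∘ chartParam p) halfSpace3 (e.symm z) (fderiv ℝ e.symm z v) = v j := by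
  obtain ⟨hs, hH⟩ := h.symm_mem hz
  have h1 : HasFDerivWithinAt (u ∘ chartParam p)
      ((EuclideanSpace.proj j : E3 →L[ℝ] ℝ).comp (fderiv ℝ e (e.symm z))) halfSpace3 (e.symm z) := by
    have h2 := ((EuclideanSpace.proj j : E3 →L[ℝ] ℝ).hasFDerivAt.comp (e.symm z)
      (h.hasFDerivAt hs)).hasFDerivWithinAt (s := halfSpace3)
    refine h2.congr_of_eventuallyEq ?_ (h.eq_coord _ ⟨hs, hH⟩)
    filter_upwards [self_mem_nhdsWithin, mem_nhdsWithin_of_mem_nhds (e.open_source.mem_nhds hs)]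
      with y hy hys
    exact h.eq_coord y ⟨hys, hy⟩
  rw [h1.fderivWithin (uniqueDiffOn_halfSpace3 _ hH)]
  simp [h.fderiv_comp_symm hz.1]

/-- The squared length of `∇u` is the quotient of the Gram determinants of the level sets and of
the ambient manifold. -/
theorem gradPair_mul_det (h : IsStraightening u p j e) {z : E3} (hz : z ∈ straightDom j e) :
    gradPair u u (chartParam p (e.symm z)) * (pullGram p (e.symm z) (fderiv ℝ e.symm z)).det =
      (pullGram p (e.symm z) ((fderiv ℝ e.symm z).comp (sliceLin j))).det := by
  have hy := h.mapsTo hz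
  have hinj := h.fderiv_symm_injective hz.1
  set G := pullGram p (e.symm z) (fderiv ℝ e.symm z) with hG
  have hdet : G.det ≠ 0 := (pullGram_det_pos hy hinj).ne'
  have hmd : MDifferentiableAt (𝓡∂ 3) 𝓘(ℝ, ℝ) u (chartParam p (e.symm z)) :=
    h.smooth.mdifferentiable one_ne_zero _
  have hsurj : Function.Surjective
      ((chartDeriv p (e.symm z)).toLinearMap ∘ₗ (fderiv ℝ e.symm z).toLinearMap) :=
    (chartDeriv_surjective hy).comp
      (LinearMap.injective_iff_surjective (f := (fderiv ℝ e.symm z).toLinearMap).1 hinj)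
  -- In these coordinates u is the `j`-th coordinate, so the covariant components of ∇u are those of
  -- the `j`-th unit covector and |∇u|² is the (j, j) entry of the inverse Gram matrix.
  have hP : ∀ i, inner ℝ (riemGradient u (chartParam p (e.symm z)))
      (((chartDeriv p (e.symm z)).toLinearMap ∘ₗ (fderiv ℝ e.symm z).toLinearMap)
        (EuclideanSpace.single i 1)) = if j = i then 1 else 0 := fun i ↦ by
    refine ((inner_riemGradient u _ _).trans (mfderiv_chartDeriv hy hmd _)).trans ?_
    refine (h.fderivWithin_symm hz _).trans ?_
    simp
  have h1 := inner_eq_gram_inv _ hsurj G hdet (pullGram_apply p (e.symm z) _)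
    (riemGradient u (chartParam p (e.symm z))) (riemGradient u (chartParam p (e.symm z)))
  have h2 : gradPair u u (chartParam p (e.symm z)) = G⁻¹ j j := by
    refine h1.trans ?_
    simp only [hP]
    simp
  have h3 : pullGram p (e.symm z) ((fderiv ℝ e.symm z).comp (sliceLin j)) =
      G.submatrix j.succAbove j.succAbove := by
    ext a b
    simp only [pullGram, hG, Matrix.of_apply, Matrix.submatrix_apply,
      ContinuousLinearMap.comp_apply, sliceLin_single]
    rfl
  -- By Cramer's rule that entry is a principal minor over the determinant, and the minor is the
  -- Gram determinant of the level surface.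
  rw [h2, h3, Matrix.inv_def, Matrix.smul_apply, Ring.inverse_eq_inv', smul_eq_mul,
    Matrix.adjugate_fin_succ_eq_det_submatrix]
  have hsign : (-1 : ℝ) ^ ((j : ℕ) + j) = 1 := Even.neg_one_pow ⟨j, rfl⟩
  rw [hsign]
  field_simp

/-- Described through the chart, the straightened region is seen to be open in `M`, also around
boundary points. -/
theorem image_eq (h : IsStraightening u p j e) :
    (chartParam p ∘ e.symm) '' straightDom j e =
      (extChartAt (𝓡∂ 3) p).source ∩ extChartAt (𝓡∂ 3) p ⁻¹' e.source := by
  ext x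
  constructor
  · rintro ⟨z, hz, rfl⟩
    refine ⟨(extChartAt (𝓡∂ 3) p).map_target (h.mapsTo hz), ?_⟩
    rw [mem_preimage, Function.comp_apply, (extChartAt (𝓡∂ 3) p).right_inv (h.mapsTo hz)]
    exact (h.symm_mem hz).1
  · rintro ⟨hx, hxe⟩
    have hH : extChartAt (𝓡∂ 3) p x ∈ halfSpace3 :=
      chartDom_subset p ((extChartAt (𝓡∂ 3) p).map_source hx)
    refine ⟨e (extChartAt (𝓡∂ 3) p x), ⟨e.map_source hxe, (h.mem_iff _ hxe).1 hH⟩, ?_⟩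
    rw [Function.comp_apply, e.left_inv hxe]
    exact (extChartAt (𝓡∂ 3) p).left_inv hx

theorem isOpen_image (h : IsStraightening u p j e) :
    IsOpen ((chartParam p ∘ e.symm) '' straightDom j e) := by
  rw [h.image_eq]
  exact isOpen_extChartAt_preimage' p e.open_source

theorem image_slice (h : IsStraightening u p j e) (s : ℝ) :
    (chartParam p ∘ e.symm ∘ slice j s) '' (slice j s ⁻¹' straightDom j e) =
      {x | u x = s} ∩ (chartParam p ∘ e.symm) '' straightDom j e := by
  ext x
  constructor
  · rintro ⟨v, hv, rfl⟩
    refine ⟨?_, slice j s v, hv, rfl⟩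
    change u (chartParam p (e.symm (slice j s v))) = s
    rw [h.apply_symm hv, slice_same]
  · rintro ⟨hx, z, hz, rfl⟩
    have hs : z j = s := by
      rw [← h.apply_symm hz]; exact hx
    have hzs : slice j s (sliceProj j z) = z := by rw [← hs, slice_sliceProj]
    exact ⟨sliceProj j z, by rw [mem_preimage, hzs]; exact hz, by simp [hzs]⟩

theorem measurableSet_straightDom (j : Fin 3) (e : OpenPartialHomeomorph E3 E3) :
    MeasurableSet (straightDom j e) :=
  e.open_target.measurableSet.inter
    (isClosed_le (by fun_prop) continuous_const).measurableSet

variable [IsRiemannianManifold (𝓡∂ 3) M] [MeasurableSpace M] [BorelSpace M]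

theorem hasMetricJacobian (h : IsStraightening u p j e) :
    HasMetricJacobian (chartParam p ∘ e.symm) (straightDom j e)
      (fun z ↦ √(pullGram p (e.symm z) (fderiv ℝ e.symm z)).det) :=
  chartParam_comp_hasMetricJacobian (measurableSet_straightDom j e) h.mapsTo
    (fun _ hz ↦ h.hasStrictFDerivAt_symm hz.1) (h.continuousOn_fderiv_symm.mono inter_subset_left)
    (fun _ hz ↦ h.fderiv_symm_injective hz.1) (e.symm.injOn.mono inter_subset_left)

theorem hasMetricJacobian_slice (h : IsStraightening u p j e) (s : ℝ) :
    HasMetricJacobian (chartParam p ∘ e.symm ∘ slice j s) (slice j s ⁻¹' straightDom j e)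
      (fun v ↦ √(pullGram p (e.symm (slice j s v))
        ((fderiv ℝ e.symm (slice j s v)).comp (sliceLin j))).det) := by
  have hc : Continuous (slice j s) := (continuous_slice j).comp (by fun_prop : Continuous fun v ↦ (s, v))
  refine chartParam_comp_hasMetricJacobian (T := e.symm ∘ slice j s)
    (T' := fun v ↦ (fderiv ℝ e.symm (slice j s v)).comp (sliceLin j))
    (hc.measurable (measurableSet_straightDom j e)) (fun v hv ↦ h.mapsTo hv)
    (fun v hv ↦ (h.hasStrictFDerivAt_symm hv.1).comp v (hasStrictFDerivAt_slice j s v)) ?_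
    (fun v hv ↦ (h.fderiv_symm_injective hv.1).comp (sliceLin_injective j))
    (fun v hv w hw hvw ↦ slice_injective j s (e.symm.injOn hv.1 hw.1 hvw))
  exact (h.continuousOn_fderiv_symm.comp hc.continuousOn fun v hv ↦ hv.1).clm_comp
    continuousOn_const

end IsStraightening

end Straightened

/-! ### The coarea formula on the regular set -/

section Coarea

variable {M : Type*} [MetricSpace M] [ChartedSpace (EuclideanHalfSpace 3) M]
  [IsManifold (𝓡∂ 3) ∞ M] [RiemannianBundle (fun x : M ↦ TangentSpace (𝓡∂ 3) x)]
  [MeasurableSpace M] [BorelSpace M]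

set_option linter.unusedSectionVars false

/-- The flux of `∇u` through the level set `{u = s}`, with the weight `χ`. -/
def levelFlux (u χ : M → ℝ) (s : ℝ) : ℝ :=
  ∫ x in {x | u x = s}, χ x * ‖riemGradient u x‖ ∂μHE[2]

/-- The weighted fluxes through the level sets of `u` exist, depend continuously on the level up to
the level `1`, and satisfy the coarea formula. -/
structure HasCoarea (u χ : M → ℝ) : Prop where
  integrableOn : ∀ s, IntegrableOn (fun x ↦ χ x * ‖riemGradient u x‖) {x | u x = s} μHE[2]
  continuousOn : ContinuousOn (levelFlux u χ) (Iic 1)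
  coarea : ∀ φ : ℝ → ℝ, Continuous φ →
    ∫ x, φ (u x) * (χ x * gradPair u u x) ∂μHE[3] = ∫ s, φ s * levelFlux u χ s
  integrable : ∀ φ : ℝ → ℝ, Continuous φ →
    Integrable (fun x ↦ φ (u x) * (χ x * gradPair u u x)) μHE[3]
  integrable_levelFlux : ∀ φ : ℝ → ℝ, Continuous φ → Integrable (fun s ↦ φ s * levelFlux u χ s)

variable [IsContMDiffRiemannianBundle (𝓡∂ 3) ∞ E3 (fun x : M ↦ TangentSpace (𝓡∂ 3) x)]
  [IsRiemannianManifold (𝓡∂ 3) M]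

theorem HasCoarea.sum {u : M → ℝ} {ι : Type*} (t : Finset ι) {χ : ι → M → ℝ}
    (h : ∀ i ∈ t, HasCoarea u (χ i)) : HasCoarea u (fun x ↦ ∑ i ∈ t, χ i x) := by
  have hfl : levelFlux u (fun x ↦ ∑ i ∈ t, χ i x) = fun s ↦ ∑ i ∈ t, levelFlux u (χ i) s := by
    ext s
    simp only [levelFlux, Finset.sum_mul]
    exact integral_finsetSum _ fun i hi ↦ (h i hi).integrableOn s
  refine ⟨fun s ↦ ?_, ?_, fun φ hφ ↦ ?_, fun φ hφ ↦ ?_, fun φ hφ ↦ ?_⟩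
  · simp only [Finset.sum_mul]
    exact integrable_finsetSum _ fun i hi ↦ (h i hi).integrableOn s
  · rw [hfl]
    exact continuousOn_finsetSum _ fun i hi ↦ (h i hi).continuousOn
  · simp only [hfl, Finset.sum_mul, Finset.mul_sum]
    rw [integral_finsetSum _ fun i hi ↦ (h i hi).integrable φ hφ,
      integral_finsetSum _ fun i hi ↦ (h i hi).integrable_levelFlux φ hφ]
    exact Finset.sum_congr rfl fun i hi ↦ (h i hi).coarea φ hφ
  · simp only [Finset.sum_mul, Finset.mul_sum]
    exact integrable_finsetSum _ fun i hi ↦ (h i hi).integrable φ hφ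
  · simp only [hfl, Finset.mul_sum]
    exact integrable_finsetSum _ fun i hi ↦ (h i hi).integrable_levelFlux φ hφ

variable {u : M → ℝ} {p : M} {j : Fin 3} {e : OpenPartialHomeomorph E3 E3}

/-- The coarea formula for weights supported in the domain of straightened coordinates. -/
theorem IsStraightening.hasCoarea (h : IsStraightening u p j e) {χ : M → ℝ} (hχ : Continuous χ)
    (hχc : HasCompactSupport χ)
    (hχs : tsupport χ ⊆ (chartParam p ∘ e.symm) '' straightDom j e) : HasCoarea u χ := by
  set W := straightDom j e with hW
  set Ψ : E3 → M := chartParam p ∘ e.symm with hΨ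
  have hWm : MeasurableSet W := measurableSet_straightDom j e
  let J₂ : E3 → ℝ := fun z ↦ √(pullGram p (e.symm z) ((fderiv ℝ e.symm z).comp (sliceLin j))).det
  let J₃ : E3 → ℝ := fun z ↦ √(pullGram p (e.symm z) (fderiv ℝ e.symm z)).det
  -- The area density is |∇u| times the volume density. Hence |∇u| against area and |∇u|² against
  -- volume have the same coordinate density.
  have hJ : ∀ z ∈ W, ‖riemGradient u (Ψ z)‖ * J₂ z = gradPair u u (Ψ z) * J₃ z := by
    intro z hz
    have h1 : J₂ z = ‖riemGradient u (Ψ z)‖ * J₃ z := by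
      simp only [J₂, J₃]
      rw [← h.gradPair_mul_det hz, Real.sqrt_mul (gradPair_self_nonneg _ _)]
      exact congrArg (· * _) (norm_riemGradient u (Ψ z)).symm
    rw [h1, gradPair_self]
    ring
  let k : E3 → ℝ := W.indicator fun z ↦ χ (Ψ z) * ‖riemGradient u (Ψ z)‖ * J₂ z
  set K : Set E3 := (e ∘ extChartAt (𝓡∂ 3) p) '' tsupport χ with hK
  have hsub := hχs
  rw [h.image_eq] at hsub
  have hKc : IsCompact K := by
    refine hχc.isCompact.image_of_continuousOn ?_
    refine e.continuousOn.comp ((continuousOn_extChartAt p).mono fun x hx ↦ (hsub hx).1)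
      fun x hx ↦ (hsub hx).2
  have hΨK : ∀ z ∈ W, Ψ z ∈ tsupport χ → z ∈ K := by
    intro z hz hzs
    refine ⟨Ψ z, hzs, ?_⟩
    rw [Function.comp_apply, hΨ, Function.comp_apply,
      (extChartAt (𝓡∂ 3) p).right_inv (h.mapsTo hz), e.right_inv hz.1]
  have hKW : K ⊆ W := by
    rintro _ ⟨x, hx, rfl⟩
    obtain ⟨z, hz, rfl⟩ := hχs hx
    rw [Function.comp_apply, hΨ, Function.comp_apply,
      (extChartAt (𝓡∂ 3) p).right_inv (h.mapsTo hz), e.right_inv hz.1]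
    exact hz
  have hk0 : ∀ z ∉ K, k z = 0 := by
    intro z hz
    by_cases hzW : z ∈ W
    · have : χ (Ψ z) = 0 := by
        by_contra hne
        exact hz (hΨK z hzW (subset_tsupport χ hne))
      simp [k, hzW, this]
    · simp [k, hzW]
  have hgc : Continuous fun x ↦ ‖riemGradient u x‖ := by
    simp only [norm_riemGradient]
    exact Real.continuous_sqrt.comp (contMDiff_gradPair (m := 0) (k := 1) (l := 1)
      (zero_le_one.trans one_le_infty) one_le_infty one_le_infty (by simp) (by simp)
      h.smooth h.smooth one_ne_zero one_ne_zero).continuous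
  have hΨc : ContinuousOn Ψ W := h.hasMetricJacobian.continuousOn
  have hJ₂c : ContinuousOn J₂ W :=
    continuousOn_pullGram_det h.mapsTo (e.continuousOn_symm.mono inter_subset_left)
      ((h.continuousOn_fderiv_symm.mono inter_subset_left).clm_comp continuousOn_const)
  -- The density may jump to 0 beyond level 1, where the manifold ends, so continuity holds only up
  -- to that level. This is why the flux is claimed continuous only on `Iic 1`.
  have hkc : ContinuousOn k {z | z j ≤ 1} := by
    have hprod : ContinuousOn (fun z ↦ χ (Ψ z) * ‖riemGradient u (Ψ z)‖ * J₂ z) W :=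
      ((hχ.comp_continuousOn hΨc).mul (hgc.comp_continuousOn hΨc)).mul hJ₂c
    have hkW : ContinuousOn k W := hprod.congr fun z hz ↦ indicator_of_mem hz _
    intro z hz
    by_cases hzt : z ∈ e.target
    · have := hkW z ⟨hzt, hz⟩
      rwa [hW, straightDom, inter_comm,
        continuousWithinAt_inter (e.open_target.mem_nhds hzt)] at this
    · have hzK : z ∉ K := fun hzK ↦ hzt (hKW hzK).1
      have hev : k =ᶠ[𝓝 z] fun _ ↦ 0 := by
        filter_upwards [hKc.isClosed.isOpen_compl.mem_nhds hzK] with w hw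
        exact hk0 w hw
      exact (continuousAt_const.congr hev.symm).continuousWithinAt
  have hcs : ∀ s, Continuous (slice j s) := fun s ↦
    (continuous_slice j).comp (by fun_prop : Continuous fun v ↦ (s, v))
  have hkint : ∀ φ : ℝ → ℝ, Continuous φ → Integrable fun z ↦ φ (z j) * k z := by
    intro φ hφ
    have hc : ContinuousOn (fun z : E3 ↦ φ (z j) * k z) K :=
      (hφ.comp (by fun_prop : Continuous fun z : E3 ↦ z j)).continuousOn.mul
        (hkc.mono fun z hz ↦ (hKW hz).2)
    refine (integrableOn_iff_integrable_of_support_subset fun z hz ↦ ?_).1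
      (hc.integrableOn_compact hKc)
    by_contra hzK
    exact hz (by simp [hk0 z hzK])
  have hslint : ∀ s, Integrable fun v ↦ k (slice j s v) := by
    intro s
    rcases le_or_gt s 1 with hs | hs
    · have hc : Continuous fun v ↦ k (slice j s v) := by
        rw [← continuousOn_univ]
        exact hkc.comp (hcs s).continuousOn fun v _ ↦ by simpa [slice_same] using hs
      refine hc.integrable_of_hasCompactSupport
        (HasCompactSupport.intro (hKc.image (continuous_sliceProj j)) fun v hv ↦ hk0 _ fun hvK ↦ ?_)
      exact hv ⟨_, hvK, sliceProj_slice j s v⟩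
    · have : (fun v ↦ k (slice j s v)) = fun _ ↦ 0 := by
        ext v
        refine indicator_of_notMem (fun hv ↦ ?_) _
        have : slice j s v j ≤ 1 := hv.2
        rw [slice_same] at this
        linarith
      rw [this]
      exact integrable_zero _ _ _
  have hΨU : MeasurableSet (Ψ '' W) := h.isOpen_image.measurableSet
  have hχ0 : ∀ x ∉ Ψ '' W, χ x = 0 := fun x hx ↦ by
    by_contra hne
    exact hx (hχs (subset_tsupport χ hne))
  have hslice : ∀ s, ∀ v ∈ slice j s ⁻¹' W, J₂ (slice j s v) *
      (χ (Ψ (slice j s v)) * ‖riemGradient u (Ψ (slice j s v))‖) = k (slice j s v) := by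
    intro s v hv
    have hv' : slice j s v ∈ W := hv
    have : k (slice j s v) = _ := indicator_of_mem hv' _
    rw [this]
    ring
  have hintOn : ∀ s, IntegrableOn (fun x ↦ χ x * ‖riemGradient u x‖) {x | u x = s} μHE[2] := by
    intro s
    have h1 : IntegrableOn (fun x ↦ χ x * ‖riemGradient u x‖) ({x | u x = s} ∩ Ψ '' W) μHE[2] := by
      rw [← h.image_slice s, (h.hasMetricJacobian_slice s).integrableOn_image]
      exact ((hslint s).integrableOn (s := slice j s ⁻¹' W)).congr_fun
        (fun v hv ↦ (hslice s v hv).symm) ((hcs s).measurable hWm)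
    exact h1.of_forall_sdiff_eq_zero (measurableSet_eq_fun h.smooth.continuous.measurable
      measurable_const) fun x hx ↦ by rw [hχ0 x fun hxU ↦ hx.2 ⟨hx.1, hxU⟩, zero_mul]
  have hfl : ∀ s, levelFlux u χ s = ∫ v, k (slice j s v) := by
    intro s
    have h1 : levelFlux u χ s =
        ∫ x in {x | u x = s} ∩ Ψ '' W, χ x * ‖riemGradient u x‖ ∂μHE[2] :=
      setIntegral_eq_of_subset_of_forall_sdiff_eq_zero (measurableSet_eq_fun
        h.smooth.continuous.measurable measurable_const) inter_subset_left
        fun x hx ↦ by rw [hχ0 x fun hxU ↦ hx.2 ⟨hx.1, hxU⟩, zero_mul]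
    rw [h1, ← h.image_slice s, (h.hasMetricJacobian_slice s).integral_image]
    refine (setIntegral_congr_fun ((hcs s).measurable hWm) (hslice s)).trans ?_
    refine setIntegral_eq_integral_of_forall_compl_eq_zero fun v hv ↦ ?_
    have hv' : slice j s v ∉ W := hv
    exact indicator_of_notMem hv' _
  have hvol : ∀ φ : ℝ → ℝ, ∀ z ∈ W, J₃ z * (φ (u (Ψ z)) * (χ (Ψ z) * gradPair u u (Ψ z))) =
      φ (z j) * k z := by
    intro φ z hz
    have h1 : k z = _ := indicator_of_mem hz _
    have h2 : u (Ψ z) = z j := h.apply_symm hz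
    rw [h1, h2, mul_assoc (χ _), hJ z hz]
    ring
  have hkz : ∀ φ : ℝ → ℝ, ∀ z ∉ W, φ (z j) * k z = 0 := fun φ z hz ↦ by
    have : k z = 0 := indicator_of_notMem hz _
    rw [this, mul_zero]
  refine ⟨hintOn, ?_, fun φ hφ ↦ ?_, fun φ hφ ↦ ?_, fun φ hφ ↦ ?_⟩
  · rw [funext hfl]
    refine continuousOn_integral_of_compact_support (hKc.image (continuous_sliceProj j)) ?_
      fun s v _ hv ↦ hk0 _ fun hvK ↦ hv ⟨_, hvK, sliceProj_slice j s v⟩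
    exact hkc.comp (continuous_slice j).continuousOn fun q hq ↦ by
      simpa [slice_same] using hq.1
  · have h1 : ∫ x, φ (u x) * (χ x * gradPair u u x) ∂μHE[3] =
        ∫ x in Ψ '' W, φ (u x) * (χ x * gradPair u u x) ∂μHE[3] :=
      (setIntegral_eq_integral_of_forall_compl_eq_zero fun x hx ↦ by
        rw [hχ0 x hx, zero_mul, mul_zero]).symm
    rw [h1, h.hasMetricJacobian.integral_image, setIntegral_congr_fun hWm (hvol φ),
      setIntegral_eq_integral_of_forall_compl_eq_zero (hkz φ),
      integral_eq_integral_slice j (hkint φ hφ)]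
    refine integral_congr_ae (Eventually.of_forall fun s ↦ ?_)
    simp only [slice_same, hfl]
    exact integral_const_mul _ _
  · refine (integrableOn_iff_integrable_of_support_subset (s := Ψ '' W) fun x hx ↦ ?_).1 ?_
    · by_contra hxU
      exact hx (by simp [hχ0 x hxU])
    · rw [h.hasMetricJacobian.integrableOn_image]
      exact ((hkint φ hφ).integrableOn (s := W)).congr_fun (fun z hz ↦ (hvol φ z hz).symm) hWm
  · obtain ⟨hmp, hme⟩ := measurePreserving_slice j
    have h1 := (hmp.integrable_comp_emb hme).2 (hkint φ hφ)
    rw [Measure.volume_eq_prod] at h1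
    have h2 := h1.integral_prod_left
    refine h2.congr (Eventually.of_forall fun s ↦ ?_)
    simp only [Function.comp, slice_same, hfl]
    exact integral_const_mul _ _

variable [SigmaCompactSpace M]

/-- The coarea formula for weights with compact support in the set of regular points. -/
theorem hasCoarea_of_regular (hu : IsHarmonic u)
    (hub : ∀ x ∈ (𝓡∂ 3).boundary M, u x = 1) (hinf : Tendsto u (cocompact M) (𝓝 0))
    {χ : M → ℝ} (hχ : Continuous χ) (hχc : HasCompactSupport χ)
    (hreg : ∀ x ∈ tsupport χ, gradPair u u x ≠ 0) : HasCoarea u χ := by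
  classical
  have hbox : ∀ p ∈ tsupport χ, ∃ U : Set M, IsOpen U ∧ p ∈ U ∧ ∀ χ' : M → ℝ, Continuous χ' →
      HasCompactSupport χ' → tsupport χ' ⊆ U → HasCoarea u χ' := by
    intro p hp
    obtain ⟨j, e, hpe, h1, h2, h3, h4, h5⟩ := exists_straightening hu hub hinf (hreg p hp)
    have hS : IsStraightening u p j e := ⟨hu.1.of_le one_le_two, h1, h2, h3, h4, h5⟩
    refine ⟨_, hS.isOpen_image, ?_, fun χ' hc hcc hs ↦ hS.hasCoarea hc hcc hs⟩
    rw [hS.image_eq]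
    exact ⟨mem_extChartAt_source p, hpe⟩
  choose! U hU hpU hUχ using hbox
  obtain ⟨t, ρ, hti, hρs, hρU, hρ1⟩ := exists_finite_partition hχc.isCompact U hU hpU
  have heq : χ = fun x ↦ ∑ i, ρ i x * χ x := by
    ext x
    rw [← Finset.sum_mul]
    by_cases hx : x ∈ tsupport χ
    · rw [hρ1 x hx, one_mul]
    · rw [image_eq_zero_of_notMem_tsupport hx, mul_zero]
  rw [heq]
  refine HasCoarea.sum Finset.univ fun i _ ↦ hUχ i (hti i) _ ((hρs i).continuous.mul hχ) hχc.mul_left ?_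
  exact (tsupport_mul_subset_left).trans (hρU i)

end Coarea

/-! ### The derivative of |∇u|² along ∇u -/

section GradientBound

variable {M : Type*} [MetricSpace M] [ChartedSpace (EuclideanHalfSpace 3) M]
  [IsManifold (𝓡∂ 3) ∞ M] [RiemannianBundle (fun x : M ↦ TangentSpace (𝓡∂ 3) x)]
  [IsContMDiffRiemannianBundle (𝓡∂ 3) ∞ E3 (fun x : M ↦ TangentSpace (𝓡∂ 3) x)]

set_option linter.unusedSectionVars false

/-- Cauchy–Schwarz for the pairing of ∇u with a coordinate vector: every partial derivative is
O(|∇u|). -/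
theorem abs_chartPartial_le {u : M → ℝ} {p : M} {y : E3} (hy : y ∈ chartDom p)
    (hu : MDifferentiableAt (𝓡∂ 3) 𝓘(ℝ, ℝ) u (chartParam p y)) (i : Fin 3) :
    |chartPartial p u i y| ≤ √(chartMetric p y i i) * √(gradPair u u (chartParam p y)) := by
  rw [← inner_riemGradient_chartDeriv hy hu i]
  refine (abs_real_inner_le_norm _ _).trans ?_
  have h1 : ‖chartDeriv p y (stdVec i)‖ = √(chartMetric p y i i) := by
    rw [chartMetric_apply, real_inner_self_eq_norm_sq, Real.sqrt_sq (norm_nonneg _)]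
  rw [mul_comm, norm_riemGradient]
  exact (congrArg (· * _) h1).le

/-- The derivative of a quadratic form in the functions `h`, with coefficients `B`. -/
theorem abs_fderivWithin_quadratic_le {S : Set E3} {y : E3} (hS : UniqueDiffWithinAt ℝ S y)
    {h : Fin 3 → E3 → ℝ} {B : Fin 3 → Fin 3 → E3 → ℝ}
    (hh : ∀ k, DifferentiableWithinAt ℝ (h k) S y)
    (hB : ∀ k l, DifferentiableWithinAt ℝ (B k l) S y) {C r : ℝ}
    (h1 : ∀ k, |h k y| ≤ C) (h2 : ∀ k, ‖fderivWithin ℝ (h k) S y‖ ≤ C)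
    (h3 : ∀ k l, |B k l y| ≤ C) (h4 : ∀ k l, ‖fderivWithin ℝ (B k l) S y‖ ≤ C)
    (h5 : ∀ k, |h k y| ≤ C * r) (hr : 0 ≤ r) (v : E3) (hv : ‖v‖ ≤ 1) :
    |fderivWithin ℝ (fun z ↦ ∑ k, ∑ l, h k z * B k l z * h l z) S y v| ≤ 27 * C ^ 3 * r := by
  have hC : 0 ≤ C := (abs_nonneg _).trans (h1 0)
  have hd : ∀ k l, HasFDerivWithinAt (fun z ↦ h k z * B k l z * h l z)
      ((h k y * B k l y) • fderivWithin ℝ (h l) S y + h l y • (h k y • fderivWithin ℝ (B k l) S y +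
        B k l y • fderivWithin ℝ (h k) S y)) S y := fun k l ↦
    ((hh k).hasFDerivWithinAt.mul (hB k l).hasFDerivWithinAt).mul (hh l).hasFDerivWithinAt
  have hsum : HasFDerivWithinAt (fun z ↦ ∑ k, ∑ l, h k z * B k l z * h l z)
      (∑ k, ∑ l, ((h k y * B k l y) • fderivWithin ℝ (h l) S y + h l y • (h k y • fderivWithin ℝ (B k l) S y +
        B k l y • fderivWithin ℝ (h k) S y))) S y :=
    HasFDerivWithinAt.fun_sum fun k _ ↦ HasFDerivWithinAt.fun_sum fun l _ ↦ hd k l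
  rw [hsum.fderivWithin hS]
  have hap : ∀ L : E3 →L[ℝ] ℝ, ‖L‖ ≤ C → |L v| ≤ C := fun L hL ↦ by
    have := L.le_of_opNorm_le hL v
    rw [Real.norm_eq_abs] at this
    nlinarith [norm_nonneg v]
  -- Each term of the product rule keeps an undifferentiated factor `h`, which supplies the factor
  -- `C * r`. Three terms for each of the nine pairs give 27.
  have hterm : ∀ k l, |((h k y * B k l y) • fderivWithin ℝ (h l) S y + h l y • (h k y • fderivWithin ℝ (B k l) S y +
        B k l y • fderivWithin ℝ (h k) S y)) v| ≤ 3 * C ^ 3 * r := by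
    intro k l
    simp only [add_apply, smul_apply, smul_eq_mul]
    have a1 : |h k y * B k l y * fderivWithin ℝ (h l) S y v| ≤ C * r * C * C := by
      rw [abs_mul, abs_mul]
      have := hap _ (h2 l)
      have := h5 k
      have := h3 k l
      gcongr
    have a2 : |h l y * (h k y * fderivWithin ℝ (B k l) S y v)| ≤ C * r * (C * C) := by
      rw [abs_mul, abs_mul]
      have := hap _ (h4 k l)
      have := h5 l
      have := h1 k
      gcongr
    have a3 : |h l y * (B k l y * fderivWithin ℝ (h k) S y v)| ≤ C * r * (C * C) := by
      rw [abs_mul, abs_mul]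
      have := hap _ (h2 k)
      have := h5 l
      have := h3 k l
      gcongr
    rw [mul_add]
    refine (abs_add_le _ _).trans ?_
    have := abs_add_le (h l y * (h k y * fderivWithin ℝ (B k l) S y v))
      (h l y * (B k l y * fderivWithin ℝ (h k) S y v))
    nlinarith
  simp only [sum_apply]
  refine (Finset.abs_sum_le_sum_abs _ _).trans ?_
  refine (Finset.sum_le_sum fun k _ ↦ (Finset.abs_sum_le_sum_abs _ _).trans
    (Finset.sum_le_sum fun l _ ↦ hterm k l)).trans ?_
  simp only [Finset.sum_const, Finset.card_univ, Fintype.card_fin, nsmul_eq_mul]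
  push_cast
  linarith

/-- In coordinates |∇u|² is quadratic in the first derivatives, so its derivative is O(|∇u|) with a
constant depending on second derivatives; pairing with ∇u gives the second factor. Only C²
regularity enters. -/
theorem eventually_abs_gradPair_gradPair_le {u : M → ℝ} (hu : ContMDiff (𝓡∂ 3) 𝓘(ℝ, ℝ) 2 u) (p : M) :
    ∃ C : ℝ, ∀ᶠ x in 𝓝 p, |gradPair (gradPair u u) u x| ≤ C * gradPair u u x := by
  set y₀ := extChartAt (𝓡∂ 3) p p with hy₀
  have hyd : y₀ ∈ chartDom p := mem_extChartAt_target p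
  have hud : UniqueDiffOn ℝ (chartDom p) := uniqueDiffOn_extChartAt_target p
  let h : Fin 3 → E3 → ℝ := fun k ↦ chartPartial p u k
  let B : Fin 3 → Fin 3 → E3 → ℝ := fun k l y ↦ (chartMetric p y)⁻¹ k l
  have hh : ∀ k, ContDiffOn ℝ 1 (h k) (chartDom p) := fun k ↦
    contDiffOn_chartPartial two_le_infty (by norm_num) hu p k
  have hB : ∀ k l, ContDiffOn ℝ 1 (B k l) (chartDom p) := fun k l ↦
    (contDiffOn_chartMetric_inv p k l).of_le one_le_infty
  -- All quantities to be bounded are collected in one continuous function, so that a single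
  -- constant controls them near the base point.
  let q : E3 → ℝ := fun y ↦ ‖fun k ↦ h k y‖ + ‖fun k ↦ fderivWithin ℝ (h k) (chartDom p) y‖ +
    ‖fun k l ↦ B k l y‖ + ‖fun k l ↦ fderivWithin ℝ (B k l) (chartDom p) y‖ +
    ‖fun k ↦ √(chartMetric p y k k)‖
  have hq : ContinuousOn q (chartDom p) := by
    refine ((((ContinuousOn.norm ?_).add (ContinuousOn.norm ?_)).add (ContinuousOn.norm ?_)).add
      (ContinuousOn.norm ?_)).add (ContinuousOn.norm ?_)
    · exact continuousOn_pi.2 fun k ↦ (hh k).continuousOn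
    · exact continuousOn_pi.2 fun k ↦ (hh k).continuousOn_fderivWithin hud le_rfl
    · exact continuousOn_pi.2 fun k ↦ continuousOn_pi.2 fun l ↦ (hB k l).continuousOn
    · exact continuousOn_pi.2 fun k ↦ continuousOn_pi.2 fun l ↦
        (hB k l).continuousOn_fderivWithin hud le_rfl
    · exact continuousOn_pi.2 fun k ↦
        Real.continuous_sqrt.comp_continuousOn (chartMetric_contDiffOn p k k).continuousOn
  set C := q y₀ + 1 with hC
  have hev : ∀ᶠ y in 𝓝[chartDom p] y₀, q y < C :=
    (hq y₀ hyd).eventually (gt_mem_nhds (by linarith))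
  have htend : Tendsto (extChartAt (𝓡∂ 3) p) (𝓝 p) (𝓝[chartDom p] y₀) :=
    tendsto_nhdsWithin_iff.2 ⟨continuousAt_extChartAt p, by
      filter_upwards [extChartAt_source_mem_nhds (I := 𝓡∂ 3) p] with x hx
      exact (extChartAt (𝓡∂ 3) p).map_source hx⟩
  -- Nine terms, each at most 27C³r · C · Cr with r = |∇u|.
  refine ⟨243 * C ^ 5, ?_⟩
  filter_upwards [htend.eventually hev, extChartAt_source_mem_nhds (I := 𝓡∂ 3) p] with x hx hxs
  have hxd : extChartAt (𝓡∂ 3) p x ∈ chartDom p := (extChartAt (𝓡∂ 3) p).map_source hxs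
  have hxx : chartParam p (extChartAt (𝓡∂ 3) p x) = x := (extChartAt (𝓡∂ 3) p).left_inv hxs
  set y := extChartAt (𝓡∂ 3) p x with hy
  rw [← hxx]
  have hmd : ∀ z, MDifferentiableAt (𝓡∂ 3) 𝓘(ℝ, ℝ) u z := fun z ↦ hu.mdifferentiable two_ne_zero z
  have hN : ContMDiff (𝓡∂ 3) 𝓘(ℝ, ℝ) 1 (gradPair u u) :=
    contMDiff_gradPair one_le_infty two_le_infty two_le_infty (by norm_num) (by norm_num) hu hu
      two_ne_zero two_ne_zero
  set r := √(gradPair u u (chartParam p y)) with hr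
  have hr0 : 0 ≤ r := Real.sqrt_nonneg _
  have hrr : r * r = gradPair u u (chartParam p y) := Real.mul_self_sqrt (gradPair_self_nonneg _ _)
  have n1 := norm_nonneg fun k ↦ h k y
  have n2 := norm_nonneg fun k ↦ fderivWithin ℝ (h k) (chartDom p) y
  have n3 := norm_nonneg fun k l ↦ B k l y
  have n4 := norm_nonneg fun k l ↦ fderivWithin ℝ (B k l) (chartDom p) y
  have n5 := norm_nonneg fun k ↦ √(chartMetric p y k k)
  have hx' : ‖fun k ↦ h k y‖ + ‖fun k ↦ fderivWithin ℝ (h k) (chartDom p) y‖ +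
    ‖fun k l ↦ B k l y‖ + ‖fun k l ↦ fderivWithin ℝ (B k l) (chartDom p) y‖ +
    ‖fun k ↦ √(chartMetric p y k k)‖ < C := hx
  have b1 : ∀ k, |h k y| ≤ C := fun k ↦ by
    have := norm_le_pi_norm (fun k ↦ h k y) k
    rw [Real.norm_eq_abs] at this
    linarith
  have b2 : ∀ k, ‖fderivWithin ℝ (h k) (chartDom p) y‖ ≤ C := fun k ↦ by
    have := norm_le_pi_norm (fun k ↦ fderivWithin ℝ (h k) (chartDom p) y) k
    linarith
  have b3 : ∀ k l, |B k l y| ≤ C := fun k l ↦ by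
    have h1 := norm_le_pi_norm (fun k l ↦ B k l y) k
    have h2 := norm_le_pi_norm (fun l ↦ B k l y) l
    rw [Real.norm_eq_abs] at h2
    linarith
  have b4 : ∀ k l, ‖fderivWithin ℝ (B k l) (chartDom p) y‖ ≤ C := fun k l ↦ by
    have h1 := norm_le_pi_norm (fun k l ↦ fderivWithin ℝ (B k l) (chartDom p) y) k
    have h2 := norm_le_pi_norm (fun l ↦ fderivWithin ℝ (B k l) (chartDom p) y) l
    linarith
  have hC0 : 0 ≤ C := (abs_nonneg _).trans (b1 0)
  have b5 : ∀ k, |h k y| ≤ C * r := fun k ↦ by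
    refine (abs_chartPartial_le hxd (hmd _) k).trans ?_
    have := norm_le_pi_norm (fun k ↦ √(chartMetric p y k k)) k
    rw [Real.norm_eq_abs, abs_of_nonneg (Real.sqrt_nonneg _)] at this
    have h2 : √(chartMetric p y k k) ≤ C := by linarith
    gcongr
  have hpart : ∀ i, |chartPartial p (gradPair u u) i y| ≤ 27 * C ^ 3 * r := fun i ↦ by
    have heq : chartPartial p (gradPair u u) i y =
        fderivWithin ℝ (fun z ↦ ∑ k, ∑ l, h k z * B k l z * h l z) (chartDom p) y (stdVec i) := by
      rw [chartPartial, ← fderivWithin_chartDom hxd]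
      refine congrArg (fun L : E3 →L[ℝ] ℝ ↦ L (stdVec i)) (fderivWithin_congr (fun z hz ↦ ?_) ?_)
      · exact gradPair_chartParam hz (hmd _) (hmd _)
      · exact gradPair_chartParam hxd (hmd _) (hmd _)
    rw [heq]
    exact abs_fderivWithin_quadratic_le (hud y hxd)
      (fun k ↦ (hh k).differentiableOn one_ne_zero y hxd)
      (fun k l ↦ (hB k l).differentiableOn one_ne_zero y hxd) b1 b2 b3 b4 b5 hr0 _ (by simp [stdVec])
  rw [gradPair_chartParam hxd (hN.mdifferentiable one_ne_zero _) (hmd _), ← hrr]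
  refine (Finset.abs_sum_le_sum_abs _ _).trans ?_
  have hterm : ∀ i j, |chartPartial p (gradPair u u) i y * (chartMetric p y)⁻¹ i j *
      chartPartial p u j y| ≤ 27 * C ^ 3 * r * C * (C * r) := fun i j ↦ by
    rw [abs_mul, abs_mul]
    have := hpart i
    have h3 : |(chartMetric p y)⁻¹ i j| ≤ C := b3 i j
    have h5 : |chartPartial p u j y| ≤ C * r := b5 j
    gcongr
  refine (Finset.sum_le_sum fun k _ ↦ (Finset.abs_sum_le_sum_abs _ _).trans
    (Finset.sum_le_sum fun l _ ↦ hterm k l)).trans ?_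
  simp only [Finset.sum_const, Finset.card_univ, Fintype.card_fin, nsmul_eq_mul]
  push_cast
  apply le_of_eq
  ring

theorem exists_abs_gradPair_gradPair_le {u : M → ℝ} (hu : ContMDiff (𝓡∂ 3) 𝓘(ℝ, ℝ) 2 u) {K : Set M}
    (hK : IsCompact K) :
    ∃ C : ℝ, 0 ≤ C ∧ ∀ x ∈ K, |gradPair (gradPair u u) u x| ≤ C * gradPair u u x := by
  refine hK.induction_on (p := fun S ↦ ∃ C : ℝ, 0 ≤ C ∧ ∀ x ∈ S,
    |gradPair (gradPair u u) u x| ≤ C * gradPair u u x) ⟨0, le_rfl, by simp⟩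
    (fun s t hst ⟨C, h0, hC⟩ ↦ ⟨C, h0, fun x hx ↦ hC x (hst hx)⟩) ?_ ?_
  · rintro s t ⟨C, h0, hC⟩ ⟨C', h0', hC'⟩
    refine ⟨C + C', by positivity, ?_⟩
    rintro x (hx | hx)
    · nlinarith [hC x hx, gradPair_self_nonneg u x]
    · nlinarith [hC' x hx, gradPair_self_nonneg u x]
  · intro p _
    obtain ⟨C, hC⟩ := eventually_abs_gradPair_gradPair_le hu p
    refine ⟨_, mem_nhdsWithin_of_mem_nhds hC, |C|, abs_nonneg C, fun x hx ↦ ?_⟩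
    exact le_trans hx (mul_le_mul_of_nonneg_right (le_abs_self C) (gradPair_self_nonneg u x))

end GradientBound

/-! ### Averages over levels and the weighted flux -/

/-- A continuous probability density on `ℝ`, supported in a compact subinterval of `(a, b)`. -/
structure IsBumpProfile (a b : ℝ) (φ : ℝ → ℝ) : Prop where
  continuous : Continuous φ
  nonneg : ∀ s, 0 ≤ φ s
  integral : ∫ s, φ s = 1
  support : ∃ a' b', a < a' ∧ b' < b ∧ ∀ s ∉ Ioo a' b', φ s = 0

theorem IsBumpProfile.integrable {a b : ℝ} {φ : ℝ → ℝ} (h : IsBumpProfile a b φ) :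
    Integrable φ := by
  by_contra hn
  have := h.integral
  rw [integral_undef hn] at this
  exact zero_ne_one this

theorem exists_isBumpProfile {a b c r : ℝ} (hac : a < c) (hcb : c < b) (hr : 0 < r) :
    ∃ φ, IsBumpProfile a b φ ∧ ∀ s, φ s ≠ 0 → |s - c| < r := by
  set R := min r (min ((c - a) / 2) ((b - c) / 2)) with hR
  have hR0 : 0 < R := lt_min hr (lt_min (by linarith) (by linarith))
  have hRr : R ≤ r := min_le_left _ _
  have hRa : R ≤ (c - a) / 2 := (min_le_right _ _).trans (min_le_left _ _)
  have hRb : R ≤ (b - c) / 2 := (min_le_right _ _).trans (min_le_right _ _)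
  let f : ContDiffBump c := ⟨R / 2, R, by linarith, by linarith⟩
  have hsupp : ∀ s, f.normed volume s ≠ 0 → |s - c| < R := fun s hs ↦ by
    have : s ∈ Function.support (f.normed volume) := hs
    rw [f.support_normed_eq] at this
    exact this
  refine ⟨f.normed volume, ⟨f.continuous_normed, f.nonneg_normed, f.integral_normed,
    c - R, c + R, by linarith, by linarith, fun s hs ↦ ?_⟩, fun s hs ↦ (hsupp s hs).trans_le hRr⟩
  by_contra h
  have := abs_lt.1 (hsupp s h)
  exact hs ⟨by linarith, by linarith⟩

/-- A difference of two such primitives is bounded by 1 and vanishes at and below `a` as well as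
near and above `b`. -/
theorem IsBumpProfile.primitive {a b : ℝ} {φ : ℝ → ℝ} (h : IsBumpProfile a b φ) :
    ∃ a' b', a < a' ∧ b' < b ∧ (∀ s ≤ a', ∫ r in a..s, φ r = 0) ∧ (∀ s, b' ≤ s → ∫ r in a..s, φ r = 1) ∧
      ∀ s, ∫ r in a..s, φ r ∈ Icc 0 1 := by
  obtain ⟨a', b', ha, hb, hs⟩ := h.support
  have h1 : ∀ s ≤ a', ∫ r in a..s, φ r = 0 := fun s hsa ↦ by
    refine intervalIntegral.integral_zero_ae (Eventually.of_forall fun r hr ↦ hs r fun hr' ↦ ?_)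
    have : r ≤ max a s := hr.2
    have h2 := max_le ha.le hsa
    linarith [hr'.1]
  refine ⟨a', b', ha, hb, h1, fun s hbs ↦ ?_, fun s ↦ ?_⟩
  · rcases le_total s a' with hsa | hsa
    · exfalso
      have : ∀ r, φ r = 0 := fun r ↦ hs r fun hr ↦ by linarith [hr.1, hr.2]
      have h2 := h.integral
      simp [this] at h2
    · rw [intervalIntegral.integral_of_le (ha.le.trans hsa), ← h.integral]
      refine setIntegral_eq_integral_of_forall_compl_eq_zero fun r hr ↦ hs r fun hr' ↦ hr ?_
      exact ⟨ha.trans hr'.1, hr'.2.le.trans hbs⟩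
  · rcases le_total s a' with hsa | hsa
    · rw [h1 s hsa]; simp
    · rw [intervalIntegral.integral_of_le (ha.le.trans hsa)]
      refine ⟨setIntegral_nonneg measurableSet_Ioc fun r _ ↦ h.nonneg r, ?_⟩
      rw [← h.integral]
      exact setIntegral_le_integral h.integrable (Eventually.of_forall h.nonneg)

/-- Monotone convergence in which integrability of the limit is a conclusion, drawn from the
convergence of the integrals. -/
theorem integrable_and_integral_eq_of_monotone {α : Type*} [MeasurableSpace α] {μ : Measure α}
    {f : ℕ → α → ℝ} {g : α → ℝ} {L : ℝ} (hf : ∀ n, Integrable (f n) μ) (h0 : ∀ n x, 0 ≤ f n x)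
    (hmono : ∀ x, Monotone fun n ↦ f n x) (hlim : ∀ x, Tendsto (fun n ↦ f n x) atTop (𝓝 (g x)))
    (hL : Tendsto (fun n ↦ ∫ x, f n x ∂μ) atTop (𝓝 L)) : Integrable g μ ∧ ∫ x, g x ∂μ = L := by
  have hg0 : ∀ x, 0 ≤ g x := fun x ↦ ge_of_tendsto' (hlim x) fun n ↦ h0 n x
  have hgm : AEStronglyMeasurable g μ :=
    aestronglyMeasurable_of_tendsto_ae atTop (fun n ↦ (hf n).1) (Eventually.of_forall hlim)
  have h1 : Tendsto (fun n ↦ ∫⁻ x, ENNReal.ofReal (f n x) ∂μ) atTop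
      (𝓝 (∫⁻ x, ENNReal.ofReal (g x) ∂μ)) :=
    lintegral_tendsto_of_tendsto_of_monotone (fun n ↦ (hf n).1.aemeasurable.ennreal_ofReal)
      (Eventually.of_forall fun x m n hmn ↦ ENNReal.ofReal_le_ofReal (hmono x hmn))
      (Eventually.of_forall fun x ↦ (ENNReal.continuous_ofReal.tendsto _).comp (hlim x))
  have h2 : ∫⁻ x, ENNReal.ofReal (g x) ∂μ = ENNReal.ofReal L := by
    refine tendsto_nhds_unique h1 ?_
    refine ((ENNReal.continuous_ofReal.tendsto _).comp hL).congr fun n ↦ ?_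
    exact ofReal_integral_eq_lintegral_ofReal (hf n) (Eventually.of_forall (h0 n))
  have hL0 : 0 ≤ L := ge_of_tendsto' hL fun n ↦ integral_nonneg (h0 n)
  refine ⟨⟨hgm, ?_⟩, ?_⟩
  · rw [hasFiniteIntegral_iff_ofReal (Eventually.of_forall hg0), h2]
    exact ENNReal.ofReal_lt_top
  · rw [integral_eq_lintegral_of_nonneg_ae (Eventually.of_forall hg0) hgm, h2,
      ENNReal.toReal_ofReal hL0]

section Flux

variable {M : Type*} [MetricSpace M] [ChartedSpace (EuclideanHalfSpace 3) M]
  [IsManifold (𝓡∂ 3) ∞ M] [RiemannianBundle (fun x : M ↦ TangentSpace (𝓡∂ 3) x)]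
  [IsContMDiffRiemannianBundle (𝓡∂ 3) ∞ E3 (fun x : M ↦ TangentSpace (𝓡∂ 3) x)]
  [IsRiemannianManifold (𝓡∂ 3) M] [MeasurableSpace M] [BorelSpace M] [SigmaCompactSpace M]
  {u : M → ℝ}

set_option linter.unusedSectionVars false

/-- Weak harmonicity, tested against `Φ(u) χ`. -/
theorem abs_sub_integral_levelFlux_le (hu : IsHarmonic u)
    (hub : ∀ x ∈ (𝓡∂ 3).boundary M, u x = 1) {χ : M → ℝ} (hχ : ContMDiff (𝓡∂ 3) 𝓘(ℝ, ℝ) 1 χ)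
    (hχc : HasCompactSupport χ) (hco : HasCoarea u χ) {a : ℝ} {φ₀ φ₁ : ℝ → ℝ}
    (h₀ : IsBumpProfile a 1 φ₀) (h₁ : IsBumpProfile a 1 φ₁) :
    |(∫ s, φ₁ s * levelFlux u χ s) - ∫ s, φ₀ s * levelFlux u χ s| ≤
      ∫ x in {x | a ≤ u x}, |gradPair χ u x| ∂μHE[3] := by
  have hu1 : ContMDiff (𝓡∂ 3) 𝓘(ℝ, ℝ) 1 u := hu.1.of_le one_le_two
  have := isLocallyFiniteMeasure_volume (M := M)
  set φ : ℝ → ℝ := fun s ↦ φ₁ s - φ₀ s with hφdef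
  have hφ : Continuous φ := h₁.continuous.sub h₀.continuous
  obtain ⟨hder, hsm⟩ := contDiff_one_primitive hφ a
  -- The primitive vanishes near and above 1, so Φ(u)χ is supported off the boundary even if χ is
  -- not. It vanishes at and below `a`, which confines the error to {u ≥ a}, and |Φ| ≤ 1.
  set Φ : ℝ → ℝ := fun s ↦ ∫ r in a..s, φ r with hΦ
  have hΦ' : ∀ s, Φ s = (∫ r in a..s, φ₁ r) - ∫ r in a..s, φ₀ r := fun s ↦
    intervalIntegral.integral_sub (h₁.continuous.intervalIntegrable _ _)
      (h₀.continuous.intervalIntegrable _ _)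
  obtain ⟨a₀, b₀, ha₀, hb₀, hl₀, hr₀, hI₀⟩ := h₀.primitive
  obtain ⟨a₁, b₁, ha₁, hb₁, hl₁, hr₁, hI₁⟩ := h₁.primitive
  have hΦl : ∀ s ≤ min a₀ a₁, Φ s = 0 := fun s hs ↦ by
    rw [hΦ', hl₀ s (hs.trans (min_le_left _ _)), hl₁ s (hs.trans (min_le_right _ _)), sub_zero]
  have hΦr : ∀ s, max b₀ b₁ ≤ s → Φ s = 0 := fun s hs ↦ by
    rw [hΦ', hr₀ s ((le_max_left _ _).trans hs), hr₁ s ((le_max_right _ _).trans hs), sub_self]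
  have hΦ1 : ∀ s, |Φ s| ≤ 1 := fun s ↦ by
    rw [hΦ', abs_le]
    constructor <;> linarith [(hI₀ s).1, (hI₀ s).2, (hI₁ s).1, (hI₁ s).2]
  have hΦu : ContMDiff (𝓡∂ 3) 𝓘(ℝ, ℝ) 1 fun x ↦ Φ (u x) := hsm.contMDiff.comp hu1
  set ζ : M → ℝ := fun x ↦ Φ (u x) * χ x with hζ
  have hζs : ContMDiff (𝓡∂ 3) 𝓘(ℝ, ℝ) 1 ζ := hΦu.mul hχ
  have hts : tsupport ζ ⊆ {x | u x ≤ max b₀ b₁} := by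
    refine closure_minimal (fun x hx ↦ ?_) (isClosed_le hu1.continuous continuous_const)
    by_contra hlt
    have h2 : max b₀ b₁ < u x := not_le.1 hlt
    exact hx (by simp only [hζ, hΦr _ h2.le, zero_mul])
  have h0 := integral_gradPair_eq_zero hu hζs hχc.mul_left fun x hx hb ↦ by
    have h2 : u x ≤ max b₀ b₁ := hts hx
    rw [hub x hb] at h2
    exact absurd h2 (not_le.2 (max_lt hb₀ hb₁))
  have heq : ∀ x, gradPair ζ u x =
      Φ (u x) * gradPair χ u x + φ (u x) * (χ x * gradPair u u x) := fun x ↦ by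
    have h2 := gradPair_mul (g := u) (hΦu.mdifferentiable one_ne_zero x)
      (hχ.mdifferentiable one_ne_zero x)
    have h3 := gradPair_comp (g := u) (hder (u x)) (hu1.mdifferentiable one_ne_zero x)
    rw [h3] at h2
    rw [hζ, h2]
    ring
  have hgc : Continuous (gradPair χ u) := continuous_gradPair hχ hu1
  have hgs : ∀ x ∉ tsupport χ, gradPair χ u x = 0 := fun x hx ↦
    gradPair_eq_zero_of_notMem_tsupport hx
  have hint1 : Integrable (fun x ↦ Φ (u x) * gradPair χ u x) μHE[3] :=
    (hΦu.continuous.mul hgc).integrable_of_hasCompactSupport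
      (HasCompactSupport.intro hχc.isCompact fun x hx ↦ by simp [hgs x hx])
  have hint2 : Integrable (fun x ↦ |gradPair χ u x|) μHE[3] :=
    hgc.abs.integrable_of_hasCompactSupport
      (HasCompactSupport.intro hχc.isCompact fun x hx ↦ by rw [hgs x hx, abs_zero])
  simp only [heq] at h0
  rw [integral_add hint1 (hco.integrable φ hφ), hco.coarea φ hφ] at h0
  have hsub : (∫ s, φ₁ s * levelFlux u χ s) - ∫ s, φ₀ s * levelFlux u χ s =
      ∫ s, φ s * levelFlux u χ s := by
    rw [← integral_sub (hco.integrable_levelFlux _ h₁.continuous)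
      (hco.integrable_levelFlux _ h₀.continuous)]
    simp only [hφdef, sub_mul]
  rw [hsub, show ∫ s, φ s * levelFlux u χ s = -∫ x, Φ (u x) * gradPair χ u x ∂μHE[3] by linarith,
    abs_neg]
  have hm : MeasurableSet {x | a ≤ u x} := (isClosed_le continuous_const hu1.continuous).measurableSet
  have h5 : ∫ x, Φ (u x) * gradPair χ u x ∂μHE[3] =
      ∫ x in {x | a ≤ u x}, Φ (u x) * gradPair χ u x ∂μHE[3] :=
    (setIntegral_eq_integral_of_forall_compl_eq_zero fun x hx ↦ by
      have h2 : u x < a := not_le.1 hx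
      rw [hΦl _ (h2.le.trans (le_min ha₀.le ha₁.le)), zero_mul]).symm
  rw [h5]
  refine (abs_integral_le_integral_abs).trans ?_
  refine integral_mono hint1.integrableOn.abs hint2.integrableOn fun x ↦ ?_
  simp only [abs_mul]
  exact mul_le_of_le_one_left (abs_nonneg _) (hΦ1 _)

/-- For c < 1 one of the two profiles concentrates at c, and continuity of the weighted flux turns
its average into the value there. Level 1 is reached as a one-sided limit. -/
theorem abs_levelFlux_sub_le (hu : IsHarmonic u)
    (hub : ∀ x ∈ (𝓡∂ 3).boundary M, u x = 1) {χ : M → ℝ} (hχ : ContMDiff (𝓡∂ 3) 𝓘(ℝ, ℝ) 1 χ)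
    (hχc : HasCompactSupport χ) (hco : HasCoarea u χ) {a : ℝ} {φ₀ : ℝ → ℝ}
    (h₀ : IsBumpProfile a 1 φ₀) {c : ℝ} (hc : c ∈ Ioc a 1) :
    |levelFlux u χ c - ∫ s, φ₀ s * levelFlux u χ s| ≤
      ∫ x in {x | a ≤ u x}, |gradPair χ u x| ∂μHE[3] := by
  have hopen : ∀ c ∈ Ioo a 1, |levelFlux u χ c - ∫ s, φ₀ s * levelFlux u χ s| ≤
      ∫ x in {x | a ≤ u x}, |gradPair χ u x| ∂μHE[3] := by
    intro c hc
    refine le_of_forall_pos_le_add fun ε hε ↦ ?_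
    have hcont : ContinuousAt (levelFlux u χ) c :=
      hco.continuousOn.continuousAt (Iic_mem_nhds hc.2)
    obtain ⟨r, hr, hrε⟩ := Metric.continuousAt_iff.1 hcont ε hε
    obtain ⟨φ₁, h₁, hs⟩ := exists_isBumpProfile hc.1 hc.2 hr
    have h2 := abs_sub_integral_levelFlux_le hu hub hχ hχc hco h₀ h₁
    have h3 : |levelFlux u χ c - ∫ s, φ₁ s * levelFlux u χ s| ≤ ε := by
      have h4 : levelFlux u χ c - ∫ s, φ₁ s * levelFlux u χ s =
          ∫ s, φ₁ s * (levelFlux u χ c - levelFlux u χ s) := by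
        simp only [mul_sub]
        rw [integral_sub (h₁.integrable.mul_const _) (hco.integrable_levelFlux _ h₁.continuous),
          integral_mul_const, h₁.integral, one_mul]
      rw [h4]
      have h5 : ∫ s, φ₁ s * ε = ε := by rw [integral_mul_const, h₁.integral, one_mul]
      rw [← h5, ← Real.norm_eq_abs]
      refine norm_integral_le_of_norm_le (h₁.integrable.mul_const ε) (Eventually.of_forall fun s ↦ ?_)
      rw [norm_mul, Real.norm_eq_abs, abs_of_nonneg (h₁.nonneg s)]
      by_cases h6 : φ₁ s = 0
      · simp [h6]
      · refine mul_le_mul_of_nonneg_left ?_ (h₁.nonneg s)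
        rw [norm_sub_rev, ← dist_eq_norm]
        exact (hrε (hs s h6)).le
    have h7 := abs_sub_le (levelFlux u χ c) (∫ s, φ₁ s * levelFlux u χ s)
      (∫ s, φ₀ s * levelFlux u χ s)
    linarith
  rcases hc.2.lt_or_eq with h1 | rfl
  · exact hopen c ⟨hc.1, h1⟩
  · have hcw : ContinuousWithinAt (levelFlux u χ) (Ioo a 1) 1 :=
      (hco.continuousOn 1 (show (1 : ℝ) ≤ 1 from le_rfl)).mono fun s hs ↦ hs.2.le
    have hne : (𝓝[Ioo a 1] (1 : ℝ)).NeBot := by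
      rw [← mem_closure_iff_nhdsWithin_neBot, closure_Ioo hc.1.ne]
      exact ⟨hc.1.le, le_rfl⟩
    refine le_of_tendsto (hcw.tendsto.sub_const _).abs ?_
    filter_upwards [self_mem_nhdsWithin] with s hs using hopen s hs

end Flux

/-! ### Removing the cutoff: constancy of the flux -/

/-- A smooth step from `0` on `(-∞, 1]` to `1` on `[2, ∞)`. -/
def smoothStep (r : ℝ) : ℝ := Real.smoothTransition (r - 1)

theorem contDiff_smoothStep : ContDiff ℝ 1 smoothStep :=
  (Real.smoothTransition.contDiff (n := 1)).comp (contDiff_id.sub contDiff_const)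

theorem smoothStep_of_le {r : ℝ} (h : r ≤ 1) : smoothStep r = 0 :=
  Real.smoothTransition.zero_of_nonpos (by linarith)

theorem smoothStep_of_ge {r : ℝ} (h : 2 ≤ r) : smoothStep r = 1 :=
  Real.smoothTransition.one_of_one_le (by linarith)

theorem smoothStep_nonneg (r : ℝ) : 0 ≤ smoothStep r := Real.smoothTransition.nonneg _

theorem smoothStep_le_one (r : ℝ) : smoothStep r ≤ 1 := Real.smoothTransition.le_one _

theorem monotone_smoothStep : Monotone smoothStep := fun _ _ h ↦
  Real.smoothTransition.monotone (by linarith)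

theorem hasDerivAt_smoothStep (r : ℝ) : HasDerivAt smoothStep (deriv smoothStep r) r :=
  (contDiff_smoothStep.differentiable one_ne_zero r).hasDerivAt

theorem deriv_smoothStep_of_lt {r : ℝ} (h : 2 < r) : deriv smoothStep r = 0 := by
  have : smoothStep =ᶠ[𝓝 r] fun _ ↦ 1 := by
    filter_upwards [lt_mem_nhds h] with s hs using smoothStep_of_ge hs.le
  rw [this.deriv_eq, deriv_const]

theorem deriv_smoothStep_of_gt {r : ℝ} (h : r < 1) : deriv smoothStep r = 0 := by
  have : smoothStep =ᶠ[𝓝 r] fun _ ↦ 0 := by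
    filter_upwards [gt_mem_nhds h] with s hs using smoothStep_of_le hs.le
  rw [this.deriv_eq, deriv_const]

/-- The derivative is supported in [1, 2]. Applied at r = (n + 1)|∇u|², the bound compensates the
factor n + 1 produced by differentiating the cutoff. -/
theorem exists_abs_deriv_smoothStep_mul_le : ∃ C, ∀ r, |deriv smoothStep r * r| ≤ C := by
  have hc : Continuous fun r ↦ deriv smoothStep r * r :=
    (contDiff_smoothStep.continuous_deriv le_rfl).mul continuous_id
  refine hc.bounded_above_of_compact_support
    (HasCompactSupport.intro (isCompact_Icc (a := (1 : ℝ)) (b := 2)) fun r hr ↦ ?_)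
  rcases lt_or_ge r 1 with h | h
  · rw [deriv_smoothStep_of_gt h, zero_mul]
  · rcases lt_or_ge 2 r with h' | h'
    · rw [deriv_smoothStep_of_lt h', zero_mul]
    · exact absurd ⟨h, h'⟩ hr

section Flux

variable {M : Type*} [MetricSpace M] [ChartedSpace (EuclideanHalfSpace 3) M]
  [IsManifold (𝓡∂ 3) ∞ M] [RiemannianBundle (fun x : M ↦ TangentSpace (𝓡∂ 3) x)]
  [IsContMDiffRiemannianBundle (𝓡∂ 3) ∞ E3 (fun x : M ↦ TangentSpace (𝓡∂ 3) x)]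
  [IsRiemannianManifold (𝓡∂ 3) M] [MeasurableSpace M] [BorelSpace M]

set_option linter.unusedSectionVars false

/-- The flux of `∇u` through the level sets of `u` is finite and does not depend on the level. -/
theorem exists_flux_eq [SigmaCompactSpace M] {u : M → ℝ} (hu : IsHarmonic u)
    (hub : ∀ x ∈ (𝓡∂ 3).boundary M, u x = 1) (hinf : Tendsto u (cocompact M) (𝓝 0)) {a : ℝ}
    (ha : 0 < a) (ha1 : a < 1) :
    ∃ L : ℝ, ∀ c ∈ Ioc a 1, IntegrableOn (fun x ↦ ‖riemGradient u x‖) {x | u x = c} μHE[2] ∧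
      ∫ x in {x | u x = c}, ‖riemGradient u x‖ ∂μHE[2] = L := by
  have hu1 : ContMDiff (𝓡∂ 3) 𝓘(ℝ, ℝ) 1 u := hu.1.of_le one_le_two
  have huc : Continuous u := hu1.continuous
  have := isLocallyFiniteMeasure_volume (M := M)
  set N : M → ℝ := gradPair u u with hNdef
  have hN : ContMDiff (𝓡∂ 3) 𝓘(ℝ, ℝ) 1 N :=
    contMDiff_gradPair one_le_infty two_le_infty two_le_infty (by norm_num) (by norm_num) hu.1 hu.1
      two_ne_zero two_ne_zero
  have hN0 : ∀ x, 0 ≤ N x := gradPair_self_nonneg u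
  have hcompact : ∀ b > 0, IsCompact {x | b ≤ u x} := fun b hb ↦
    (isCompact_abs_ge huc hinf hb).of_isClosed_subset (isClosed_le continuous_const huc)
      fun x hx ↦ show b ≤ |u x| from le_trans hx (le_abs_self _)
  -- The affine argument sends a/2 to 1 and 3a/4 to 2. Thus κ(u) has compact support and equals 1
  -- near {u ≥ a}, where it adds nothing to the gradient of the cutoff.
  let κ : ℝ → ℝ := fun s ↦ smoothStep (4 / a * s - 1)
  have hκs : ContDiff ℝ 1 κ := contDiff_smoothStep.comp (by fun_prop)
  have hκ0 : ∀ s ≤ a / 2, κ s = 0 := fun s hs ↦ smoothStep_of_le (by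
    have : 4 / a * s ≤ 4 / a * (a / 2) := by gcongr
    have h2 : 4 / a * (a / 2) = 2 := by field_simp; norm_num
    linarith)
  have hκ1 : ∀ s, 3 / 4 * a ≤ s → κ s = 1 := fun s hs ↦ smoothStep_of_ge (by
    have : 4 / a * (3 / 4 * a) ≤ 4 / a * s := by gcongr
    have h2 : 4 / a * (3 / 4 * a) = 3 := by field_simp
    linarith)
  let χ : ℕ → M → ℝ := fun n x ↦ smoothStep ((n + 1) * N x) * κ (u x)
  have hηs : ∀ n : ℕ, ContMDiff (𝓡∂ 3) 𝓘(ℝ, ℝ) 1 fun x ↦ smoothStep ((n + 1) * N x) := fun n ↦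
    (contDiff_smoothStep.comp (by fun_prop : ContDiff ℝ 1 fun r : ℝ ↦ ((n : ℝ) + 1) * r)).contMDiff.comp
      hN
  have hχs : ∀ n, ContMDiff (𝓡∂ 3) 𝓘(ℝ, ℝ) 1 (χ n) := fun n ↦
    (hηs n).mul (hκs.contMDiff.comp hu1)
  have hχ0 : ∀ n x, 0 ≤ χ n x := fun n x ↦ mul_nonneg (smoothStep_nonneg _) (smoothStep_nonneg _)
  have hχ1 : ∀ n x, χ n x ≤ 1 := fun n x ↦
    mul_le_one₀ (smoothStep_le_one _) (smoothStep_nonneg _) (smoothStep_le_one _)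
  have hts : ∀ n, tsupport (χ n) ⊆ {x | a / 2 ≤ u x} ∩ {x | 1 ≤ (n + 1) * N x} := fun n ↦ by
    refine closure_minimal (fun x hx ↦ ?_) ((isClosed_le continuous_const huc).inter
      (isClosed_le continuous_const (continuous_const.mul hN.continuous)))
    constructor
    · by_contra h
      exact hx (by simp only [χ, hκ0 _ (not_le.1 h).le, mul_zero])
    · by_contra h
      exact hx (by simp only [χ, smoothStep_of_le (not_le.1 h).le, zero_mul])
  have hχc : ∀ n, HasCompactSupport (χ n) := fun n ↦
    (hcompact (a / 2) (by linarith)).of_isClosed_subset (isClosed_tsupport _)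
      ((hts n).trans inter_subset_left)
  have hco : ∀ n, HasCoarea u (χ n) := fun n ↦
    hasCoarea_of_regular hu hub hinf (hχs n).continuous (hχc n) fun x hx h0 ↦ by
      have h1 : 1 ≤ (n + 1) * N x := (hts n hx).2
      have h2 : N x = 0 := h0
      rw [h2, mul_zero] at h1
      linarith
  have hlarge : ∀ x, N x ≠ 0 → ∀ᶠ n : ℕ in atTop, 2 < ((n : ℝ) + 1) * N x := fun x hx ↦ by
    have hpos : 0 < N x := lt_of_le_of_ne (hN0 x) (Ne.symm hx)
    filter_upwards [(tendsto_natCast_atTop_atTop (R := ℝ)).eventually_gt_atTop (2 / N x)] with n hn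
    have := (div_lt_iff₀ hpos).1 hn
    nlinarith
  have hχlim : ∀ x, N x ≠ 0 → a ≤ u x → ∀ᶠ n in atTop, χ n x = 1 := fun x hx hux ↦ by
    filter_upwards [hlarge x hx] with n hn
    simp only [χ, smoothStep_of_ge hn.le, hκ1 _ (show 3 / 4 * a ≤ u x by linarith), mul_one]
  have hgrad : ∀ n x, a ≤ u x →
      gradPair (χ n) u x = deriv smoothStep ((n + 1) * N x) * (n + 1) * gradPair N u x := by
    intro n x hx
    have hev : χ n =ᶠ[𝓝 x] fun x ↦ smoothStep ((n + 1) * N x) := by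
      filter_upwards [huc.continuousAt.eventually (lt_mem_nhds (show 3 / 4 * a < u x by linarith))]
        with z hz
      simp only [χ, hκ1 _ hz.le, mul_one]
    rw [gradPair_congr hev]
    refine gradPair_comp (f := N) (Φ := fun r ↦ smoothStep ((n + 1) * r)) ?_
      (hN.mdifferentiable one_ne_zero x)
    have h1 : HasDerivAt (fun r : ℝ ↦ ((n : ℝ) + 1) * r) ((n : ℝ) + 1) (N x) := by
      simpa using (hasDerivAt_id (N x)).const_mul ((n : ℝ) + 1)
    exact (hasDerivAt_smoothStep ((n + 1) * N x)).comp (N x) h1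
  obtain ⟨C, hC0, hC⟩ := exists_abs_gradPair_gradPair_le hu.1 (hcompact a ha)
  obtain ⟨C', hC'⟩ := exists_abs_deriv_smoothStep_mul_le
  have hm : MeasurableSet {x | a ≤ u x} := (isClosed_le continuous_const huc).measurableSet
  -- The integrand is at most C'C because |⟨∇N, ∇u⟩| ≤ C N, and {u ≥ a} has finite volume. Pointwise
  -- it tends to 0: at critical points ⟨∇N, ∇u⟩ = 0, and at regular points (n + 1)N eventually
  -- passes 2, where the step is constant.
  have hD : Tendsto (fun n ↦ ∫ x in {x | a ≤ u x}, |gradPair (χ n) u x| ∂μHE[3]) atTop (𝓝 0) := by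
    have hfin : IsFiniteMeasure ((μHE[3] : Measure M).restrict {x | a ≤ u x}) :=
      ⟨by rw [Measure.restrict_apply_univ]; exact (hcompact a ha).measure_lt_top⟩
    have h0 : ∫ x in {x | a ≤ u x}, (0 : ℝ) ∂(μHE[3] : Measure M) = 0 := integral_zero _ _
    rw [← h0]
    refine tendsto_integral_of_dominated_convergence (fun _ ↦ C' * C)
      (fun n ↦ (continuous_gradPair (hχs n) hu1).abs.aestronglyMeasurable) (integrable_const _)
      (fun n ↦ ?_) ?_
    · filter_upwards [ae_restrict_mem hm] with x hx
      rw [hgrad n x hx, Real.norm_eq_abs, abs_abs, abs_mul]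
      have h1 := hC x hx
      have h2 := hC' ((n + 1) * N x)
      calc |deriv smoothStep ((n + 1) * N x) * (n + 1)| * |gradPair N u x|
          ≤ |deriv smoothStep ((n + 1) * N x) * (n + 1)| * (C * N x) := by gcongr
        _ = |deriv smoothStep ((n + 1) * N x) * ((n + 1) * N x)| * C := by
          rw [← mul_assoc (deriv _ _), abs_mul _ (N x), abs_of_nonneg (hN0 x)]; ring
        _ ≤ C' * C := by gcongr
    · filter_upwards [ae_restrict_mem hm] with x hx
      refine tendsto_const_nhds.congr' ?_
      by_cases hx0 : N x = 0
      · refine Eventually.of_forall fun n ↦ ?_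
        have h1 : |gradPair N u x| ≤ C * N x := hC x hx
        rw [hx0, mul_zero] at h1
        simp only [hgrad n x hx, abs_nonpos_iff.1 h1, mul_zero, abs_zero]
      · filter_upwards [hlarge x hx0] with n hn
        rw [hgrad n x hx, deriv_smoothStep_of_lt hn]
        simp
  obtain ⟨φ₀, h₀, -⟩ := exists_isBumpProfile (a := a) (b := 1) (c := (a + 1) / 2) (r := 1)
    (by linarith) (by linarith) one_pos
  have hφ0 : ∀ s ≤ a, φ₀ s = 0 := by
    obtain ⟨a', b', ha', -, hs⟩ := h₀.support
    exact fun s hsa ↦ hs s fun h ↦ by linarith [h.1]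
  -- The common value of the flux is identified as an energy averaged against φ₀; it does not
  -- involve the level c.
  set L : ℝ := ∫ x, φ₀ (u x) * N x ∂μHE[3] with hL
  have hLlim : Tendsto (fun n ↦ ∫ s, φ₀ s * levelFlux u (χ n) s) atTop (𝓝 L) := by
    have hint : Integrable (fun x ↦ φ₀ (u x) * N x) μHE[3] :=
      ((h₀.continuous.comp huc).mul hN.continuous).integrable_of_hasCompactSupport
        (HasCompactSupport.intro (hcompact a ha) fun x hx ↦ by
          simp [hφ0 _ (not_le.1 hx).le])
    refine Tendsto.congr (fun n ↦ (hco n).coarea φ₀ h₀.continuous) ?_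
    refine tendsto_integral_of_dominated_convergence (fun x ↦ φ₀ (u x) * N x)
      (fun n ↦ ((hco n).integrable φ₀ h₀.continuous).1) hint
      (fun n ↦ Eventually.of_forall fun x ↦ ?_) (Eventually.of_forall fun x ↦ ?_)
    · rw [Real.norm_eq_abs, abs_of_nonneg (mul_nonneg (h₀.nonneg _) (mul_nonneg (hχ0 n x) (hN0 x)))]
      exact mul_le_mul_of_nonneg_left (mul_le_of_le_one_left (hN0 x) (hχ1 n x)) (h₀.nonneg _)
    · refine tendsto_const_nhds.congr' ?_
      rcases le_total (u x) a with hx | hx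
      · exact Eventually.of_forall fun n ↦ by simp only [hφ0 _ hx, zero_mul]
      · by_cases hx0 : N x = 0
        · exact Eventually.of_forall fun n ↦ by
            have : gradPair u u x = 0 := hx0
            simp only [hx0, this, mul_zero]
        · filter_upwards [hχlim x hx0 hx] with n hn
          rw [hn, one_mul]
  refine ⟨L, fun c hc ↦ ?_⟩
  have hF : Tendsto (fun n ↦ levelFlux u (χ n) c) atTop (𝓝 L) := by
    have h1 : Tendsto (fun n ↦ levelFlux u (χ n) c - ∫ s, φ₀ s * levelFlux u (χ n) s) atTop (𝓝 0) :=
      squeeze_zero_norm (fun n ↦ abs_levelFlux_sub_le hu hub (hχs n) (hχc n) (hco n) h₀ hc) hD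
    have h2 := h1.add hLlim
    simpa using h2
  have hS : MeasurableSet {x | u x = c} := (isClosed_eq huc continuous_const).measurableSet
  have hind : ∀ f : M → ℝ, ∫ x, ({x | u x = c}.indicator f) x ∂μHE[2] =
      ∫ x in {x | u x = c}, f x ∂μHE[2] := fun f ↦ integral_indicator hS
  -- The cutoffs increase with n. On the level set the weighted integrand converges to |∇u|
  -- everywhere, since at critical points both are 0.
  have hres := integrable_and_integral_eq_of_monotone (μ := (μHE[2] : Measure M))
    (f := fun n ↦ {x | u x = c}.indicator fun x ↦ χ n x * ‖riemGradient u x‖)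
    (g := {x | u x = c}.indicator fun x ↦ ‖riemGradient u x‖) (L := L)
    (fun n ↦ ((hco n).integrableOn c).integrable_indicator hS)
    (fun n x ↦ indicator_nonneg (fun x _ ↦ mul_nonneg (hχ0 n x) (norm_nonneg _)) x)
    (fun x m n hmn ↦ indicator_le_indicator (mul_le_mul_of_nonneg_right
      (mul_le_mul_of_nonneg_right (monotone_smoothStep (mul_le_mul_of_nonneg_right
        (by have : (m : ℝ) ≤ n := Nat.cast_le.2 hmn
            linarith) (hN0 x))) (smoothStep_nonneg _)) (norm_nonneg _)))
    (fun x ↦ ?_) (hF.congr fun n ↦ (hind _).symm)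
  · rw [integrable_indicator_iff hS, hind] at hres
    exact hres
  · by_cases hx : x ∈ {x | u x = c}
    · simp only [indicator_of_mem hx]
      refine tendsto_const_nhds.congr' ?_
      by_cases hx0 : N x = 0
      · refine Eventually.of_forall fun n ↦ ?_
        have : ‖riemGradient u x‖ = 0 := by
          rw [norm_riemGradient]
          exact Real.sqrt_eq_zero'.2 hx0.le
        simp only [this, mul_zero]
      · have hxa : a ≤ u x := by
          have : u x = c := hx
          rw [this]; exact hc.1.le
        filter_upwards [hχlim x hx0 hxa] with n hn
        rw [hn, one_mul]
    · simp only [indicator_of_notMem hx]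
      exact tendsto_const_nhds

/-- Both c and 1 lie in (c/2, 1], so they share the constant of `exists_flux_eq`. -/
theorem integral_level_eq [SigmaCompactSpace M] {u : M → ℝ} (hu : IsHarmonic u)
    (hub : ∀ x ∈ (𝓡∂ 3).boundary M, u x = 1) (hinf : Tendsto u (cocompact M) (𝓝 0)) {c : ℝ}
    (hc : c ∈ Ioc 0 1) :
    IntegrableOn (fun x ↦ ‖riemGradient u x‖) {x | u x = c} μHE[2] ∧
      ∫ x in {x | u x = c}, ‖riemGradient u x‖ ∂μHE[2] =
        ∫ x in {x | u x = 1}, ‖riemGradient u x‖ ∂μHE[2] := by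
  obtain ⟨L, hL⟩ := exists_flux_eq hu hub hinf (a := c / 2) (by linarith [hc.1])
    (by linarith [hc.1, hc.2])
  obtain ⟨h1, h2⟩ := hL c ⟨by linarith [hc.1], hc.2⟩
  exact ⟨h1, h2.trans (hL 1 ⟨by linarith [hc.1, hc.2], le_rfl⟩).2.symm⟩

/-! ### From u to w = −log u -/

theorem norm_riemGradient_neg_log {u : M → ℝ} {x : M}
    (hu : MDifferentiableAt (𝓡∂ 3) 𝓘(ℝ, ℝ) u x) (hx : u x ≠ 0) :
    ‖riemGradient (fun x ↦ -Real.log (u x)) x‖ = |u x|⁻¹ * ‖riemGradient u x‖ := by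
  have hd : HasDerivAt (fun r ↦ -Real.log r) (-(u x)⁻¹) (u x) := (Real.hasDerivAt_log hx).neg
  have h1 : ∀ g : M → ℝ, gradPair (fun x ↦ -Real.log (u x)) g x = -(u x)⁻¹ * gradPair u g x :=
    fun g ↦ gradPair_comp (g := g) hd hu
  have hcomm : ∀ f g : M → ℝ, gradPair f g x = gradPair g f x := fun f g ↦ real_inner_comm _ _
  rw [norm_riemGradient, norm_riemGradient, h1, hcomm, h1, ← mul_assoc,
    Real.sqrt_mul (mul_self_nonneg _), Real.sqrt_mul_self_eq_abs, abs_neg, abs_inv]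

/-- As `Real.log 0 = 0`, zeros of u belong to {w = 0}. If w is differentiable at such a zero, it is
continuous there, which forces u to vanish nearby and w to be locally constant. Otherwise `mfderiv`
takes its default value 0. -/
theorem riemGradient_neg_log_of_eq_zero {u : M → ℝ} (hu : Continuous u) {x : M} (hx : u x = 0) :
    ‖riemGradient (fun x ↦ -Real.log (u x)) x‖ = 0 := by
  have hmf : mfderiv (𝓡∂ 3) 𝓘(ℝ, ℝ) (fun x ↦ -Real.log (u x)) x = 0 := by
    by_cases hd : MDifferentiableAt (𝓡∂ 3) 𝓘(ℝ, ℝ) (fun x ↦ -Real.log (u x)) x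
    · have hev : ∀ᶠ z in 𝓝 x, u z = 0 := by
        have h1 : ∀ᶠ z in 𝓝 x, -Real.log (u z) < 1 :=
          hd.continuousAt.eventually (gt_mem_nhds (by simp [hx]))
        have h2 : ∀ᶠ z in 𝓝 x, |u z| < Real.exp (-1) :=
          hu.abs.continuousAt.eventually (gt_mem_nhds (by simp [hx, Real.exp_pos]))
        filter_upwards [h1, h2] with z hz1 hz2
        by_contra hne
        have := Real.log_lt_log (abs_pos.2 hne) hz2
        rw [Real.log_abs, Real.log_exp] at this
        linarith
      have heq : (fun x ↦ -Real.log (u x)) =ᶠ[𝓝 x] fun _ ↦ 0 := by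
        filter_upwards [hev] with z hz
        simp [hz]
      rw [heq.mfderiv_eq, mfderiv_const]
      rfl
    · exact mfderiv_zero_of_not_mdifferentiableAt hd
  rw [norm_riemGradient, gradPair_eq_mfderiv, hmf]
  exact Real.sqrt_zero

end Flux

end

theorem proposition2p1 {M : Type*} [MetricSpace M] [ChartedSpace (EuclideanHalfSpace 3) M]
    [IsManifold (𝓡∂ 3) ∞ M] [RiemannianBundle (fun x : M ↦ TangentSpace (𝓡∂ 3) x)]
    [IsContMDiffRiemannianBundle (𝓡∂ 3) ∞ E3 (fun x : M ↦ TangentSpace (𝓡∂ 3) x)]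
    [IsRiemannianManifold (𝓡∂ 3) M] [ConnectedSpace M] [MeasurableSpace M] [BorelSpace M]
    (hAF : IsAsymptoticallyFlat M)
    (hboundary : IsConnected ((𝓡∂ 3).boundary M))
    (u : M → ℝ) (hu : IsHarmonic u)
    (hu_boundary : ∀ x ∈ (𝓡∂ 3).boundary M, u x = 1)
    (hu_infinity : Tendsto u (cocompact M) (𝓝 0))
    (w : M → ℝ) (hw : w = fun x ↦ -Real.log (u x))
    (t : ℝ) (ht : 0 ≤ t) :
    IntegrableOn (fun x ↦ ‖riemGradient w x‖) {x | w x = t} μHE[2] ∧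
      IntegrableOn (fun x ↦ ‖riemGradient w x‖) ((𝓡∂ 3).boundary M) μHE[2] ∧
      ∫ x in {x | w x = t}, ‖riemGradient w x‖ ∂μHE[2] =
        (∫ x in (𝓡∂ 3).boundary M, ‖riemGradient w x‖ ∂μHE[2]) * Real.exp t := by
  have := hAF.sigmaCompactSpace
  have huc : Continuous u := hu.1.continuous
  have hmd : ∀ x, MDifferentiableAt (𝓡∂ 3) 𝓘(ℝ, ℝ) u x := fun x ↦ hu.1.mdifferentiable two_ne_zero x
  have hlev : ∀ c, MeasurableSet {x | u x = c} := fun c ↦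
    (isClosed_eq huc continuous_const).measurableSet
  have hgw : ∀ x, u x ≠ 0 → ‖riemGradient w x‖ = |u x|⁻¹ * ‖riemGradient u x‖ := fun x hx ↦ by
    rw [hw]; exact norm_riemGradient_neg_log (hmd x) hx
  have hreg : ∀ x, gradPair u u x = 0 → ‖riemGradient u x‖ = 0 := fun x hx ↦ by
    rw [norm_riemGradient, hx, Real.sqrt_zero]
  have key : ∀ c ∈ Ioc (0 : ℝ) 1,
      IntegrableOn (fun x ↦ ‖riemGradient w x‖) {x | u x = c} μHE[2] ∧
      ∫ x in {x | u x = c}, ‖riemGradient w x‖ ∂μHE[2] =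
        c⁻¹ * ∫ x in {x | u x = 1}, ‖riemGradient u x‖ ∂μHE[2] := by
    intro c hc
    obtain ⟨h1, h2⟩ := integral_level_eq hu hu_boundary hu_infinity hc
    have heq : ∀ x ∈ {x | u x = c}, ‖riemGradient w x‖ = c⁻¹ * ‖riemGradient u x‖ := fun x hx ↦ by
      have hx' : u x = c := hx
      rw [hgw x (by rw [hx']; exact hc.1.ne'), hx', abs_of_pos hc.1]
    refine ⟨IntegrableOn.congr_fun (h1.const_mul c⁻¹) (fun x hx ↦ (heq x hx).symm) (hlev c), ?_⟩
    rw [setIntegral_congr_fun (hlev c) heq, integral_const_mul, h2]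
  -- Nonnegativity of t keeps the level within the range (0, 1] on which the flux is constant.
  have hc : Real.exp (-t) ∈ Ioc (0 : ℝ) 1 := ⟨Real.exp_pos _, Real.exp_le_one_iff.2 (by linarith)⟩
  obtain ⟨h1, h2⟩ := key _ hc
  obtain ⟨h3, h4⟩ := key 1 ⟨one_pos, le_rfl⟩
  have hsub : {x | u x = Real.exp (-t)} ⊆ {x | w x = t} := fun x hx ↦ by
    have hx' : u x = Real.exp (-t) := hx
    simp [hw, hx']
  have hwm : MeasurableSet {x | w x = t} := by
    rw [hw]
    exact measurableSet_eq_fun (Real.measurable_log.comp huc.measurable).neg measurable_const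
  -- By the conventions for `Real.log`, {w = t} may also contain points with u = −exp(−t) and, when
  -- t = 0, zeros of u. The gradient of w vanishes at all of them.
  have hzero : ∀ x ∈ {x | w x = t} \ {x | u x = Real.exp (-t)}, ‖riemGradient w x‖ = 0 := by
    rintro x ⟨hx, hxn⟩
    have hx' : -Real.log (u x) = t := by rw [hw] at hx; exact hx
    rcases lt_trichotomy (u x) 0 with h | h | h
    · rw [hgw x h.ne, hreg x (gradPair_self_eq_zero_of_neg hu hu_boundary hu_infinity h), mul_zero]
    · rw [hw]; exact riemGradient_neg_log_of_eq_zero huc h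
    · exact absurd (show u x = Real.exp (-t) by rw [← hx', neg_neg, Real.exp_log h]) hxn
  have hbsub : (𝓡∂ 3).boundary M ⊆ {x | u x = 1} := hu_boundary
  -- The level {u = 1} may contain interior points as well, but none of them is regular, so the
  -- boundary carries the whole flux.
  have hbzero : ∀ x ∈ {x | u x = 1} \ (𝓡∂ 3).boundary M, ‖riemGradient w x‖ = 0 := by
    rintro x ⟨hx, hxb⟩
    have hx' : u x = 1 := hx
    rw [hgw x (by rw [hx']; exact one_ne_zero), hreg x, mul_zero]
    by_contra h
    exact (lt_one_of_regular_interior hu hu_boundary hu_infinity h hxb).ne hx'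
  refine ⟨h1.of_forall_sdiff_eq_zero hwm hzero, h3.mono_set hbsub, ?_⟩
  rw [setIntegral_eq_of_subset_of_forall_sdiff_eq_zero hwm hsub hzero, h2,
    ← setIntegral_eq_of_subset_of_forall_sdiff_eq_zero (hlev 1) hbsub hbzero, h4, Real.exp_neg,
    inv_inv, inv_one, one_mul, mul_comm]
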